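/- **Setting.** Let $\varepsilon$ be the totally antisymmetric tensor with $\varepsilon_{123}=1$; repeated indices are summed over $1,2,3$. Let $G=\mathbb R^6$ with coordinates $(x^i,x^*_i)$ and group law $(x,x^*)(y,y^*)=(x+y,\;x^*_i+y^*_i+\tfrac12\varepsilon_{ijk}x^jy^k)$, let $\Gamma\subset G$ be the lattice generated by the three vectors $(e_i,0)$, let $Y=\Gamma\backslash G$, and use $F=[0,1)^6$ as fundamental domain. A smooth function $f$ of the coordinates is regarded, by restriction to $F$, as a (possibly discontinuous) element of $L^2(Y)$, and $\langle\psi|f\rangle=\int_F\overline\psi f$ for $\psi\in L^2(Y)$. *Modes.* Consider the modes $W^i,P_i,x^i_n,x^*_{i,n}$ ($n\in\mathbb Z$) with commutation relations (with $\hbar=1$) $[P_i,P_j]=-\varepsilon_{ijk}W^k$, $[P_i,x^*_{j,n}]=-\tfrac12\varepsilon_{ijk}x^k_n$ (all $n$), $[P_i,x^j_0]=[W^j,x^*_{i,0}]=\delta_i^j$, $[x^*_{i,n},x^j_m]=\tfrac1m\delta_i^j\delta_{m,-n}$ ($m\ne0$), $[x^*_{i,m},x^*_{j,n}]=\tfrac{m+n}{2mn}\varepsilon_{ijk}x^k_{m+n}+\tfrac1{m^2}\varepsilon_{ijk}W^k\delta_{m,-n}$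 ($m,n\neq0$), $[x^*_{i,m},x^*_{j,0}]=\tfrac1{2m}\varepsilon_{ijk}x^k_m$ ($m\ne0$), all other brackets being zero. The modes of degree $0$ act on smooth functions of the coordinates by $W^i=\partial_{x^*_i}$, $P_i=\partial_{x^i}+\tfrac12\varepsilon_{ijk}x^j\partial_{x^*_k}$, and by letting $x^i_0,x^*_{i,0}$ multiply by the coordinates; the modes of positive degree $n>0$ act by $0$. Let $\mathcal H$ be the induced module, with ground states $|f\rangle$. For $\psi\in L^2(Y)$, the bra $\langle\psi|$ is the linear functional on $\mathcal H$ which vanishes on $x^i_{n}\mathcal H$ and $x^*_{i,n}\mathcal H$ for $n<0$ and takes the value $\langle\psi|f\rangle$ on $|f\rangle$. *Vertex operators.* For $u\in\mathbb C^3$ let $e^u=\exp(\sum_iu^ix^*_i)$. Put $\alpha_0=u^ix^*_{i,0}$, $Q_i=P_i-\tfrac12\varepsilon_{ijk}x^j_0W^k$, $\alpha(z)_\pm=u^i\sum_{n\gtrless0}\bigl(x^*_{i,n}+\tfrac12\log z\,\varepsilon_{ijk}W^jx^k_n\bigr)z^{-n}$, and $$e^u(z)=e^{\alpha_0}\,z^{u^iQ_i}\,\exp(\alpha(z)_-)\,\exp(\alpha(z)_+),$$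 a formal series in integral powers of $z$ and natural powers of the formal variable $\log z$, with $z^{u^iQ_i}=\exp(\log z\;u^iQ_i)$. Here $e^{\alpha_0}$ is the operator on $\mathcal H$ with $e^{\alpha_0}|f\rangle=|e^uf\rangle$ and $e^{\alpha_0}\,m=(m+[\alpha_0,m])\,e^{\alpha_0}$ for every mode $m$. *Dilogarithm.* For $|x|<1$, $x\ne 0$, let $L(x)=\sum_{n>0}\frac{x^n}{n^2}+\tfrac12\log(x)\log(1-x)$ be Rogers' dilogarithm, multivalued through $\log x$ (with $\log(1-x)$ principal). Its expansion in the domain $|z|\gg|w|$ is $i_{z,w}L(w/z)=\sum_{n>0}\frac1{n^2}\frac{w^n}{z^n}-\tfrac12(\log w-\log z)\sum_{n>0}\frac1n\frac{w^n}{z^n}$, where $\log z,\log w$ are formal variables. **Proposition.** Let $n_1,n_2,n_3\in\mathbb Z^3$, let $\kappa\in\mathbb C$ be a normalization constant (for example $\kappa=1$ or $\kappa=2\pi\sqrt{-1}$), and put $w_i=\kappa n_i$. Let $\mathrm{vol}(\Delta_E)$ be the oriented volume of the Euclidean tetrahedron with vertices $0,n_1,n_2,n_3$ (its sign is that of $\det(n_1,n_2,n_3)$),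 so that $6\kappa^3\,\mathrm{vol}(\Delta_E)=\varepsilon_{ijk}w_1^iw_2^jw_3^k$. Then for every $\psi\in L^2(Y)$ the bra $\langle\psi|$ exists and is unique, and, as formal series in $z^{\pm1},w^{\pm1},\log z,\log w$, $$\langle\psi|e^{w_1}(z)\,e^{w_2}(w)|e^{w_3}\rangle=i_{z,w}\exp\bigl(6\kappa^3\,\mathrm{vol}(\Delta_E)\,L(w/z)\bigr)\;\langle\psi|e^{w_1}e^{w_2}e^{w_3}\rangle,$$ where the right side is the exponential of the formal series $6\kappa^3\,\mathrm{vol}(\Delta_E)\; i_{z,w}L(w/z)$. For all nonzero complex $z,w$ with $|w|<|z|$ and all choices of $\log z$ and $\log w$, the expansion $i_{z,w}\exp(\cdots)$, as a power series in $w/z$, converges to the number $\exp\bigl(6\kappa^3\,\mathrm{vol}(\Delta_E)\,L(w/z)\bigr)$, where $\log(w/z)=\log w-\log z$ in $L$. -/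

import Mathlib

open scoped BigOperators ComplexConjugate ContDiff Nat TensorProduct
open MeasureTheory

noncomputable section

namespace HDFT

/-! ### The double twisted torus -/

/-- The totally antisymmetric tensor with `eps 0 1 2 = 1`. -/
def eps (i j k : Fin 3) : ℤ :=
  (((j : ℕ) : ℤ) - ((i : ℕ) : ℤ)) * (((k : ℕ) : ℤ) - ((j : ℕ) : ℤ)) *
    (((k : ℕ) : ℤ) - ((i : ℕ) : ℤ)) / 2

/-- Coordinates `(xⁱ, x*ᵢ)` on the six-dimensional group `G`. -/
abbrev Coord : Type := (Fin 3 → ℝ) × (Fin 3 → ℝ)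

/-- The free two-step nilpotent Lie group on `ℝ³`, as a set of coordinates. -/
@[ext] structure G where
  /-- the coordinates `xⁱ` (base) and `x*ᵢ` (fibre) -/
  coord : Coord

namespace G

/-- `(x, x*) (y, y*) = (x + y, x*ᵢ + y*ᵢ + ½ εᵢⱼₖ xʲ yᵏ)`. -/
instance : Mul G where
  mul g h := ⟨(g.coord.1 + h.coord.1, fun i => g.coord.2 i + h.coord.2 i +
    (1 / 2) * ∑ j, ∑ k, (eps i j k : ℝ) * g.coord.1 j * h.coord.1 k)⟩

instance : One G where
  one := ⟨(0, 0)⟩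

instance : Inv G where
  inv g := ⟨(-g.coord.1, -g.coord.2)⟩

theorem mul_def (g h : G) : g * h =
    ⟨(g.coord.1 + h.coord.1, fun i => g.coord.2 i + h.coord.2 i +
      (1 / 2) * ∑ j, ∑ k, (eps i j k : ℝ) * g.coord.1 j * h.coord.1 k)⟩ := rfl

theorem one_def : (1 : G) = ⟨(0, 0)⟩ := rfl

theorem inv_def (g : G) : g⁻¹ = ⟨(-g.coord.1, -g.coord.2)⟩ := rfl

instance : Group G :=
  Group.ofLeftAxioms
    (by
      intro a b c
      simp only [mul_def, G.mk.injEq, Prod.mk.injEq]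
      refine ⟨add_assoc _ _ _, ?_⟩
      funext i
      simp only [Pi.add_apply, mul_add, add_mul, Finset.sum_add_distrib]
      ring)
    (by
      intro a
      simp [mul_def, one_def])
    (by
      intro a
      rcases a with ⟨x, y⟩
      simp only [mul_def, one_def, inv_def, G.mk.injEq, Prod.mk.injEq]
      refine ⟨neg_add_cancel _, ?_⟩
      funext i
      fin_cases i <;> simp [Fin.sum_univ_three, eps] <;> ring)

end G

/-- The lattice `Γ ⊆ G` generated by the three standard basis vectors of `ℝ³`. -/
def Γ : Subgroup G :=
  Subgroup.closure (Set.range fun i : Fin 3 => (⟨(Pi.single i 1, 0)⟩ : G))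

/-- The double twisted torus `Y = Γ \ G`. -/
abbrev Y : Type := MulAction.orbitRel.Quotient Γ G

/-- The projection `G → Y` in coordinates. -/
def toY (p : Coord) : Y := Quotient.mk (MulAction.orbitRel Γ G) (⟨p⟩ : G)

/-- The unit cube, a fundamental domain for the action of `Γ` on `G` by left translations. -/
def fundDomain : Set Coord :=
  {p | (∀ i, p.1 i ∈ Set.Ico (0 : ℝ) 1) ∧ ∀ i, p.2 i ∈ Set.Ico (0 : ℝ) 1}

/-- The quotient σ-algebra on `Y`. -/
instance : MeasurableSpace Y := MeasurableSpace.map toY inferInstance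

/-- The invariant probability measure of `Y`: the image of Lebesgue (Haar) measure on a
fundamental domain. -/
def volY : Measure Y := (volume.restrict fundDomain).map toY

/-- The Hilbert space `L²(Y)`. -/
abbrev L2Y : Type := Lp ℂ 2 volY

/-! ### Zero mode wave functions -/

/-- Wave functions of the zero modes: smooth functions of the coordinates `(xⁱ, x*ᵢ)` on `G`.
Such a function, restricted to the fundamental domain, is a (possibly discontinuous) function on
`Y`; the `Γ`-invariant ones are the elements of `C^∞(Y)`. -/
def Wave : Submodule ℂ (Coord → ℂ) where
  carrier := {f | ContDiff ℝ ∞ f}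
  add_mem' {f g} (hf : ContDiff ℝ ∞ f) (hg : ContDiff ℝ ∞ g) := hf.add hg
  zero_mem' := (contDiff_const : ContDiff ℝ ∞ fun _ : Coord => (0 : ℂ))
  smul_mem' c f (hf : ContDiff ℝ ∞ f) := (contDiff_const (c := c)).mul hf

theorem Wave.contDiff (f : Wave) : ContDiff ℝ ∞ f.1 := f.2

/-- Multiplication of wave functions. -/
def Wave.mul (e f : Wave) : Wave :=
  ⟨fun p => e.1 p * f.1 p, (Wave.contDiff e).mul (Wave.contDiff f)⟩

/-- The exponential function `exp (∑ wʲ x*ⱼ)`. -/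
def expWave (w : Fin 3 → ℂ) : Wave :=
  ⟨fun p => Complex.exp (∑ j, w j * (p.2 j : ℂ)), by
    change ContDiff ℝ ∞ _
    refine ContDiff.cexp (ContDiff.sum fun j _ => contDiff_const.mul ?_)
    exact Complex.ofRealCLM.contDiff.comp (by fun_prop)⟩

/-- The pairing `⟨ψ | f⟩` of `L²(Y)`, evaluated over the fundamental domain on which `f` is
regarded as a function on `Y`. -/
def pairing (ψ : L2Y) (f : Wave) : ℂ :=
  ∫ p in fundDomain, conj (ψ (toY p)) * f.1 p

/-! ### The algebra of modes -/

/-- The modes `Wⁱ`, `Pᵢ`, `xⁱₙ`, `x*ᵢ,ₙ` (`n ∈ ℤ`). -/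
inductive Mode : Type
  | W (i : Fin 3)
  | P (i : Fin 3)
  | x (i : Fin 3) (n : ℤ)
  | xs (i : Fin 3) (n : ℤ)

namespace Mode

/-- The degree of a mode. -/
def degree : Mode → ℤ
  | W _ => 0
  | P _ => 0
  | x _ n => n
  | xs _ n => n

end Mode

/-- The free algebra on the modes. -/
abbrev FreeModes : Type := FreeAlgebra ℂ Mode

/-- A mode as an element of the free algebra. -/
abbrev gen (m : Mode) : FreeModes := FreeAlgebra.ι ℂ m

/-- `∑ₖ εᵢⱼₖ v k`. -/
def epsSum {V : Type} [AddCommGroup V] (i j : Fin 3) (v : Fin 3 → V) : V :=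
  ∑ k, eps i j k • v k

/-- The value of the commutator `[x*ᵢ,ₘ , x*ⱼ,ₙ]`. -/
def xsBracket (i j : Fin 3) (m n : ℤ) : FreeModes :=
  if m = 0 then
    if n = 0 then 0 else (1 / (2 * n) : ℂ) • epsSum i j fun k => gen (.x k n)
  else
    if n = 0 then (1 / (2 * m) : ℂ) • epsSum i j fun k => gen (.x k m)
    else ((m + n) / (2 * m * n) : ℂ) • (epsSum i j fun k => gen (.x k (m + n))) +
      (if m = -n then (1 / (m : ℂ) ^ 2) • epsSum i j fun k => gen (.W k) else 0)

/-- The commutation relations of the modes (with `ħ = 1`), written as `a b = b a + [a, b]`. -/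
inductive Rel : FreeModes → FreeModes → Prop
  | W_W (i j : Fin 3) : Rel (gen (.W i) * gen (.W j)) (gen (.W j) * gen (.W i))
  | P_W (i j : Fin 3) : Rel (gen (.P i) * gen (.W j)) (gen (.W j) * gen (.P i))
  | x_x (i j : Fin 3) (m n : ℤ) :
      Rel (gen (.x i m) * gen (.x j n)) (gen (.x j n) * gen (.x i m))
  | W_x (i j : Fin 3) (n : ℤ) : Rel (gen (.W i) * gen (.x j n)) (gen (.x j n) * gen (.W i))
  | W_xs (i j : Fin 3) (n : ℤ) :
      Rel (gen (.W i) * gen (.xs j n))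
        (gen (.xs j n) * gen (.W i) + if i = j ∧ n = 0 then 1 else 0)
  | P_x (i j : Fin 3) (n : ℤ) :
      Rel (gen (.P i) * gen (.x j n))
        (gen (.x j n) * gen (.P i) + if i = j ∧ n = 0 then 1 else 0)
  | P_P (i j : Fin 3) :
      Rel (gen (.P i) * gen (.P j))
        (gen (.P j) * gen (.P i) - epsSum i j fun k => gen (.W k))
  | P_xs (i j : Fin 3) (n : ℤ) :
      Rel (gen (.P i) * gen (.xs j n))
        (gen (.xs j n) * gen (.P i) - (1 / 2 : ℂ) • epsSum i j fun k => gen (.x k n))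
  | xs_x (i j : Fin 3) (n m : ℤ) :
      Rel (gen (.xs i n) * gen (.x j m))
        (gen (.x j m) * gen (.xs i n) +
          if i = j ∧ m = -n ∧ m ≠ 0 then algebraMap ℂ FreeModes (1 / m) else 0)
  | xs_xs (i j : Fin 3) (m n : ℤ) :
      Rel (gen (.xs i m) * gen (.xs j n)) (gen (.xs j n) * gen (.xs i m) + xsBracket i j m n)

/-- The algebra of modes: the enveloping algebra (at `ħ = 1`) of the Lie algebra spanned by `ħ`
and the modes, that is, the associative algebra with the modes as generators and their
commutation relations as defining relations. -/
def ModeAlg : Type := RingQuot Rel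

instance : Ring ModeAlg := inferInstanceAs (Ring (RingQuot Rel))

instance : Algebra ℂ ModeAlg := inferInstanceAs (Algebra ℂ (RingQuot Rel))

/-- The projection of the free algebra on the algebra of modes. -/
def toModeAlg : FreeModes →ₐ[ℂ] ModeAlg := RingQuot.mkAlgHom ℂ Rel

/-- A mode as an element of the algebra of modes. -/
def op (m : Mode) : ModeAlg := toModeAlg (gen m)

/-- A relation between modes holds between their images in the algebra of modes. -/
theorem op_rel {a b : FreeModes} (h : Rel a b) :
    toModeAlg a = toModeAlg b :=
  RingQuot.mkAlgHom_rel ℂ h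

/-! ### The space of states -/

/-- The derivative of a wave function along a smooth vector field. -/
def Wave.deriv (v : Coord → Coord) (hv : ContDiff ℝ ∞ v) (f : Wave) : Wave :=
  ⟨fun p => fderiv ℝ f.1 p (v p),
    ContDiff.clm_apply (ContDiff.fderiv_right (Wave.contDiff f) (by simp)) hv⟩

/-- Multiplication by the coordinate `xⁱ`. -/
def Wave.mulX (i : Fin 3) (f : Wave) : Wave :=
  Wave.mul ⟨fun p => (p.1 i : ℂ), Complex.ofRealCLM.contDiff.comp
    (by fun_prop : ContDiff ℝ ∞ fun p : Coord => p.1 i)⟩ f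

/-- Multiplication by the coordinate `x*ᵢ`. -/
def Wave.mulXs (i : Fin 3) (f : Wave) : Wave :=
  Wave.mul ⟨fun p => (p.2 i : ℂ), Complex.ofRealCLM.contDiff.comp
    (by fun_prop : ContDiff ℝ ∞ fun p : Coord => p.2 i)⟩ f

/-- The vector field `∂/∂x*ᵢ`. -/
def fieldW (i : Fin 3) : Coord → Coord := fun _ => (0, Pi.single i 1)

/-- The vector field `∂/∂xⁱ + ½ εᵢⱼₖ xʲ ∂/∂x*ₖ`. -/
def fieldP (i : Fin 3) : Coord → Coord := fun p =>
  (Pi.single i 1, fun k => (1 / 2) * ∑ j, (eps i j k : ℝ) * p.1 j)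

theorem fieldW_contDiff (i : Fin 3) : ContDiff ℝ ∞ (fieldW i) := contDiff_const

theorem fieldP_contDiff (i : Fin 3) : ContDiff ℝ ∞ (fieldP i) := by
  unfold fieldP
  fun_prop

/-- The action of the modes of degree `≥ 0` on wave functions: `Wⁱ` and `Pᵢ` act as vector fields,
`xⁱ₀` and `x*ᵢ,₀` act by multiplication, the modes of positive degree act by zero.  (The value
at a mode of negative degree is not used.) -/
def zeroAct : Mode → Wave → Wave
  | .W i, f => Wave.deriv (fieldW i) (fieldW_contDiff i) f
  | .P i, f => Wave.deriv (fieldP i) (fieldP_contDiff i) f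
  | .x i n, f => if n = 0 then Wave.mulX i f else 0
  | .xs i n, f => if n = 0 then Wave.mulXs i f else 0

/-- The left submodule of `ModeAlg ⊗ Wave` generated by the elements `g ⊗ f - 1 ⊗ g f`, where `g`
is a mode of degree `≥ 0`. -/
def indRel : Submodule ModeAlg (ModeAlg ⊗[ℂ] Wave) :=
  Submodule.span ModeAlg
    {t | ∃ (g : Mode) (f : Wave), 0 ≤ g.degree ∧ t = op g ⊗ₜ[ℂ] f - 1 ⊗ₜ[ℂ] zeroAct g f}

/-- The space of states `ℋ`: the module induced from the action on wave functions of the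
modes of degree `≥ 0`. -/
abbrev States : Type := (ModeAlg ⊗[ℂ] Wave) ⧸ indRel

/-- The ground state `|f⟩`. -/
def ket (f : Wave) : States := indRel.mkQ (1 ⊗ₜ[ℂ] f)

/-- `Ψ` is the bra `⟨ψ|`: it is annihilated by the modes of negative degree (creation operators)
acting from the right, and is the pairing with `ψ` on the ground states. -/
def IsBra (ψ : L2Y) (Ψ : States →ₗ[ℂ] ℂ) : Prop :=
  (∀ f : Wave, Ψ (ket f) = pairing ψ f) ∧
    ∀ (g : Mode) (v : States), g.degree < 0 → Ψ (op g • v) = 0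

/-! ### The operator `exp (α₀)` -/

/-- `α₀ = ∑ wⁱ x*ᵢ,₀`. -/
def alphaZero (w : Fin 3 → ℂ) : ModeAlg := ∑ j, w j • op (.xs j 0)

/-- `[α₀, a]`. -/
def adZero (w : Fin 3 → ℂ) : ModeAlg →ₗ[ℂ] ModeAlg :=
  LinearMap.mulLeft ℂ (alphaZero w) - LinearMap.mulRight ℂ (alphaZero w)

theorem adZero_apply (w : Fin 3 → ℂ) (a : ModeAlg) :
    adZero w a = alphaZero w * a - a * alphaZero w := rfl

theorem adZero_eq_sum (w : Fin 3 → ℂ) (a : ModeAlg) :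
    adZero w a = ∑ j, w j • (op (.xs j 0) * a - a * op (.xs j 0)) := by
  simp only [adZero_apply, alphaZero, Finset.sum_mul, Finset.mul_sum, smul_sub,
    Finset.sum_sub_distrib, smul_mul_assoc, mul_smul_comm]

theorem toModeAlg_epsSum (i j : Fin 3) (v : Fin 3 → FreeModes) :
    toModeAlg (epsSum i j v) = epsSum i j fun k => toModeAlg (v k) := by
  simp [epsSum]

theorem adZero_W (w : Fin 3 → ℂ) (i : Fin 3) :
    adZero w (op (.W i)) = algebraMap ℂ ModeAlg (-w i) := by
  have h : ∀ j, op (.xs j 0) * op (.W i) - op (.W i) * op (.xs j 0) =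
      if i = j then (-1 : ModeAlg) else 0 := by
    intro j
    have := op_rel (Rel.W_xs i j 0)
    simp only [map_add, map_mul] at this
    by_cases hij : i = j <;> simp [hij, op] at this ⊢ <;> simp [this]
  simp only [adZero_eq_sum, h]
  simp [Algebra.algebraMap_eq_smul_one]

theorem adZero_x (w : Fin 3 → ℂ) (i : Fin 3) (n : ℤ) : adZero w (op (.x i n)) = 0 := by
  have h : ∀ j, op (.xs j 0) * op (.x i n) - op (.x i n) * op (.xs j 0) = 0 := by
    intro j
    have := op_rel (Rel.xs_x j i 0 n)
    simp only [map_add, map_mul] at this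
    have hn : ¬ (j = i ∧ n = -0 ∧ n ≠ 0) := by
      rintro ⟨-, h, h'⟩
      exact h' (by simpa using h)
    simp only [hn, if_false, map_zero, add_zero] at this
    simpa [op, sub_eq_zero] using this
  simp [adZero_eq_sum, h]

theorem adZero_P (w : Fin 3 → ℂ) (i : Fin 3) :
    adZero w (op (.P i)) = ∑ j, w j • (1 / 2 : ℂ) • epsSum i j fun k => op (.x k 0) := by
  have h : ∀ j, op (.xs j 0) * op (.P i) - op (.P i) * op (.xs j 0) =
      (1 / 2 : ℂ) • epsSum i j fun k => op (.x k 0) := by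
    intro j
    have := op_rel (Rel.P_xs i j 0)
    simp only [map_sub, map_mul, map_smul, toModeAlg_epsSum] at this
    simp [op, this]
  simp only [adZero_eq_sum, h]

theorem adZero_xs (w : Fin 3 → ℂ) (i : Fin 3) (n : ℤ) :
    adZero w (op (.xs i n)) =
      if n = 0 then 0 else ∑ j, w j • (1 / (2 * n) : ℂ) • epsSum j i fun k => op (.x k n) := by
  have h : ∀ j, op (.xs j 0) * op (.xs i n) - op (.xs i n) * op (.xs j 0) =
      if n = 0 then 0 else (1 / (2 * n) : ℂ) • epsSum j i fun k => op (.x k n) := by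
    intro j
    have := op_rel (Rel.xs_xs j i 0 n)
    simp only [map_add, map_mul, xsBracket, if_true] at this
    by_cases hn : n = 0
    · subst hn
      simpa [op, sub_eq_zero] using this
    · simp only [hn, if_false, map_smul, toModeAlg_epsSum] at this ⊢
      simp [op, this]
  simp only [adZero_eq_sum, h]
  split_ifs <;> simp

/-- The span of `1` and of the modes `xⁱₙ`. -/
def xSpan : Submodule ℂ ModeAlg :=
  Submodule.span ℂ ({1} ∪ {a | ∃ i n, a = op (.x i n)})

theorem xSpan_commute {a b : ModeAlg} (ha : a ∈ xSpan) (hb : b ∈ xSpan) : a * b = b * a := by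
  unfold xSpan at ha hb
  induction ha, hb using Submodule.span_induction₂ with
  | mem_mem a b ha hb =>
    rcases ha with rfl | ⟨i, n, rfl⟩
    · simp
    · rcases hb with rfl | ⟨j, m, rfl⟩
      · simp
      · have := op_rel (Rel.x_x i j n m)
        simp only [map_mul] at this
        exact this
  | zero_left => simp
  | zero_right => simp
  | add_left a b c _ _ _ h h' => simp [add_mul, mul_add, h, h']
  | add_right a b c _ _ _ h h' => simp [add_mul, mul_add, h, h']
  | smul_left r a b _ _ h => simp [h]
  | smul_right r a b _ _ h => simp [h]

theorem epsSum_mem_xSpan (i j : Fin 3) (n : ℤ) : (epsSum i j fun k => op (.x k n)) ∈ xSpan :=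
  Submodule.sum_mem _ fun _ _ => zsmul_mem
    (Submodule.subset_span (Or.inr ⟨_, n, rfl⟩) : op (.x _ n) ∈ xSpan) _

theorem adZero_mem_xSpan (w : Fin 3 → ℂ) (g : Mode) : adZero w (op g) ∈ xSpan := by
  cases g with
  | W i =>
    rw [adZero_W, Algebra.algebraMap_eq_smul_one]
    exact Submodule.smul_mem _ _ (Submodule.subset_span (Or.inl rfl))
  | P i =>
    rw [adZero_P]
    exact Submodule.sum_mem _ fun j _ => Submodule.smul_mem _ _ (Submodule.smul_mem _ _
      (epsSum_mem_xSpan _ _ _))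
  | x i n => rw [adZero_x]; exact Submodule.zero_mem _
  | xs i n =>
    rw [adZero_xs]
    split_ifs
    · exact Submodule.zero_mem _
    · exact Submodule.sum_mem _ fun j _ => Submodule.smul_mem _ _ (Submodule.smul_mem _ _
        (epsSum_mem_xSpan _ _ _))

/-- `exp (ad α₀)` on the modes; as `(ad α₀)²` vanishes on them, it is `g ↦ g + [α₀, g]`. -/
def shift (w : Fin 3 → ℂ) (g : Mode) : ModeAlg := op g + adZero w (op g)

theorem adZero_adZero (w : Fin 3 → ℂ) (g : Mode) : adZero w (adZero w (op g)) = 0 := by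
  have h : ∀ a ∈ xSpan, adZero w a = 0 := by
    intro a ha
    unfold xSpan at ha
    induction ha using Submodule.span_induction with
    | mem a ha =>
      rcases ha with rfl | ⟨i, n, rfl⟩
      · simp [adZero_apply]
      · exact adZero_x w i n
    | zero => simp
    | add a b _ _ h h' => simp [h, h']
    | smul r a _ h => simp [h]
  exact h _ (adZero_mem_xSpan w g)

/-- The span of `1` and of all modes in the free algebra. -/
def linSpan : Submodule ℂ FreeModes := Submodule.span ℂ ({1} ∪ Set.range gen)

theorem gen_mem (g : Mode) : gen g ∈ linSpan := Submodule.subset_span (Or.inr ⟨g, rfl⟩)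

theorem one_mem_linSpan : (1 : FreeModes) ∈ linSpan := Submodule.subset_span (Or.inl rfl)

theorem epsSum_mem (i j : Fin 3) (g : Fin 3 → Mode) :
    (epsSum i j fun k => gen (g k)) ∈ linSpan :=
  Submodule.sum_mem _ fun _ _ => zsmul_mem (gen_mem _) _

theorem lift_shift_lin (w : Fin 3 → ℂ) {c : FreeModes} (hc : c ∈ linSpan) :
    FreeAlgebra.lift ℂ (shift w) c = toModeAlg c + adZero w (toModeAlg c) := by
  unfold linSpan at hc
  induction hc using Submodule.span_induction with
  | mem a ha =>
    rcases ha with rfl | ⟨g, rfl⟩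
    · simp [adZero_apply]
    · rw [FreeAlgebra.lift_ι_apply]; rfl
  | zero => simp
  | add a b _ _ h h' => simp only [map_add, h, h']; abel
  | smul r a _ h => simp only [map_smul, h, smul_add]

theorem lift_shift_rel (w : Fin 3 → ℂ) (a b : Mode) (c : FreeModes) (hc : c ∈ linSpan)
    (h : toModeAlg (gen a * gen b) = toModeAlg (gen b * gen a + c)) :
    FreeAlgebra.lift ℂ (shift w) (gen a * gen b) =
      FreeAlgebra.lift ℂ (shift w) (gen b * gen a + c) := by
  simp only [map_mul, map_add, lift_shift_lin w hc, FreeAlgebra.lift_ι_apply, shift] at h ⊢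
  have hD := xSpan_commute (adZero_mem_xSpan w a) (adZero_mem_xSpan w b)
  change op a * op b = op b * op a + _ at h
  have hc' : toModeAlg c = op a * op b - op b * op a := by rw [h]; abel
  rw [hc', ← sub_eq_zero]
  have : ∀ A B x : ModeAlg, (A + (x * A - A * x)) * (B + (x * B - B * x)) -
      ((B + (x * B - B * x)) * (A + (x * A - A * x)) + (A * B - B * A +
        (x * (A * B - B * A) - (A * B - B * A) * x))) =
      (x * A - A * x) * (x * B - B * x) - (x * B - B * x) * (x * A - A * x) := by
    intro A B x
    noncomm_ring
  simp only [adZero_apply] at hD ⊢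
  rw [this, hD, sub_self]

theorem lift_shift_of_rel (w : Fin 3 → ℂ) ⦃a b : FreeModes⦄ (h : Rel a b) :
    FreeAlgebra.lift ℂ (shift w) a = FreeAlgebra.lift ℂ (shift w) b := by
  have key := lift_shift_rel w
  have h0 := op_rel h
  have z := Submodule.zero_mem linSpan
  cases h with
  | W_W i j => simpa using key (.W i) (.W j) 0 z (by simpa using h0)
  | P_W i j => simpa using key (.P i) (.W j) 0 z (by simpa using h0)
  | x_x i j m n => simpa using key (.x i m) (.x j n) 0 z (by simpa using h0)
  | W_x i j n => simpa using key (.W i) (.x j n) 0 z (by simpa using h0)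
  | W_xs i j n =>
    exact key _ _ _ (by split_ifs; exacts [one_mem_linSpan, z]) h0
  | P_x i j n =>
    exact key _ _ _ (by split_ifs; exacts [one_mem_linSpan, z]) h0
  | P_P i j =>
    rw [sub_eq_add_neg] at h0 ⊢
    exact key _ _ _ (neg_mem (epsSum_mem _ _ _)) h0
  | P_xs i j n =>
    rw [sub_eq_add_neg] at h0 ⊢
    exact key _ _ _ (neg_mem (Submodule.smul_mem _ _ (epsSum_mem _ _ _))) h0
  | xs_x i j n m =>
    refine key _ _ _ ?_ h0
    split_ifs
    · rw [Algebra.algebraMap_eq_smul_one]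
      exact Submodule.smul_mem _ _ one_mem_linSpan
    · exact z
  | xs_xs i j m n =>
    refine key _ _ _ ?_ h0
    unfold xsBracket
    split_ifs <;>
    first
    | exact z
    | exact Submodule.smul_mem _ _ (epsSum_mem _ _ _)
    | exact add_mem (Submodule.smul_mem _ _ (epsSum_mem _ _ _))
        (Submodule.smul_mem _ _ (epsSum_mem _ _ _))
    | exact add_mem (Submodule.smul_mem _ _ (epsSum_mem _ _ _)) z

/-- The automorphism `exp (ad α₀)` of the algebra of modes. -/
def conjExp (w : Fin 3 → ℂ) : ModeAlg →ₐ[ℂ] ModeAlg :=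
  RingQuot.liftAlgHom ℂ ⟨FreeAlgebra.lift ℂ (shift w), lift_shift_of_rel w⟩

theorem conjExp_op (w : Fin 3 → ℂ) (g : Mode) : conjExp w (op g) = shift w g := by
  unfold conjExp op toModeAlg
  erw [RingQuot.liftAlgHom_mkAlgHom_apply]
  exact FreeAlgebra.lift_ι_apply _ _

/-- Multiplication by `exp (∑ wʲ x*ⱼ)` as a linear map. -/
def mulExp (w : Fin 3 → ℂ) : Wave →ₗ[ℂ] Wave where
  toFun f := Wave.mul (expWave w) f
  map_add' _ _ := Subtype.ext (funext fun _ => mul_add _ _ _)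
  map_smul' _ _ := Subtype.ext (funext fun _ => mul_left_comm _ _ _)

/-- `a ⊗ f ↦ exp (α₀) a exp (-α₀) ⊗ exp (α₀) f`. -/
def preExp (w : Fin 3 → ℂ) : ModeAlg ⊗[ℂ] Wave →ₗ[ℂ] ModeAlg ⊗[ℂ] Wave :=
  TensorProduct.map (conjExp w).toLinearMap (mulExp w)

theorem preExp_smul (w : Fin 3 → ℂ) (a : ModeAlg) (t : ModeAlg ⊗[ℂ] Wave) :
    preExp w (a • t) = conjExp w a • preExp w t := by
  induction t using TensorProduct.induction_on with
  | zero => simp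
  | tmul b f => simp [preExp, TensorProduct.smul_tmul']
  | add s t hs ht => simp [smul_add, hs, ht]

/-- `f ↦ |f⟩` is linear. -/
def ketLin : Wave →ₗ[ℂ] States :=
  (indRel.mkQ.restrictScalars ℂ).comp (TensorProduct.mk ℂ ModeAlg Wave 1)

theorem ketLin_apply (f : Wave) : ketLin f = ket f := rfl

theorem mkQ_tmul (a : ModeAlg) (f : Wave) : indRel.mkQ (a ⊗ₜ[ℂ] f) = a • ketLin f := by
  rw [ketLin_apply, ket, ← map_smul, TensorProduct.smul_tmul', smul_eq_mul, mul_one]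

theorem op_smul_ket (g : Mode) (hg : 0 ≤ g.degree) (f : Wave) :
    op g • ketLin f = ketLin (zeroAct g f) := by
  rw [← mkQ_tmul, ← sub_eq_zero, ketLin_apply, ket, ← map_sub, Submodule.mkQ_apply,
    Submodule.Quotient.mk_eq_zero]
  exact Submodule.subset_span ⟨g, f, hg, rfl⟩

theorem zeroAct_W (i : Fin 3) (f : Wave) :
    zeroAct (.W i) f = Wave.deriv (fieldW i) (fieldW_contDiff i) f := rfl

theorem zeroAct_P (i : Fin 3) (f : Wave) :
    zeroAct (.P i) f = Wave.deriv (fieldP i) (fieldP_contDiff i) f := rfl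

theorem zeroAct_x (i : Fin 3) (n : ℤ) (f : Wave) :
    zeroAct (.x i n) f = if n = 0 then Wave.mulX i f else 0 := rfl

theorem zeroAct_xs (i : Fin 3) (n : ℤ) (f : Wave) :
    zeroAct (.xs i n) f = if n = 0 then Wave.mulXs i f else 0 := rfl

theorem deriv_mulExp (w : Fin 3 → ℂ) (v : Coord → Coord) (hv : ContDiff ℝ ∞ v) (f : Wave)
    (p : Coord) : (Wave.deriv v hv (mulExp w f)).1 p =
      (mulExp w (Wave.deriv v hv f)).1 p +
        (∑ j, w j * ((v p).2 j : ℂ)) * (mulExp w f).1 p := by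
  have hlin : HasFDerivAt (fun p : Coord => ∑ j, w j * (p.2 j : ℂ))
      (∑ j, w j • (Complex.ofRealCLM.comp ((ContinuousLinearMap.proj j).comp
        (ContinuousLinearMap.snd ℝ (Fin 3 → ℝ) (Fin 3 → ℝ))))) p := by
    refine HasFDerivAt.fun_sum fun j _ => HasFDerivAt.const_mul ?_ _
    exact ContinuousLinearMap.hasFDerivAt (Complex.ofRealCLM.comp
      ((ContinuousLinearMap.proj j).comp (ContinuousLinearMap.snd ℝ (Fin 3 → ℝ) (Fin 3 → ℝ))))
  have hf : DifferentiableAt ℝ f.1 p :=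
    (Wave.contDiff f).differentiable (by simp) p
  have := (hlin.cexp.mul hf.hasFDerivAt).fderiv
  change fderiv ℝ ((fun q : Coord => Complex.exp (∑ j, w j * (q.2 j : ℂ))) * f.1) p (v p) =
    Complex.exp (∑ j, w j * (p.2 j : ℂ)) * fderiv ℝ f.1 p (v p) +
      (∑ j, w j * ((v p).2 j : ℂ)) * (Complex.exp (∑ j, w j * (p.2 j : ℂ)) * f.1 p)
  rw [this]
  simp
  ring

theorem shift_smul_ket (w : Fin 3 → ℂ) (g : Mode) (hg : 0 ≤ g.degree) (f : Wave) :
    shift w g • ketLin (mulExp w f) = ketLin (mulExp w (zeroAct g f)) := by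
  have hx : ∀ (i j : Fin 3) (n : ℤ) (_ : 0 ≤ n) (u : Wave),
      (epsSum i j fun k => op (.x k n)) • ketLin u =
        ketLin (∑ k, eps i j k • zeroAct (.x k n) u) := by
    intro i j n hn u
    simp only [epsSum, Finset.sum_smul, map_sum, map_zsmul]
    refine Finset.sum_congr rfl fun k _ => ?_
    rw [← op_smul_ket (.x k n) hn, smul_assoc]
  rw [shift, add_smul, op_smul_ket g hg]
  cases g with
  | W i =>
    rw [adZero_W, algebraMap_smul, ← map_smul, ← map_add]
    congr 1
    ext p
    change (Wave.deriv _ (fieldW_contDiff i) (mulExp w f)).1 p + -w i * (mulExp w f).1 p =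
      (mulExp w (Wave.deriv _ (fieldW_contDiff i) f)).1 p
    rw [deriv_mulExp]
    simp [fieldW, Pi.single_apply, apply_ite (Complex.ofReal)]
  | P i =>
    rw [adZero_P]
    simp only [Finset.sum_smul, smul_assoc, hx i _ 0 le_rfl, ← map_smul, ← map_sum, ← map_add]
    congr 1
    ext p
    change (Wave.deriv _ (fieldP_contDiff i) (mulExp w f)).1 p + _ =
      (mulExp w (Wave.deriv _ (fieldP_contDiff i) f)).1 p
    rw [deriv_mulExp]
    have hX : ∀ k, (zeroAct (.x k 0) (mulExp w f)).1 p = (p.1 k : ℂ) * (mulExp w f).1 p :=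
      fun k => rfl
    generalize mulExp w f = F at *
    have hS : ∀ j, (∑ k, eps i j k • zeroAct (.x k 0) F).1 p =
        ∑ k, (eps i j k : ℂ) * ((p.1 k : ℂ) * F.1 p) := by
      intro j
      rw [Submodule.coe_sum, Finset.sum_apply]
      refine Finset.sum_congr rfl fun k _ => ?_
      rw [← hX, ← zsmul_eq_mul]
      rfl
    have hT : (∑ j, w j • (1 / 2 : ℂ) • ∑ k, eps i j k • zeroAct (.x k 0) F).1 p =
        ∑ j, w j * (1 / 2 * ∑ k, (eps i j k : ℂ) * ((p.1 k : ℂ) * F.1 p)) := by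
      rw [Submodule.coe_sum, Finset.sum_apply]
      refine Finset.sum_congr rfl fun j _ => ?_
      rw [← hS]
      rfl
    rw [hT]
    fin_cases i <;> simp [fieldP, Fin.sum_univ_three, eps] <;> ring
  | x i n =>
    rw [adZero_x, zero_smul, add_zero]
    congr 1
    simp only [zeroAct_x]
    split_ifs
    · ext p; exact mul_left_comm _ _ _
    · simp
  | xs i n =>
    have h0 : adZero w (op (.xs i n)) • ketLin (mulExp w f) = 0 := by
      rw [adZero_xs]
      split_ifs with hn
      · simp
      · simp only [Finset.sum_smul, smul_assoc, hx _ i n hg]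
        simp [zeroAct, hn]
    rw [h0, add_zero]
    congr 1
    simp only [zeroAct_xs]
    split_ifs
    · ext p; exact mul_left_comm _ _ _
    · simp

theorem preExp_mem (w : Fin 3 → ℂ) {t : ModeAlg ⊗[ℂ] Wave} (ht : t ∈ indRel) :
    preExp w t ∈ indRel := by
  unfold indRel at ht
  induction ht using Submodule.span_induction with
  | mem t ht =>
    obtain ⟨g, f, hg, rfl⟩ := ht
    rw [← Submodule.Quotient.mk_eq_zero, ← Submodule.mkQ_apply, map_sub, map_sub]
    simp only [preExp, TensorProduct.map_tmul, mkQ_tmul, AlgHom.toLinearMap_apply, conjExp_op,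
      map_one, one_smul]
    rw [shift_smul_ket w g hg, sub_self]
  | zero => simp
  | add s t _ _ hs ht => rw [map_add]; exact add_mem hs ht
  | smul a t _ ht => rw [preExp_smul]; exact Submodule.smul_mem _ _ ht

/-- The operator `exp (α₀)` on the space of states: `exp (α₀) |f⟩ = |exp (∑ wʲ x*ⱼ) f⟩` and
`exp (α₀) a exp (-α₀) = exp (ad α₀) a`. -/
def expZero (w : Fin 3 → ℂ) : States →ₗ[ℂ] States :=
  (Submodule.liftQ (indRel.restrictScalars ℂ) ((indRel.mkQ.restrictScalars ℂ).comp (preExp w))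
    (fun t ht => by
      change indRel.mkQ (preExp w t) = 0
      rw [Submodule.mkQ_apply, Submodule.Quotient.mk_eq_zero]
      exact preExp_mem w ht)).comp
    (Submodule.Quotient.restrictScalarsEquiv ℂ indRel).symm.toLinearMap

theorem expZero_ket (w : Fin 3 → ℂ) (f : Wave) :
    expZero w (ket f) = ket (Wave.mul (expWave w) f) := by
  change indRel.mkQ (preExp w (1 ⊗ₜ[ℂ] f)) = _
  simp only [preExp, TensorProduct.map_tmul, AlgHom.toLinearMap_apply, map_one]
  rfl

theorem expZero_op (w : Fin 3 → ℂ) (g : Mode) (v : States) :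
    expZero w (op g • v) =
      (op g + (alphaZero w * op g - op g * alphaZero w)) • expZero w v := by
  obtain ⟨t, rfl⟩ := Submodule.Quotient.mk_surjective _ v
  change indRel.mkQ (preExp w (op g • t)) = _ • indRel.mkQ (preExp w t)
  rw [preExp_smul, map_smul, conjExp_op]
  rfl

/-! ### Vertex operators

A formal series in integral powers of `z` and natural powers of `log z`, with coefficients in the
operators on `ℋ`, is given by its coefficients at `zᵃ (log z)ᵖ`. A power series in the outer
variable `z` (or `z⁻¹`) has coefficients that are power series in the inner variable `log z`. -/

/-- The exponential of a power series without constant term; the terms with `k > n` of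
`∑ fᵏ / k!` do not contribute to the coefficient of degree `n`. -/
def formalExp {R : Type} [Ring R] [Algebra ℂ R] (f : PowerSeries R) : PowerSeries R :=
  PowerSeries.mk fun n => ∑ k ∈ Finset.range (n + 1),
    ((k ! : ℂ)⁻¹) • PowerSeries.coeff n (f ^ k)

/-- The series `∑_{n > 0} (wⁱ x*ᵢ,ₛₙ + ½ log z wⁱ εᵢⱼₖ Wʲ xᵏₛₙ) uⁿ` with `s = ±1`. It is `α(z)₊`
for `s = 1`, `u = z⁻¹`, and `α(z)₋` for `s = -1`, `u = z`. -/
def alphaHalf (s : ℤ) (w : Fin 3 → ℂ) : PowerSeries (PowerSeries ModeAlg) :=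
  PowerSeries.mk fun n => if n = 0 then 0 else
    PowerSeries.C (∑ i, w i • op (.xs i (s * n))) +
      PowerSeries.C ((1 / 2 : ℂ) •
        ∑ i, w i • ∑ j, epsSum i j fun k => op (.W j) * op (.x k (s * n))) * PowerSeries.X

/-- `Qᵢ = Pᵢ - ½ εᵢⱼₖ xʲ₀ Wᵏ`. -/
def opQ (i : Fin 3) : ModeAlg :=
  op (.P i) - (1 / 2 : ℂ) • ∑ j, epsSum i j fun k => op (.x j 0) * op (.W k)

/-- `z ^ (wⁱ Qᵢ) = exp (log z wⁱ Qᵢ)` as a series in `log z`. -/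
def zPow (w : Fin 3 → ℂ) : PowerSeries ModeAlg :=
  PowerSeries.mk fun p => ((p ! : ℂ)⁻¹) • (∑ i, w i • opQ i) ^ p

/-- The coefficient at `zᵃ (log z)ᵖ` of `e^α(z) v`, where `α = ∑ wⁱ x*ᵢ` and
`e^α(z) = exp (α₀) z^(wⁱ Qᵢ) exp (α(z)₋) exp (α(z)₊)`. The sum is over the powers `z^c` in
`exp (α(z)₋)` and `z^(-b)` in `exp (α(z)₊)`; only finitely many `b` contribute, as the coefficients
of high degree in `exp (α(z)₊)` annihilate `v`. -/
def vertex (w : Fin 3 → ℂ) (a : ℤ) (p : ℕ) (v : States) : States :=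
  expZero w (∑ᶠ cb ∈ {cb : ℕ × ℕ | (cb.1 : ℤ) - cb.2 = a},
    PowerSeries.coeff p (zPow w * PowerSeries.coeff cb.1 (formalExp (alphaHalf (-1) w)) *
      PowerSeries.coeff cb.2 (formalExp (alphaHalf 1 w))) • v)

/-- The coefficient at `zᵃ (log z)ᵖ wᵇ (log w)^q` of `⟨ψ| e^{u₁}(z) e^{u₂}(w) |e^{u₃}⟩`, where
`Ψ = ⟨ψ|`. -/
def correlator (Ψ : States →ₗ[ℂ] ℂ) (u₁ u₂ u₃ : Fin 3 → ℂ) (a : ℤ) (p : ℕ) (b : ℤ) (q : ℕ) : ℂ :=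
  Ψ (vertex u₁ a p (vertex u₂ b q (ket (expWave u₃))))

/-! ### Rogers' dilogarithm and volumes -/

/-- Rogers' dilogarithm `Li₂(x) + ½ log x log (1 - x)` at `‖x‖ < 1`, for the determination `l`
of `log x`. -/
def rogersL (x l : ℂ) : ℂ :=
  (∑' n : ℕ, x ^ (n + 1) / ((n : ℂ) + 1) ^ 2) + 1 / 2 * l * Complex.log (1 - x)

/-- The expansion of `L(w/z)` in the domain `|z| ≫ |w|`, as a power series in `w/z` whose
coefficients are polynomials in `log z` (variable `0`) and `log w` (variable `1`):
`∑_{n>0} (w/z)ⁿ / n² - ½ (log w - log z) ∑_{n>0} (w/z)ⁿ / n`. -/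
def rogersSeries : PowerSeries (MvPolynomial (Fin 2) ℂ) :=
  PowerSeries.mk fun n => if n = 0 then 0 else
    MvPolynomial.C (1 / (n : ℂ) ^ 2) -
      MvPolynomial.C (1 / (2 * (n : ℂ))) * (MvPolynomial.X 1 - MvPolynomial.X 0)

/-- The coefficient at `zᵃ (log z)ᵖ wᵇ (log w)^q` of a power series in `w/z` with coefficients
polynomial in `log z`, `log w`. -/
def coeffZW (F : PowerSeries (MvPolynomial (Fin 2) ℂ)) (a : ℤ) (p : ℕ) (b : ℤ) (q : ℕ) : ℂ :=
  if 0 ≤ b ∧ a = -b then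
    MvPolynomial.coeff (Finsupp.single 0 p + Finsupp.single 1 q) (PowerSeries.coeff b.toNat F)
  else 0

/-- An integral vector as a point of Euclidean space. -/
def toPoint (n : Fin 3 → ℤ) : EuclideanSpace ℝ (Fin 3) := WithLp.toLp 2 fun i => (n i : ℝ)

/-- The oriented volume of the Euclidean tetrahedron with vertices `0, n₁, n₂, n₃`. -/
def orientedVol (n₁ n₂ n₃ : Fin 3 → ℤ) : ℝ :=
  ((SignType.sign (Matrix.of ![n₁, n₂, n₃]).det : ℤ) : ℝ) *
    (volume (convexHull ℝ {0, toPoint n₁, toPoint n₂, toPoint n₃})).toReal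

/-- The winding vector `κ n`. -/
def winding (κ : ℂ) (n : Fin 3 → ℤ) : Fin 3 → ℂ := fun i => κ * n i

end HDFT

end

noncomputable section

namespace HDFT

/-! ### Derivations of polynomial rings over algebras -/

section CoeffDerivation

variable {σ R : Type*} [CommRing R] [Algebra ℂ R]

/-! Put `c = w₁ × w₂`. The annihilation half current of `w₁` at `z` and the creation half current of
`w₂` at `w` have a commutator made of modes `c·xₘ` and of a multiple of `c·W`. The multiples of
`c·W` are the coefficients of `i_{z,w} L(w/z)`: the bracket of two modes `x*` gives `1/n²`, and the
corrections `½ log z ε W x` give the logarithmic terms (`lie_alphaAt_alphaAt`).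

The modes `c·xₘ` are not scalars, but `c` is orthogonal to `w₁` and `w₂`, so they commute with both
half currents. For `m > 0` they can be moved to the ket, which they annihilate; for `m < 0` they can
be moved to the bra, which vanishes on their images; for `m = 0` the coefficient is zero. The
operator `c·W` commutes with the creation half current and acts on `|e^{w₂+w₃}⟩` as `c·(w₂ + w₃) =
c·w₃`, the triple product. Hence, modulo the subspace `createdSpan` on which the bra vanishes, the
commutator is a scalar on the vectors that occur, and exchanging the two exponentials produces the
exponential of the scalar series (`coeff_smul_expVec_sub_mem`,
`coeff_formalExp_smul_expVec_sub_mem`, `apply_formalExp_alphaAt`).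

The other factors of the vertex operators do not matter. Composition with `e^{α₀}` turns the bra
into a functional that still vanishes on images of creation operators. The operators `Qᵢ` annihilate
every `|e^w⟩`, and the bracket of `w₁·Q` with `w₂·x*ₙ` is a multiple of `c·xₙ`, so `z^{w₁·Q}`
contributes only its constant term (`correlator_eq`). The formal logarithms are handled by
evaluation: each coefficient is polynomial in them, so an identity at all numerical values is an
identity of coefficients (`apply_expHalf_expHalf`).

The bra is unique because the commutation relations write every state as a combination of creation
operators applied to ground states (`mem_span_createdState`). Its existence requires a model in
which the constant term is meaningful: a Fock space of polynomials in the creation modes over the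
smooth functions, where every mode acts as a derivation plus a multiplication (`fockRep`). Creation
operators then map into the polynomials without constant term, and the bra is the pairing of `ψ`
with the constant term (`exists_isBra`).

Convergence is the rearrangement of an absolutely convergent double series
(`hasSum_exp_of_triangular`). The volume enters because the tetrahedron is a linear image of the
corner simplex, of volume `1/6`, so that six times the oriented volume is a determinant. -/

/-- The coefficientwise extension of a linear endomorphism to polynomials. -/
def mvMapCoeff (d : R →ₗ[ℂ] R) : MvPolynomial σ R →ₗ[ℂ] MvPolynomial σ R :=
  (AddMonoidAlgebra.coeffLinearEquiv ℂ).symm.toLinearMap ∘ₗ Finsupp.mapRange.linearMap d ∘ₗ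
    (AddMonoidAlgebra.coeffLinearEquiv ℂ).toLinearMap

theorem mvMapCoeff_monomial (d : R →ₗ[ℂ] R) (s : σ →₀ ℕ) (r : R) :
    mvMapCoeff d (MvPolynomial.monomial s r) = MvPolynomial.monomial s (d r) := by
  ext t
  change (Finsupp.mapRange d (map_zero d) (Finsupp.single s r)) t = _
  rw [Finsupp.mapRange_single]
  rfl

/-- The coefficientwise extension of a derivation to polynomials. -/
def coeffDerivation (d : Derivation ℂ R R) :
    Derivation ℂ (MvPolynomial σ R) (MvPolynomial σ R) :=
  Derivation.mk' (mvMapCoeff d.toLinearMap) fun a b => by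
    induction a using MvPolynomial.induction_on' with
    | add p q hp hq => simp only [add_mul, map_add, hp, hq, smul_eq_mul, mul_add]; ring
    | monomial u r =>
      induction b using MvPolynomial.induction_on' with
      | add p q hp hq => simp only [mul_add, map_add, hp, hq, smul_eq_mul, add_mul]; ring
      | monomial v t =>
        simp only [MvPolynomial.monomial_mul, mvMapCoeff_monomial, smul_eq_mul]
        simp [Derivation.leibniz, add_comm v u]

theorem coeffDerivation_C (d : Derivation ℂ R R) (r : R) :
    coeffDerivation (σ := σ) d (MvPolynomial.C r) = MvPolynomial.C (d r) :=
  mvMapCoeff_monomial _ _ _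

theorem coeffDerivation_X (d : Derivation ℂ R R) (s : σ) :
    coeffDerivation d (MvPolynomial.X s) = 0 := by
  change mvMapCoeff d.toLinearMap (MvPolynomial.monomial _ _) = 0
  rw [mvMapCoeff_monomial]
  simp

/-- Derivations of a polynomial ring that agree on constants and variables are equal. -/
theorem mvDerivation_ext {D E : Derivation ℂ (MvPolynomial σ R) (MvPolynomial σ R)}
    (hC : ∀ r, D (MvPolynomial.C r) = E (MvPolynomial.C r))
    (hX : ∀ s, D (MvPolynomial.X s) = E (MvPolynomial.X s)) : D = E := by
  ext1 p
  induction p using MvPolynomial.induction_on with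
  | C a => exact hC a
  | add p q hp hq => simp only [map_add, hp, hq]
  | mul_X p n hp => simp only [Derivation.leibniz, hp, hX]

end CoeffDerivation

/-- The first order operator `D + f` on a commutative algebra. -/
def firstOrder {A : Type*} [CommRing A] [Algebra ℂ A] :
    (Derivation ℂ A A × A) →ₗ[ℂ] Module.End ℂ A where
  toFun t := t.1.toLinearMap + LinearMap.mulLeft ℂ t.2
  map_add' s t := by ext; simp [add_mul]; abel
  map_smul' c t := by ext; simp [smul_add]

theorem firstOrder_apply {A : Type*} [CommRing A] [Algebra ℂ A] (t : Derivation ℂ A A × A)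
    (a : A) : firstOrder t a = t.1 a + t.2 * a := rfl

/-- The second order parts of the two products cancel, so the commutator of `D + f` and `E + g` is
`[D, E] + (D g - E f)`. Each relation between modes thus splits into an identity of derivations and
an identity of functions. -/
theorem firstOrder_mul {A : Type*} [CommRing A] [Algebra ℂ A] {s t u : Derivation ℂ A A × A}
    (h₁ : ⁅s.1, t.1⁆ = u.1) (h₂ : s.1 t.2 - t.1 s.2 = u.2) :
    firstOrder s * firstOrder t = firstOrder t * firstOrder s + firstOrder u := by
  ext a
  simp only [Module.End.mul_apply, LinearMap.add_apply, firstOrder_apply, ← h₁, ← h₂,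
    Derivation.commutator_apply, map_add, Derivation.leibniz, smul_eq_mul]
  ring

theorem firstOrder_scalar {A : Type*} [CommRing A] [Algebra ℂ A] (c : ℂ) :
    firstOrder ((0 : Derivation ℂ A A), algebraMap ℂ A c) = algebraMap ℂ _ c := by
  ext a
  simp [firstOrder_apply, Algebra.smul_def]

/-! ### The antisymmetric tensor -/

theorem eps_swap (i j k : Fin 3) : eps j i k = -eps i j k := by
  fin_cases i <;> fin_cases j <;> fin_cases k <;> rfl

theorem eps_rotate (i j k : Fin 3) : eps j k i = eps i j k := by
  fin_cases i <;> fin_cases j <;> fin_cases k <;> rfl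

theorem eps_swap_right (i j k : Fin 3) : eps i k j = -eps i j k := by
  fin_cases i <;> fin_cases j <;> fin_cases k <;> rfl

theorem map_epsSum {A B F : Type} [AddCommGroup A] [AddCommGroup B] [FunLike F A B]
    [AddMonoidHomClass F A B] (T : F) (i j : Fin 3) (v : Fin 3 → A) :
    T (epsSum i j v) = epsSum i j fun k => T (v k) := by
  simp [epsSum]

/-! ### The Fock space -/

/-- The algebra of smooth functions of the coordinates. -/
def SmoothFun : Subalgebra ℂ (Coord → ℂ) where
  carrier := {f | ContDiff ℝ ∞ f}
  add_mem' {f g} (hf : ContDiff ℝ ∞ f) (hg : ContDiff ℝ ∞ g) := hf.add hg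
  mul_mem' {f g} (hf : ContDiff ℝ ∞ f) (hg : ContDiff ℝ ∞ g) := hf.mul hg
  algebraMap_mem' c := (contDiff_const : ContDiff ℝ ∞ fun _ : Coord => c)

theorem SmoothFun.contDiff (f : SmoothFun) : ContDiff ℝ ∞ f.1 := f.2

/-- Wave functions as elements of the algebra of smooth functions. -/
def waveEquiv : Wave ≃ₗ[ℂ] SmoothFun where
  toFun f := ⟨f.1, f.2⟩
  invFun f := ⟨f.1, f.2⟩
  map_add' _ _ := rfl
  map_smul' _ _ := rfl
  left_inv _ := rfl
  right_inv _ := rfl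

/-! ### Vector fields and zero modes on smooth functions -/

/-- A smooth vector field as a derivation of the algebra of smooth functions. -/
def fieldDerivation (v : Coord → Coord) (hv : ContDiff ℝ ∞ v) :
    Derivation ℂ SmoothFun SmoothFun :=
  have hd : ∀ (f : SmoothFun) (p : Coord), DifferentiableAt ℝ f.1 p := fun f p =>
    (SmoothFun.contDiff f).differentiable (by simp) p
  Derivation.mk'
    { toFun := fun f => ⟨fun p => fderiv ℝ f.1 p (v p),
        ContDiff.clm_apply (ContDiff.fderiv_right (SmoothFun.contDiff f) (by simp)) hv⟩
      map_add' := fun f g => by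
        ext p
        change fderiv ℝ (f.1 + g.1) p (v p) = fderiv ℝ f.1 p (v p) + fderiv ℝ g.1 p (v p)
        rw [fderiv_add (hd f p) (hd g p)]
        rfl
      map_smul' := fun c f => by
        ext p
        change fderiv ℝ (c • f.1) p (v p) = c • fderiv ℝ f.1 p (v p)
        rw [fderiv_const_smul (hd f p)]
        rfl }
    fun f g => by
      ext p
      change fderiv ℝ (f.1 * g.1) p (v p) =
        f.1 p * fderiv ℝ g.1 p (v p) + g.1 p * fderiv ℝ f.1 p (v p)
      rw [fderiv_mul (hd f p) (hd g p)]
      rfl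

theorem fieldDerivation_apply (v : Coord → Coord) (hv : ContDiff ℝ ∞ v) (f : SmoothFun)
    (p : Coord) : (fieldDerivation v hv f).1 p = fderiv ℝ f.1 p (v p) := rfl

/-- The second derivative of the function drops out by symmetry; what remains is its derivative
along the Lie bracket of the fields. -/
theorem fieldDerivation_commutator (v w u : Coord → Coord) (hv : ContDiff ℝ ∞ v)
    (hw : ContDiff ℝ ∞ w) (hu : ContDiff ℝ ∞ u)
    (h : ∀ p, fderiv ℝ w p (v p) - fderiv ℝ v p (w p) = u p) :
    ⁅fieldDerivation v hv, fieldDerivation w hw⁆ = fieldDerivation u hu := by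
  ext f p
  have h2 : ∀ p, DifferentiableAt ℝ (fderiv ℝ f.1) p := fun p =>
    (((SmoothFun.contDiff f).fderiv_right (m := ∞) (by simp)).differentiable (by simp)) p
  have hv' : DifferentiableAt ℝ v p := hv.differentiable (by simp) p
  have hw' : DifferentiableAt ℝ w p := hw.differentiable (by simp) p
  change fderiv ℝ (fun q => fderiv ℝ f.1 q (w q)) p (v p) -
    fderiv ℝ (fun q => fderiv ℝ f.1 q (v q)) p (w p) = fderiv ℝ f.1 p (u p)
  rw [fderiv_clm_apply (h2 p) hw', fderiv_clm_apply (h2 p) hv', ← h]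
  have hs : IsSymmSndFDerivAt ℝ f.1 p :=
    (SmoothFun.contDiff f).contDiffAt.isSymmSndFDerivAt
      (by simpa using (WithTop.coe_le_coe.2 le_top : ((2 : ℕ∞) : WithTop ℕ∞) ≤ ((⊤ : ℕ∞) : WithTop ℕ∞)))
  simp [hs.eq (v p) (w p)]

/-- `∂/∂x*ᵢ` as a derivation. -/
def derW (i : Fin 3) : Derivation ℂ SmoothFun SmoothFun :=
  fieldDerivation (fieldW i) (fieldW_contDiff i)

/-- `∂/∂xⁱ + ½ εᵢⱼₖ xʲ ∂/∂x*ₖ` as a derivation. -/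
def derP (i : Fin 3) : Derivation ℂ SmoothFun SmoothFun :=
  fieldDerivation (fieldP i) (fieldP_contDiff i)

/-- The coordinate `xⁱ`. -/
def coordX (i : Fin 3) : SmoothFun :=
  ⟨fun p => (p.1 i : ℂ), Complex.ofRealCLM.contDiff.comp
    (by fun_prop : ContDiff ℝ ∞ fun p : Coord => p.1 i)⟩

/-- The coordinate `x*ᵢ`. -/
def coordXs (i : Fin 3) : SmoothFun :=
  ⟨fun p => (p.2 i : ℂ), Complex.ofRealCLM.contDiff.comp
    (by fun_prop : ContDiff ℝ ∞ fun p : Coord => p.2 i)⟩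

theorem fderiv_coordX (i : Fin 3) (p v : Coord) :
    fderiv ℝ (coordX i).1 p v = (v.1 i : ℂ) := by
  have := (Complex.ofRealCLM.comp ((ContinuousLinearMap.proj i).comp
    (ContinuousLinearMap.fst ℝ (Fin 3 → ℝ) (Fin 3 → ℝ)))).hasFDerivAt (x := p)
  exact congrArg (fun L => L v) this.fderiv

theorem fderiv_coordXs (i : Fin 3) (p v : Coord) :
    fderiv ℝ (coordXs i).1 p v = (v.2 i : ℂ) := by
  have := (Complex.ofRealCLM.comp ((ContinuousLinearMap.proj i).comp
    (ContinuousLinearMap.snd ℝ (Fin 3 → ℝ) (Fin 3 → ℝ)))).hasFDerivAt (x := p)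
  exact congrArg (fun L => L v) this.fderiv

theorem derW_coordX (i j : Fin 3) : derW i (coordX j) = 0 := by
  ext p
  rw [derW, fieldDerivation_apply, fderiv_coordX]
  simp [fieldW]

theorem derW_coordXs (i j : Fin 3) : derW i (coordXs j) = if i = j then 1 else 0 := by
  ext p
  rw [derW, fieldDerivation_apply, fderiv_coordXs]
  by_cases h : i = j <;> simp [fieldW, h, eq_comm]

theorem derP_coordX (i j : Fin 3) : derP i (coordX j) = if i = j then 1 else 0 := by
  ext p
  rw [derP, fieldDerivation_apply, fderiv_coordX]
  by_cases h : i = j <;> simp [fieldP, h, eq_comm]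

theorem derP_coordXs (i j : Fin 3) :
    derP i (coordXs j) = -((1 / 2 : ℂ) • epsSum i j fun k => coordX k) := by
  ext p
  rw [derP, fieldDerivation_apply, fderiv_coordXs]
  have : (epsSum i j fun k => coordX k).1 p = ∑ k, (eps i j k : ℂ) * (p.1 k : ℂ) := by
    simp [epsSum, coordX]
  change _ = -((1 / 2 : ℂ) * (epsSum i j fun k => coordX k).1 p)
  rw [this]
  simp only [fieldP, eps_swap_right i j]
  push_cast
  simp

theorem fderiv_fieldP (i : Fin 3) (p v : Coord) :
    fderiv ℝ (fieldP i) p v = (0, fun k => (1 / 2) * ∑ j, (eps i j k : ℝ) * v.1 j) := by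
  let L : Coord →ₗ[ℝ] Coord :=
    { toFun := fun v => (0, fun k => (1 / 2) * ∑ j, (eps i j k : ℝ) * v.1 j)
      map_add' := fun v w => by
        ext k <;> simp [mul_add, Finset.sum_add_distrib]
      map_smul' := fun c v => by
        ext k
        · simp
        · simp only [Prod.smul_fst, Pi.smul_apply, smul_eq_mul, Prod.smul_snd, RingHom.id_apply,
            Finset.mul_sum]
          exact Finset.sum_congr rfl fun j _ => by ring }
  have h : fieldP i = fun p => ((Pi.single i 1, 0) :
    Coord) + LinearMap.toContinuousLinearMap L p := by
    funext p
    ext k <;> simp [fieldP, L]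
  rw [h, fderiv_const_add, ContinuousLinearMap.fderiv]
  rfl

theorem derW_derW (i j : Fin 3) : ⁅derW i, derW j⁆ = 0 := by
  refine (fieldDerivation_commutator _ _ (fun _ => 0) _ _ contDiff_const fun p => ?_).trans ?_
  · unfold fieldW; simp
  · ext f p; simp [fieldDerivation_apply]

theorem derP_derW (i j : Fin 3) : ⁅derP i, derW j⁆ = 0 := by
  refine (fieldDerivation_commutator _ _ (fun _ => 0) _ _ contDiff_const fun p => ?_).trans ?_
  · rw [fderiv_fieldP]
    unfold fieldW
    ext <;> simp
  · ext f p; simp [fieldDerivation_apply]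

theorem derP_derP (i j : Fin 3) : ⁅derP i, derP j⁆ = -epsSum i j fun k => derW k := by
  have hu : ContDiff ℝ ∞ (fun _ : Coord => -∑ k, (eps i j k : ℝ) • fieldW k 0) := contDiff_const
  refine (fieldDerivation_commutator _ _ _ _ _ hu fun p => ?_).trans ?_
  · rw [fderiv_fieldP, fderiv_fieldP]
    ext k
    · simp [fieldW, Prod.fst_sum]
    · simp [fieldP, fieldW, Pi.single_apply, eps_swap i j k, Prod.snd_sum]
      ring
  · ext f p
    have : (epsSum i j fun k => derW k) f = epsSum i j fun k => derW k f := by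
      simp [epsSum, Fin.sum_univ_three]
    simp only [Derivation.neg_apply, this, fieldDerivation_apply]
    change _ = -((epsSum i j fun k => derW k f).1 p)
    rw [map_neg, map_sum]
    simp only [map_smul]
    simp [epsSum, derW, fieldDerivation_apply, fieldW]

/-- Derivations `Wⁱ`, `Pᵢ` and elements `xⁱ`, `x*ᵢ` of a commutative algebra which satisfy the
commutation relations of the zero modes. -/
structure ZeroModes (R : Type) [CommRing R] [Algebra ℂ R] where
  /-- `Wⁱ` -/
  W : Fin 3 → Derivation ℂ R R
  /-- `Pᵢ` -/
  P : Fin 3 → Derivation ℂ R R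
  /-- `xⁱ` -/
  x : Fin 3 → R
  /-- `x*ᵢ` -/
  xs : Fin 3 → R
  W_x : ∀ i j, W i (x j) = 0
  W_xs : ∀ i j, W i (xs j) = if i = j then 1 else 0
  P_x : ∀ i j, P i (x j) = if i = j then 1 else 0
  P_xs : ∀ i j, P i (xs j) = -((1 / 2 : ℂ) • epsSum i j fun k => x k)
  W_W : ∀ i j, ⁅W i, W j⁆ = 0
  P_W : ∀ i j, ⁅P i, W j⁆ = 0
  P_P : ∀ i j, ⁅P i, P j⁆ = -epsSum i j fun k => W k

/-- The zero modes acting on smooth functions. -/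
def smoothZeroModes : ZeroModes SmoothFun where
  W := derW
  P := derP
  x := coordX
  xs := coordXs
  W_x := derW_coordX
  W_xs := derW_coordXs
  P_x := derP_coordX
  P_xs := derP_coordXs
  W_W := derW_derW
  P_W := derP_derW
  P_P := derP_derP

/-- The Fock space: polynomials in the creation operators `xⁱₙ` (first index `false`) and `x*ᵢ,ₙ`
(first index `true`), `n < 0`, with coefficients in the zero modes. -/
abbrev Fock (R : Type) [CommRing R] : Type := MvPolynomial (Bool × Fin 3 × ℤ) R

section Fock

variable {R : Type} [CommRing R] [Algebra ℂ R] (Z : ZeroModes R)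

/-- The derivation of the Fock space which kills the coefficients and takes given values
on the variables. -/
def fockDerivation (v : Bool × Fin 3 × ℤ → Fock R) : Derivation ℂ (Fock R) (Fock R) :=
  (MvPolynomial.mkDerivation R v).restrictScalars ℂ

theorem fockDerivation_C (v : Bool × Fin 3 × ℤ → Fock R) (r : R) :
    fockDerivation v (MvPolynomial.C r) = 0 :=
  MvPolynomial.derivation_C (MvPolynomial.mkDerivation R v) r

theorem fockDerivation_X (v : Bool × Fin 3 × ℤ → Fock R) (s : Bool × Fin 3 × ℤ) :
    fockDerivation v (MvPolynomial.X s) = v s :=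
  MvPolynomial.mkDerivation_X R v s

theorem epsSum_derivation_apply (i j : Fin 3) (D : Fin 3 → Derivation ℂ (Fock R) (Fock R)) (a :
    Fock R) :
    (epsSum i j D) a = epsSum i j fun k => D k a := by
  simp [epsSum, Fin.sum_univ_three]

/-- The value of the mode `xʲₙ` at the vacuum. -/
def fockX (j : Fin 3) (n : ℤ) : Fock R :=
  if n < 0 then MvPolynomial.X (false, j, n) else
    if n = 0 then MvPolynomial.C (Z.x j) else 0

/-- The value of the mode `x*ᵢ,ₙ` at the vacuum. -/
def fockXs (i : Fin 3) (n : ℤ) : Fock R :=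
  if n < 0 then MvPolynomial.X (true, i, n) else
    if n = 0 then MvPolynomial.C (Z.xs i) else 0

/-- The derivation part of `xʲₙ`. -/
def dX (j : Fin 3) (n : ℤ) : Derivation ℂ (Fock R) (Fock R) :=
  fockDerivation fun s => if s.1 = true ∧ j = s.2.1 ∧ s.2.2 = -n ∧ 0 < n then
    algebraMap ℂ (Fock R) (-1 / n) else 0

/-- The derivation `Wⁱ`. -/
def dW (i : Fin 3) : Derivation ℂ (Fock R) (Fock R) := coeffDerivation (Z.W i)

/-- The derivation `Pᵢ`. -/
def dP (i : Fin 3) : Derivation ℂ (Fock R) (Fock R) :=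
  coeffDerivation (Z.P i) + fockDerivation fun s => if s.1 = true ∧ s.2.2 < 0 then
    -((1 / 2 : ℂ) • epsSum i s.2.1 fun k => fockX Z k s.2.2) else 0

/-- The coefficient of the derivations `Wˡ` in `x*ᵢ,ₙ`. -/
def coeffW (n : ℤ) : ℂ := if n < 0 then -1 / n else 0

/-- The coefficient in the derivative of the variable `x*ⱼ,ₘ` along `x*ᵢ,ₙ`. -/
def coeffXs (n m : ℤ) : ℂ :=
  if m < 0 then
    if 0 < n then (n + m) / (2 * n * m) else if n = 0 then -1 / (2 * m) else 1 / (2 * n)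
  else 0

/-- The derivative of `xʲₘ` along `x*ᵢ,ₙ`. -/
def coeffX (i j : Fin 3) (n m : ℤ) : ℂ := if i = j ∧ m = -n ∧ 0 < n then 1 / m else 0

/-- The derivation part of `x*ᵢ,ₙ`. -/
def dXs (i : Fin 3) (n : ℤ) : Derivation ℂ (Fock R) (Fock R) :=
  coeffW n • (∑ k, fockX Z k n • epsSum i k fun l => dW Z l) + fockDerivation fun s =>
    if s.1 = true then coeffXs n s.2.2 • epsSum i s.2.1 fun k => fockX Z k (n + s.2.2)
    else algebraMap ℂ (Fock R) (coeffX i s.2.1 n s.2.2)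

theorem dX_C (j : Fin 3) (n : ℤ) (r : R) : dX j n (MvPolynomial.C r : Fock R) = 0 :=
  fockDerivation_C _ _

theorem dX_false (j : Fin 3) (n : ℤ) (t : Fin 3 × ℤ) : dX j n (MvPolynomial.X (false, t) :
    Fock R) = 0 :=
  (fockDerivation_X _ _).trans (by simp)

theorem dX_true (j : Fin 3) (n : ℤ) (t : Fin 3 × ℤ) : dX j n (MvPolynomial.X (true, t) : Fock R) =
    algebraMap ℂ (Fock R) (if j = t.1 ∧ t.2 = -n ∧ 0 < n then -1 / n else 0) :=
  (fockDerivation_X _ _).trans (by simp only [true_and]; split_ifs <;> simp)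

theorem dX_fockX (j : Fin 3) (n : ℤ) (k : Fin 3) (m : ℤ) : dX j n (fockX Z k m) = 0 := by
  unfold fockX
  split_ifs <;> simp [dX_C, dX_false]

theorem dX_fockXs (j : Fin 3) (n : ℤ) (k : Fin 3) (m : ℤ) : dX j n (fockXs Z k m) =
    algebraMap ℂ (Fock R) (if j = k ∧ m = -n ∧ 0 < n then -1 / n else 0) := by
  unfold fockXs
  split_ifs with h1 h2 h2 h2 h2 <;> simp only [dX_C, dX_true, map_zero] <;>
    first
    | rfl
    | (exfalso; omega)
    | simp [h2]

theorem dX_eq_zero (j : Fin 3) {n : ℤ} (hn : n ≤ 0) :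
    (dX j n : Derivation ℂ (Fock R) (Fock R)) = 0 := by
  refine mvDerivation_ext (fun r => by simp [dX_C]) ?_
  rintro ⟨_ | _, t⟩
  · simp [dX_false]
  · simp [dX_true, hn.not_gt]

theorem dW_C (i : Fin 3) (r : R) :
    dW Z i (MvPolynomial.C r) = MvPolynomial.C (Z.W i r) := coeffDerivation_C _ _

theorem dW_X (i : Fin 3) (s : Bool × Fin 3 × ℤ) : dW Z i (MvPolynomial.X s) = 0 :=
  coeffDerivation_X _ _

theorem dW_fockX (i k : Fin 3) (m : ℤ) : dW Z i (fockX Z k m) = 0 := by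
  unfold fockX
  split_ifs <;> simp [dW_C, dW_X, Z.W_x]

theorem dP_C (i : Fin 3) (r : R) :
    dP Z i (MvPolynomial.C r) = MvPolynomial.C (Z.P i r) := by
  simp [dP, fockDerivation_C, coeffDerivation_C]

theorem dP_false (i : Fin 3) (t : Fin 3 × ℤ) : dP Z i (MvPolynomial.X (false, t)) = 0 := by
  simp [dP, fockDerivation_X, coeffDerivation_X]

theorem dP_true (i : Fin 3) (t : Fin 3 × ℤ) : dP Z i (MvPolynomial.X (true, t)) =
    if t.2 < 0 then -((1 / 2 : ℂ) • epsSum i t.1 fun k => fockX Z k t.2) else 0 := by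
  simp [dP, fockDerivation_X, coeffDerivation_X]

theorem dP_fockX (i k : Fin 3) (m : ℤ) :
    dP Z i (fockX Z k m) = if i = k ∧ m = 0 then 1 else 0 := by
  unfold fockX
  by_cases hm : m < 0
  · simp [hm, dP_false, hm.ne]
  · by_cases h0 : m = 0
    · simp only [h0, lt_irrefl, if_false, if_true, dP_C, Z.P_x, and_true]
      split_ifs <;> simp
    · simp [hm, h0]

/-- Through `coeffW` a creation operator `x*ᵢ,ₙ` carries the term `-(1/n) xᵏₙ εᵢₖₗ Wˡ`. It is there
for the summand `εᵢⱼₖ Wᵏ / m²` of `[x*ᵢ,ₘ, x*ⱼ,₋ₘ]`: contracting the factor `x` with the opposite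
mode `x*` leaves `W`. For `n ≥ 0` it is absent, as the prescribed action on ground states demands.
-/
theorem dXs_C (i : Fin 3) (n : ℤ) (r : R) : dXs Z i n (MvPolynomial.C r) =
    coeffW n • ∑ k, fockX Z k n * epsSum i k fun l => MvPolynomial.C (Z.W l r) := by
  simp [dXs, fockDerivation_C, Fin.sum_univ_three, epsSum_derivation_apply, dW_C]

theorem dXs_false (i : Fin 3) (n : ℤ) (t : Fin 3 × ℤ) : dXs Z i n (MvPolynomial.X (false, t)) =
    algebraMap ℂ (Fock R) (coeffX i t.1 n t.2) := by
  simp [dXs, fockDerivation_X, Fin.sum_univ_three, dW_X, epsSum]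

theorem dXs_true (i : Fin 3) (n : ℤ) (t : Fin 3 × ℤ) : dXs Z i n (MvPolynomial.X (true, t)) =
    coeffXs n t.2 • epsSum i t.1 fun k => fockX Z k (n + t.2) := by
  simp [dXs, fockDerivation_X, Fin.sum_univ_three, dW_X, epsSum]

theorem dXs_fockX (i : Fin 3) (n : ℤ) (k : Fin 3) (m : ℤ) :
    dXs Z i n (fockX Z k m) = algebraMap ℂ (Fock R) (coeffX i k n m) := by
  unfold fockX
  split_ifs with hm h0
  · rw [dXs_false]
  · rw [dXs_C]
    simp only [Z.W_x, map_zero, epsSum, smul_zero, Finset.sum_const_zero, mul_zero]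
    rw [coeffX, if_neg (by omega), map_zero]
  · rw [map_zero, coeffX, if_neg (by omega), map_zero]

/-- The action of the modes on the Fock space, as derivations and multiplication operators. -/
def fockMode : Mode → Derivation ℂ (Fock R) (Fock R) × Fock R
  | .W i => (dW Z i, 0)
  | .P i => (dP Z i, 0)
  | .x i n => (dX i n, fockX Z i n)
  | .xs i n => (dXs Z i n, fockXs Z i n)

/-! ### Structure constants and their identities -/

/-- The coefficient of `εᵢⱼₖ xᵏ` in `[x*ᵢ,ₘ , x*ⱼ,ₙ]`. -/
def bracketCoeff (m n : ℤ) : ℂ :=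
  if m = 0 then if n = 0 then 0 else 1 / (2 * n)
  else if n = 0 then 1 / (2 * m) else (m + n) / (2 * m * n)

theorem xsBracket_eq (i j : Fin 3) (m n : ℤ) : xsBracket i j m n =
    bracketCoeff m n • (epsSum i j fun k => gen (.x k (m + n))) +
      (if m = -n ∧ m ≠ 0 then 1 / (m : ℂ) ^ 2 else 0) • epsSum i j fun k => gen (.W k) := by
  unfold xsBracket bracketCoeff
  by_cases hm : m = 0
  · by_cases hn : n = 0 <;> simp [hm, hn]
  · by_cases hn : n = 0
    · simp [hm, hn]
    · by_cases h : m = -n <;> simp [hm, hn, h]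

/-- The scalar content of the Jacobi identity for `x*ₙ`, `x*ₘ` and the variable `x*ₚ`: one mode
turns the variable into an `x`, which the other contracts to a number. Both sides vanish unless `n +
m + p = 0` and `p < 0`; then the signs of `n` and `m` are distinguished. -/
theorem coeffXs_identity (n m p : ℤ) :
    coeffXs m p * (if m + p = -n ∧ 0 < n then 1 / ((m + p : ℤ) : ℂ) else 0) +
      coeffXs n p * (if n + p = -m ∧ 0 < m then 1 / ((n + p : ℤ) : ℂ) else 0) =
    bracketCoeff n m * (if p = -(n + m) ∧ 0 < n + m then -1 / ((n + m : ℤ) : ℂ) else 0) := by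
  by_cases hp : p = -(n + m)
  · subst hp
    have e1 : m + -(n + m) = -n := by ring
    have e2 : n + -(n + m) = -m := by ring
    simp only [e1, e2, true_and]
    by_cases hs : 0 < n + m
    · have hs' : (n + m : ℂ) ≠ 0 := by exact_mod_cast hs.ne'
      simp only [coeffXs, bracketCoeff]
      rcases lt_trichotomy n 0 with hn | hn | hn <;> rcases lt_trichotomy m 0 with hm | hm | hm <;>
        (try (exfalso; omega))
      · have a : (n : ℂ) ≠ 0 := by exact_mod_cast hn.ne
        have b : (m : ℂ) ≠ 0 := by exact_mod_cast hm.ne'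
        simp only [hs, hn.ne, hm.ne', hn.not_gt, hm, if_true, if_false,
          show -(n + m) < 0 by omega]
        push_cast
        field_simp
        ring
      · subst hn
        have b : (m : ℂ) ≠ 0 := by exact_mod_cast hm.ne'
        simp [hm, hm.ne']
        field_simp
      · have a : (n : ℂ) ≠ 0 := by exact_mod_cast hn.ne'
        have b : (m : ℂ) ≠ 0 := by exact_mod_cast hm.ne
        simp only [hs, hn.ne', hm.ne, hm.not_gt, hn, if_true, if_false,
          show -(n + m) < 0 by omega]
        push_cast
        field_simp
        ring
      · subst hm
        have b : (n : ℂ) ≠ 0 := by exact_mod_cast hn.ne'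
        simp [hn, hn.ne']
        field_simp
      · have a : (n : ℂ) ≠ 0 := by exact_mod_cast hn.ne'
        have b : (m : ℂ) ≠ 0 := by exact_mod_cast hm.ne'
        simp only [hs, hn.ne', hm.ne', hm, hn, if_true, if_false,
          show -(n + m) < 0 by omega]
        push_cast
        field_simp
        ring
    · simp only [coeffXs, show ¬ -(n + m) < 0 by omega, hs, if_false]
      simp
  · rw [if_neg (by omega), if_neg (by omega), if_neg (by tauto)]
    simp

/-- The bound on `n + m` cannot be dropped: for `n, m > 0` the left side is zero and the right side
is not. Beyond the bound the identity is not needed, because it multiplies `fockX` at `n + m`, which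
is then zero. -/
theorem coeffXs_add_swap (n m : ℤ) (h : n + m ≤ 0) :
    (if m = 0 then -coeffW n else coeffXs n m) + (if n = 0 then -coeffW m else coeffXs m n) =
      bracketCoeff n m := by
  simp only [coeffXs, bracketCoeff, coeffW]
  rcases lt_trichotomy n 0 with hn | hn | hn <;> rcases lt_trichotomy m 0 with hm | hm | hm <;>
    (try (exfalso; omega))
  · have a : (n : ℂ) ≠ 0 := by exact_mod_cast hn.ne
    have b : (m : ℂ) ≠ 0 := by exact_mod_cast hm.ne
    simp only [hn, hm, hn.ne, hm.ne, hn.not_gt, hm.not_gt, if_true, if_false]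
    field_simp
    try ring
  · have a : (n : ℂ) ≠ 0 := by exact_mod_cast hn.ne
    subst hm
    simp [hn, hn.ne]
    field_simp
    try ring
  · simp only [hn, hm, hn.ne, hm.ne', hn.not_gt, hm.not_gt, if_true, if_false, zero_add]
    ring
  · have a : (m : ℂ) ≠ 0 := by exact_mod_cast hm.ne
    subst hn
    simp [hm, hm.ne]
    field_simp
    try ring
  · simp [hn, hm]
  · simp only [hn, hm, hn.ne', hm.ne, hn.not_gt, hm.not_gt, if_true, if_false, add_zero]

theorem epsSum_const_zero {V : Type} [AddCommGroup V] (i j : Fin 3) :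
    (epsSum i j fun _ => (0 : V)) = 0 := by
  simp [epsSum]

theorem epsSum_smul {V : Type} [AddCommGroup V] [Module ℂ V] (i j : Fin 3) (c : ℂ)
    (v : Fin 3 → V) : (epsSum i j fun k => c • v k) = c • epsSum i j v := by
  simp only [epsSum, Finset.smul_sum]
  exact Finset.sum_congr rfl fun l _ => smul_comm _ _ _

theorem epsSum_swap {V : Type} [AddCommGroup V] (i j : Fin 3) (v : Fin 3 → V) :
    epsSum j i v = -epsSum i j v := by
  simp [epsSum, eps_swap i j]

theorem epsSum_algebraMap_ite (i j k : Fin 3) (p : Prop) [Decidable p] (c : ℂ) :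
    (epsSum i j fun a => algebraMap ℂ (Fock R) (if a = k ∧ p then c else 0)) =
      eps i j k • algebraMap ℂ (Fock R) (if p then c else 0) := by
  rw [epsSum, Finset.sum_eq_single k]
  · simp
  · intro b _ hb; simp [hb]
  · simp

theorem epsSum_algebraMap_ite' (i j k : Fin 3) (p : Prop) [Decidable p] (c : ℂ) :
    (epsSum i j fun a => algebraMap ℂ (Fock R) (if k = a ∧ p then c else 0)) =
      eps i j k • algebraMap ℂ (Fock R) (if p then c else 0) := by
  simp only [eq_comm (a := k), epsSum_algebraMap_ite]

theorem derivation_smul (D : Derivation ℂ (Fock R) (Fock R)) (c : ℂ) (a : Fock R) :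
    D (c • a) = c • D a := D.map_smul c a

theorem derivation_const (D : Derivation ℂ (Fock R) (Fock R)) (c : ℂ) :
    D (algebraMap ℂ (Fock R) c) = 0 := D.map_algebraMap c

theorem derivation_epsSum (D : Derivation ℂ (Fock R) (Fock R)) (i j : Fin 3) (v : Fin 3 → Fock R) :
    D (epsSum i j v) = epsSum i j fun k => D (v k) := map_epsSum D i j v

/-! ### Commutators of the derivation parts of the modes -/

theorem comm_dW_dW (i j : Fin 3) : ⁅dW Z i, dW Z j⁆ = 0 := by
  refine mvDerivation_ext (fun r => ?_) fun s => ?_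
  · have := congrArg (fun D => D r) (Z.W_W i j)
    simp only [Derivation.commutator_apply, dW_C, Derivation.zero_apply] at this ⊢
    rw [← map_sub, this, map_zero]
  · simp [Derivation.commutator_apply, dW_X]

theorem comm_dP_dW (i j : Fin 3) : ⁅dP Z i, dW Z j⁆ = 0 := by
  refine mvDerivation_ext (fun r => ?_) ?_
  · have := congrArg (fun D => D r) (Z.P_W i j)
    simp only [Derivation.commutator_apply, dW_C, dP_C, Derivation.zero_apply] at this ⊢
    rw [← map_sub, this, map_zero]
  · rintro ⟨_ | _, t⟩
    · simp [Derivation.commutator_apply, dW_X, dP_false]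
    · simp only [Derivation.commutator_apply, dW_X, dP_true]
      split_ifs <;> simp [map_epsSum, dW_fockX, epsSum_const_zero]

theorem comm_dP_dP (i j : Fin 3) : ⁅dP Z i, dP Z j⁆ = -epsSum i j fun k => dW Z k := by
  refine mvDerivation_ext (fun r => ?_) ?_
  · have := congrArg (fun D => D r) (Z.P_P i j)
    simp only [Derivation.commutator_apply, dP_C, Derivation.neg_apply, epsSum_derivation_apply,
      dW_C] at this ⊢
    rw [← map_sub, this, map_neg]
    simp [epsSum, Fin.sum_univ_three]
  · rintro ⟨_ | _, t⟩
    · simp [Derivation.commutator_apply, epsSum_derivation_apply, dW_X, dP_false,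
        epsSum_const_zero]
    · have h : ∀ (a b : Fin 3), t.2 < 0 → dP Z a (epsSum b t.1 fun k => fockX Z k t.2) = 0 := by
        intro a b ht
        rw [map_epsSum]
        simp [dP_fockX, ht.ne, epsSum_const_zero]
      simp only [Derivation.commutator_apply, dP_true]
      split_ifs with ht
      · simp [h _ _ ht, epsSum_derivation_apply, dW_X, epsSum_const_zero]
      · simp [epsSum_derivation_apply, dW_X, epsSum_const_zero]

theorem comm_dX_dX (i j : Fin 3) (m n : ℤ) :
    ⁅(dX i m : Derivation ℂ (Fock R) (Fock R)), (dX j n : Derivation ℂ (Fock R) (Fock R))⁆ = 0 := by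
  refine mvDerivation_ext (fun r => ?_) ?_
  · simp [Derivation.commutator_apply, dX_C]
  · rintro ⟨_ | _, t⟩ <;> simp only [Derivation.commutator_apply, dX_false, dX_true,
      derivation_const, map_zero,
      sub_self, Derivation.zero_apply]

theorem comm_dW_dX (i j : Fin 3) (n : ℤ) :
    ⁅dW Z i, (dX j n : Derivation ℂ (Fock R) (Fock R))⁆ = 0 := by
  refine mvDerivation_ext (fun r => ?_) ?_
  · simp [Derivation.commutator_apply, dX_C, dW_C]
  · rintro ⟨_ | _, t⟩ <;>
      simp only [Derivation.commutator_apply, dX_false, dX_true, dW_X, derivation_const, map_zero,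
      sub_self, Derivation.zero_apply]

theorem comm_dP_dX (i j : Fin 3) (n : ℤ) :
    ⁅dP Z i, (dX j n : Derivation ℂ (Fock R) (Fock R))⁆ = 0 := by
  refine mvDerivation_ext (fun r => ?_) ?_
  · simp [Derivation.commutator_apply, dX_C, dP_C]
  · rintro ⟨_ | _, t⟩
    · simp only [Derivation.commutator_apply, dX_false, dP_false]
      simp
    · simp only [Derivation.commutator_apply, dX_true, dP_true, derivation_const]
      split_ifs <;> simp [derivation_epsSum, dX_fockX, epsSum_const_zero]

theorem comm_dW_dXs (i j : Fin 3) (n : ℤ) : ⁅dW Z i, dXs Z j n⁆ = 0 := by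
  refine mvDerivation_ext (fun r => ?_) ?_
  · have h : ∀ l, dW Z i (MvPolynomial.C (Z.W l r)) = MvPolynomial.C (Z.W l (Z.W i r)) := by
      intro l
      have := congrArg (fun D => D r) (Z.W_W i l)
      simp only [Derivation.commutator_apply, Derivation.zero_apply, sub_eq_zero] at this
      rw [dW_C, this]
    simp only [Derivation.commutator_apply, dXs_C, dW_C, derivation_smul, map_sum,
      Derivation.leibniz,
      dW_fockX, derivation_epsSum, h, smul_eq_mul, mul_zero, add_zero, sub_self,
        Derivation.zero_apply]
  · rintro ⟨_ | _, t⟩ <;>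
      simp only [Derivation.commutator_apply, dXs_false, dXs_true, dW_X, derivation_epsSum,
        derivation_smul, derivation_const, dW_fockX, epsSum_const_zero, map_zero, smul_zero,
        sub_self, Derivation.zero_apply]

theorem comm_dXs_dX (i j : Fin 3) (n m : ℤ) :
    ⁅dXs Z i n, (dX j m : Derivation ℂ (Fock R) (Fock R))⁆ = 0 := by
  refine mvDerivation_ext (fun r => ?_) ?_
  · simp [Derivation.commutator_apply, dXs_C, dX_C, derivation_epsSum, dX_fockX, epsSum_const_zero]
  · rintro ⟨_ | _, t⟩
    · simp only [Derivation.commutator_apply, dXs_false, dX_false, derivation_const]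
      simp
    · simp only [Derivation.commutator_apply, dXs_true, dX_true, derivation_smul, derivation_epsSum,
        derivation_const, dX_fockX]
      simp [epsSum_const_zero]

theorem comm_dP_dXs (i j : Fin 3) (n : ℤ) : ⁅dP Z i, dXs Z j n⁆ =
    -((1 / 2 : ℂ) • epsSum i j fun k => dX k n) := by
  refine mvDerivation_ext (fun r => ?_) ?_
  · have h : ∀ l, dP Z i (MvPolynomial.C (Z.W l r)) = MvPolynomial.C (Z.W l (Z.P i r)) := by
      intro l
      have := congrArg (fun D => D r) (Z.P_W i l)
      simp only [Derivation.commutator_apply, Derivation.zero_apply, sub_eq_zero] at this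
      rw [dP_C, this]
    -- `coeffW` lives on `n < 0`, whereas `Pᵢ` differentiates `xᵏₙ` to something nonzero only at `n
    -- = 0`.
    have hc : ∀ k, coeffW n • (if i = k ∧ n = 0 then (1 : Fock R) else 0) = 0 := by
      intro k
      unfold coeffW
      split_ifs <;> first | omega | simp
    simp only [Derivation.commutator_apply, dXs_C, dP_C, derivation_smul, map_sum,
      Derivation.leibniz,
      dP_fockX, derivation_epsSum, h, smul_eq_mul, Derivation.neg_apply, Derivation.smul_apply,
      epsSum_derivation_apply, dX_C, epsSum_const_zero, smul_zero, neg_zero, Finset.sum_add_distrib,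
      smul_add, add_sub_cancel_left, Finset.smul_sum]
    refine Finset.sum_eq_zero fun k _ => ?_
    rw [mul_comm, ← smul_mul_assoc, hc, zero_mul]
  · rintro ⟨_ | _, t⟩
    · simp only [Derivation.commutator_apply, dXs_false, dP_false, derivation_const]
      simp [epsSum_derivation_apply, dX_false, epsSum_const_zero]
    -- If the `x` produced has degree zero, so that `Pᵢ` could act on it, then its coefficient
    -- `coeffXs` vanishes: for `n > 0` the numerator `n + m` is zero, and `n ≤ 0` is incompatible
    -- with a variable of negative degree.
    · have h1 : coeffXs n t.2 • (epsSum j t.1 fun k => if i = k ∧ n + t.2 = 0 then (1 : Fock R)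
          else 0) = 0 := by
        by_cases h : n + t.2 = 0
        · have : coeffXs n t.2 = 0 := by
            have h' : (n : ℂ) + t.2 = 0 := by exact_mod_cast h
            unfold coeffXs
            split_ifs <;> first | rfl | omega | simp [h']
          rw [this, zero_smul]
        · simp [h, epsSum_const_zero]
      simp only [Derivation.commutator_apply, dXs_true, dP_true, derivation_smul,
        derivation_epsSum, dP_fockX, h1,
        Derivation.neg_apply, Derivation.smul_apply, epsSum_derivation_apply, dX_true,
        epsSum_algebraMap_ite]
      have h2 : dXs Z j n (if t.2 < 0 then -((1 / 2 : ℂ) • epsSum i t.1 fun k => fockX Z k t.2)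
          else 0) = -((1 / 2 : ℂ) • (epsSum i t.1 fun k =>
            algebraMap ℂ (Fock R) (coeffX j k n t.2))) := by
        split_ifs with ht
        · rw [map_neg, derivation_smul, derivation_epsSum]
          simp only [dXs_fockX]
        · have : ∀ k, coeffX j k n t.2 = 0 := by
            intro k
            unfold coeffX
            rw [if_neg (by omega)]
          simp [this, epsSum_const_zero]
      rw [h2]
      simp only [coeffX, epsSum_algebraMap_ite', eps_swap_right i j t.1]
      by_cases h : t.2 = -n ∧ 0 < n
      · simp [h.1, h.2, neg_div]
      · simp [h]

theorem sum_epsSum_coeffX (i j : Fin 3) (n m : ℤ) (v : Fin 3 → Fock R) :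
    (∑ k, (epsSum j k v) * algebraMap ℂ (Fock R) (coeffX i k n m)) =
      epsSum j i v * algebraMap ℂ (Fock R) (if m = -n ∧ 0 < n then 1 / (m : ℂ) else 0) := by
  rw [Finset.sum_eq_single i]
  · simp [coeffX]
  · intro b _ hb
    simp [coeffX, hb.symm]
  · simp

/-- The second order part of `x*ᵢ,ₙ x*ⱼ,ₘ r` for a coefficient `r`. -/
def secondOrderW (i j : Fin 3) (n m : ℤ) (r : R) : Fock R :=
  ∑ k, fockX Z k m * epsSum j k fun l =>
    ∑ a, fockX Z a n * epsSum i a fun b => (MvPolynomial.C (Z.W b (Z.W l r)) : Fock R)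

theorem secondOrderW_eq (i j : Fin 3) (n m : ℤ) (r : R) : secondOrderW Z i j n m r =
    ∑ x : Fin 3 × Fin 3, ∑ y : Fin 3 × Fin 3, (eps j x.1 x.2 * eps i y.1 y.2 : Fock R) *
      (fockX Z x.1 m * fockX Z y.1 n * MvPolynomial.C (Z.W y.2 (Z.W x.2 r))) := by
  simp only [secondOrderW, Fintype.sum_prod_type, epsSum, zsmul_eq_mul, Finset.mul_sum]
  refine Finset.sum_congr rfl fun k _ => Finset.sum_congr rfl fun l _ =>
    Finset.sum_congr rfl fun a _ => Finset.sum_congr rfl fun b _ => ?_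
  ring

/-- The derivations `W` commute, so this part is symmetric and disappears from the commutator of two
modes `x*`. -/
theorem secondOrderW_swap (i j : Fin 3) (n m : ℤ) (r : R) :
    secondOrderW Z j i m n r = secondOrderW Z i j n m r := by
  rw [secondOrderW_eq, secondOrderW_eq, Finset.sum_comm]
  refine Finset.sum_congr rfl fun x _ => Finset.sum_congr rfl fun y _ => ?_
  have := congrArg (fun D => D r) (Z.W_W x.2 y.2)
  simp only [Derivation.commutator_apply, Derivation.zero_apply, sub_eq_zero] at this
  rw [this]
  ring

/-- By the Leibniz rule, the outer derivation either differentiates the coefficient once more, which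
is the second order part, or contracts the factor `xᵏₘ` in front of it. -/
theorem dXs_dXs_C (i j : Fin 3) (n m : ℤ) (r : R) : dXs Z i n (dXs Z j m (MvPolynomial.C r)) =
    coeffW m • (coeffW n • secondOrderW Z i j n m r + (epsSum j i fun l => dW Z l (MvPolynomial.C r)) *
      algebraMap ℂ (Fock R) (if m = -n ∧ 0 < n then 1 / (m : ℂ) else 0)) := by
  rw [dXs_C, derivation_smul, map_sum, ← sum_epsSum_coeffX, secondOrderW]
  refine congrArg (coeffW m • ·) ?_
  rw [Finset.smul_sum, ← Finset.sum_add_distrib]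
  refine Finset.sum_congr rfl fun k _ => ?_
  have h : ∀ l, dXs Z i n (MvPolynomial.C (Z.W l r)) = coeffW n •
      ∑ a, fockX Z a n * epsSum i a fun b => (MvPolynomial.C (Z.W b (Z.W l r)) : Fock R) :=
    fun l => dXs_C _ _ _ _
  rw [Derivation.leibniz, derivation_epsSum, dXs_fockX, smul_eq_mul, smul_eq_mul]
  simp only [h, dW_C]
  rw [epsSum_smul, mul_smul_comm]

/-- Only opposite modes contribute, and of these the positive one contracts the `W`-term of the
negative one. The contraction and `coeffW` each supply a factor of size `1/|n|`. -/
theorem coeffW_identity (n m : ℤ) : -(coeffW m * (if m = -n ∧ 0 < n then 1 / (m : ℂ) else 0)) -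
    coeffW n * (if n = -m ∧ 0 < m then 1 / (n : ℂ) else 0) =
      if n = -m ∧ n ≠ 0 then 1 / (n : ℂ) ^ 2 else 0 := by
  by_cases h : n = -m
  · subst h
    unfold coeffW
    rcases lt_trichotomy m 0 with hm | rfl | hm
    · simp [hm, hm.ne, hm.not_gt]
      field_simp
    · simp
    · simp [hm, hm.ne', hm.not_gt]
      field_simp
  · rw [if_neg (by omega), if_neg (by tauto), if_neg (by tauto)]
    simp

/-- On coefficients only the `W`-term is visible, on variables `x` both sides are zero, and on
variables `x*` the `W`-term is invisible, so that `coeffXs_identity` decides. -/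
theorem comm_dXs_dXs (i j : Fin 3) (n m : ℤ) : ⁅dXs Z i n, dXs Z j m⁆ =
    bracketCoeff n m • (epsSum i j fun k => dX k (n + m)) +
      (if n = -m ∧ n ≠ 0 then 1 / (n : ℂ) ^ 2 else 0) • epsSum i j fun k => dW Z k := by
  refine mvDerivation_ext (fun r => ?_) ?_
  · rw [Derivation.commutator_apply, dXs_dXs_C, dXs_dXs_C, secondOrderW_swap, ← coeffW_identity,
      epsSum_swap i j]
    simp only [Derivation.add_apply, Derivation.smul_apply, epsSum_derivation_apply, dX_C,
      epsSum_const_zero, smul_zero, zero_add]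
    simp only [Algebra.smul_def, map_sub, map_neg, map_mul]
    ring
  · rintro ⟨_ | _, k, p⟩
    · simp only [Derivation.commutator_apply, dXs_false, derivation_const, Derivation.add_apply,
        Derivation.smul_apply, epsSum_derivation_apply, dX_false, dW_X, epsSum_const_zero]
      simp
    · simp only [Derivation.commutator_apply, dXs_true, derivation_smul, derivation_epsSum,
        dXs_fockX,
        Derivation.add_apply, Derivation.smul_apply, epsSum_derivation_apply, dX_true, dW_X,
        epsSum_const_zero, smul_zero, add_zero, coeffX, epsSum_algebraMap_ite,
        epsSum_algebraMap_ite']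
      have h1 : eps j k i = eps i j k := eps_rotate i j k
      have h2 : eps i k j = -eps i j k := eps_swap_right i j k
      have := congrArg (algebraMap ℂ (Fock R)) (coeffXs_identity n m p)
      simp only [h1, h2]
      simp only [map_add, map_mul] at this
      simp only [zsmul_eq_mul, Int.cast_neg]
      simp only [Algebra.smul_def]
      linear_combination (eps i j k : Fock R) * this

/-- At `m = 0` the vacuum value is the coordinate `x*ⱼ`, on which only the `W`-term of `x*ᵢ,ₙ` acts;
hence `coeffW`, with the sign from the antisymmetry of `ε`. -/
theorem dXs_fockXs (i j : Fin 3) (n m : ℤ) : dXs Z i n (fockXs Z j m) =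
    (if m = 0 then -coeffW n else coeffXs n m) • epsSum i j fun k => fockX Z k (n + m) := by
  unfold fockXs
  split_ifs with h1 h2 h2
  · omega
  · rw [dXs_true]
  · subst h2
    rw [dXs_C, neg_smul, ← smul_neg]
    congr 1
    simp only [Z.W_xs, add_zero, epsSum, ← Finset.sum_neg_distrib]
    refine Finset.sum_congr rfl fun k _ => ?_
    rw [Finset.sum_eq_single j]
    · simp [eps_swap_right i j k, mul_comm]
    · intro b _ hb; simp [hb]
    · simp
  · simp [coeffXs, h1]

theorem dXs_fockXs_sub (i j : Fin 3) (n m : ℤ) :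
    dXs Z i n (fockXs Z j m) - dXs Z j m (fockXs Z i n) =
      bracketCoeff n m • epsSum i j fun k => fockX Z k (n + m) := by
  rw [dXs_fockXs, dXs_fockXs, epsSum_swap i j, add_comm m n, smul_neg, sub_neg_eq_add, ← add_smul]
  by_cases h : n + m ≤ 0
  · rw [coeffXs_add_swap n m h]
  · have : ∀ k, fockX Z k (n + m) = 0 := fun k => by
      unfold fockX
      rw [if_neg (by omega), if_neg (by omega)]
    simp [this, epsSum_const_zero]

theorem dP_fockXs (i j : Fin 3) (n : ℤ) : dP Z i (fockXs Z j n) =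
    -((1 / 2 : ℂ) • epsSum i j fun k => fockX Z k n) := by
  unfold fockXs
  split_ifs with h1 h2
  · rw [dP_true, if_pos h1]
  · subst h2
    rw [dP_C, Z.P_xs]
    simp [epsSum, Fin.sum_univ_three, fockX, Algebra.smul_def]
  · have : ∀ k, fockX Z k n = 0 := fun k => by
      unfold fockX
      rw [if_neg h1, if_neg h2]
    simp [this, epsSum_const_zero]

theorem dW_fockXs (i j : Fin 3) (n : ℤ) : dW Z i (fockXs Z j n) =
    if i = j ∧ n = 0 then 1 else 0 := by
  unfold fockXs
  by_cases h1 : n < 0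
  · simp [h1, dW_X, h1.ne]
  · by_cases h0 : n = 0
    · simp only [h0, lt_irrefl, if_false, if_true, dW_C, Z.W_xs, and_true]
      split_ifs <;> simp
    · simp [h1, h0]

/-! ### The representation of the algebra of modes -/

/-- The representation of the free algebra on the Fock space. -/
def fockFree : FreeModes →ₐ[ℂ] Module.End ℂ (Fock R) :=
  FreeAlgebra.lift ℂ fun g => firstOrder (fockMode Z g)

theorem fockFree_gen (g : Mode) : fockFree Z (gen g) = firstOrder (fockMode Z g) :=
  FreeAlgebra.lift_ι_apply _ _

theorem fockFree_rel (g h : Mode) {c : FreeModes} {u : Derivation ℂ (Fock R) (Fock R) × Fock R}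
    (hc : fockFree Z c = firstOrder u) (h₁ : ⁅(fockMode Z g).1, (fockMode Z h).1⁆ = u.1)
    (h₂ : (fockMode Z g).1 (fockMode Z h).2 - (fockMode Z h).1 (fockMode Z g).2 = u.2) :
    fockFree Z (gen g * gen h) = fockFree Z (gen h * gen g + c) := by
  rw [map_add, map_mul, map_mul, fockFree_gen, fockFree_gen, hc]
  exact firstOrder_mul h₁ h₂

theorem fockFree_epsSum (i j : Fin 3) (g : Fin 3 → Mode) :
    fockFree Z (epsSum i j fun k => gen (g k)) =
      firstOrder (epsSum i j fun k => (fockMode Z (g k)).1,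
        epsSum i j fun k => (fockMode Z (g k)).2) := by
  have : (epsSum i j fun k => (fockMode Z (g k)).1, epsSum i j fun k => (fockMode Z (g k)).2) =
      epsSum i j fun k => fockMode Z (g k) := by
    exact Prod.ext (by simp [epsSum, Prod.fst_sum]) (by simp [epsSum, Prod.snd_sum])
  rw [this, map_epsSum, map_epsSum]
  simp only [fockFree_gen]

theorem fockFree_ite_one (p : Prop) [Decidable p] :
    fockFree Z (if p then 1 else 0) = firstOrder (0, if p then 1 else 0) := by
  split_ifs
  · have := firstOrder_scalar (A := Fock R) 1
    simp only [map_one] at this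
    rw [map_one, this]
  · rw [map_zero]
    exact (map_zero firstOrder).symm

theorem fockFree_of_rel ⦃a b : FreeModes⦄ (h : Rel a b) : fockFree Z a = fockFree Z b := by
  have key := fun g h => fockFree_rel Z g h (c := 0) (u := 0) (by simp)
  cases h with
  | W_W i j => simpa using key (.W i) (.W j) (comm_dW_dW Z i j) (by simp [fockMode])
  | P_W i j => simpa using key (.P i) (.W j) (comm_dP_dW Z i j) (by simp [fockMode])
  | x_x i j m n =>
    simpa using key (.x i m) (.x j n) (comm_dX_dX i j m n) (by simp [fockMode, dX_fockX])
  | W_x i j n =>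
    simpa using key (.W i) (.x j n) (comm_dW_dX Z i j n) (by simp [fockMode, dW_fockX])
  | W_xs i j n =>
    exact fockFree_rel Z _ _ (fockFree_ite_one Z _) (comm_dW_dXs Z i j n)
      (by simp [fockMode, dW_fockXs])
  | P_x i j n =>
    exact fockFree_rel Z _ _ (fockFree_ite_one Z _) (comm_dP_dX Z i j n)
      (by simp [fockMode, dP_fockX])
  | P_P i j =>
    rw [sub_eq_add_neg]
    refine fockFree_rel Z _ _ (by rw [map_neg, fockFree_epsSum, ← map_neg]) ?_ ?_
    · exact comm_dP_dP Z i j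
    · simp [fockMode, epsSum_const_zero]
  | P_xs i j n =>
    rw [sub_eq_add_neg]
    refine fockFree_rel Z _ _ (by rw [map_neg, map_smul, fockFree_epsSum, ← map_smul, ← map_neg])
      ?_ ?_
    · exact comm_dP_dXs Z i j n
    · simp [fockMode, dP_fockXs]
  | xs_x i j n m =>
    refine fockFree_rel Z (.xs i n) (.x j m) (u := (0, algebraMap ℂ (Fock R)
      (if i = j ∧ m = -n ∧ m ≠ 0 then 1 / m else 0))) ?_ ?_ ?_
    · rw [firstOrder_scalar]
      split_ifs
      · rw [AlgHom.commutes]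
      · simp
    · exact comm_dXs_dX Z i j n m
    · simp only [fockMode, dXs_fockX, dX_fockXs, ← map_sub]
      congr 1
      unfold coeffX
      by_cases hij : i = j
      · by_cases hmn : m = -n
        · subst hij hmn
          rcases lt_trichotomy n 0 with hn | rfl | hn
          · simp [hn.ne, hn.not_gt, hn, neg_div]
          · simp
          · simp [hn.ne', hn.not_gt, hn]
        · have : ¬ n = -m := by omega
          simp [hmn, this]
      · simp [hij, Ne.symm hij]
  | xs_xs i j m n =>
    rw [xsBracket_eq]
    refine fockFree_rel Z _ _ (by rw [map_add, map_smul, map_smul, fockFree_epsSum,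
      fockFree_epsSum, ← map_smul, ← map_smul, ← map_add]) ?_ ?_
    · exact comm_dXs_dXs Z i j m n
    · have := dXs_fockXs_sub Z i j m n
      simp only [fockMode, Prod.snd_add, Prod.smul_snd, epsSum_const_zero, smul_zero, add_zero]
      exact this

/-- The representation of the algebra of modes on the Fock space. -/
def fockRep : ModeAlg →ₐ[ℂ] Module.End ℂ (Fock R) :=
  RingQuot.liftAlgHom ℂ ⟨fockFree Z, fockFree_of_rel Z⟩

theorem fockRep_op (g : Mode) : fockRep Z (op g) = firstOrder (fockMode Z g) := by
  unfold fockRep op toModeAlg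
  erw [RingQuot.liftAlgHom_mkAlgHom_apply]
  exact fockFree_gen Z g

end Fock

/-! ### Existence and uniqueness of the bra -/

section Fock

variable {R : Type} [CommRing R] [Algebra ℂ R] (Z : ZeroModes R)

theorem constantCoeff_fockX (k : Fin 3) {n : ℤ} (hn : n < 0) :
    MvPolynomial.constantCoeff (fockX Z k n) = 0 := by
  simp [fockX, hn]

/-- For `n < 0` every value contains a variable: `xᵏₙ` on coefficients, and `xᵏₙ₊ₘ` with both
degrees negative on `x*ₘ`. The contraction with a variable `x`, which would give a number, requires
`n > 0`. -/
theorem constantCoeff_dXs (i : Fin 3) {n : ℤ} (hn : n < 0) (a : Fock R) :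
    MvPolynomial.constantCoeff (dXs Z i n a) = 0 := by
  induction a using MvPolynomial.induction_on with
  | C r =>
    rw [dXs_C]
    simp [Algebra.smul_def, constantCoeff_fockX Z _ hn]
  | add p q hp hq => rw [map_add, map_add, hp, hq, add_zero]
  | mul_X p s hp =>
    have hs : MvPolynomial.constantCoeff (dXs Z i n (MvPolynomial.X s)) = 0 := by
      obtain ⟨_ | _, t⟩ := s
      · have : coeffX i t.1 n t.2 = 0 := if_neg (by omega)
        rw [dXs_false, this, map_zero, map_zero]
      · rw [dXs_true]
        by_cases ht : t.2 < 0
        · simp [epsSum, Algebra.smul_def, constantCoeff_fockX Z _ (add_neg hn ht)]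
        · simp [coeffXs, ht]
    rw [Derivation.leibniz, map_add, smul_eq_mul, smul_eq_mul, map_mul, map_mul, hs, hp]
    simp

theorem constantCoeff_fockRep (g : Mode) (hg : g.degree < 0) (a : Fock R) :
    MvPolynomial.constantCoeff (fockRep Z (op g) a) = 0 := by
  rw [fockRep_op, firstOrder_apply, map_add, map_mul]
  cases g with
  | W i => exact absurd hg (lt_irrefl _)
  | P i => exact absurd hg (lt_irrefl _)
  | x i n =>
    change n < 0 at hg
    simp [fockMode, dX_eq_zero i hg.le, constantCoeff_fockX Z i hg]
  | xs i n =>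
    change n < 0 at hg
    simp [fockMode, constantCoeff_dXs Z i hg, fockXs, hg]

end Fock

/-! ### From the space of states to the Fock space -/

/-- A ground state as an element of the Fock space. -/
def waveFock : Wave →ₗ[ℂ] Fock SmoothFun :=
  (IsScalarTower.toAlgHom ℂ SmoothFun (Fock SmoothFun)).toLinearMap.comp waveEquiv.toLinearMap

theorem waveFock_apply (f : Wave) : waveFock f = MvPolynomial.C (waveEquiv f) := rfl

theorem fockRep_waveFock (g : Mode) (hg : 0 ≤ g.degree) (f : Wave) :
    fockRep smoothZeroModes (op g) (waveFock f) = waveFock (zeroAct g f) := by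
  rw [fockRep_op, firstOrder_apply, waveFock_apply, waveFock_apply]
  cases g with
  | W i => simp only [fockMode, dW_C, zero_mul, add_zero]; rfl
  | P i => simp only [fockMode, dP_C, zero_mul, add_zero]; rfl
  | x i n =>
    change 0 ≤ n at hg
    simp only [fockMode, dX_C, zero_add, zeroAct_x, fockX, hg.not_gt, if_false]
    split_ifs
    · rw [← map_mul]; rfl
    · simp
  | xs i n =>
    change 0 ≤ n at hg
    simp only [fockMode, dXs_C, zero_add, zeroAct_xs, fockXs, hg.not_gt, if_false, coeffW,
      zero_smul]
    split_ifs
    · rw [← map_mul]; rfl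
    · simp

/-- `a ⊗ f ↦ a f` with values in the Fock space. -/
def tensorFock : ModeAlg ⊗[ℂ] Wave →ₗ[ℂ] Fock SmoothFun :=
  TensorProduct.lift ((LinearMap.lcomp ℂ (Fock SmoothFun) waveFock).comp
    (fockRep smoothZeroModes).toLinearMap)

theorem tensorFock_tmul (a : ModeAlg) (f : Wave) :
    tensorFock (a ⊗ₜ[ℂ] f) = fockRep smoothZeroModes a (waveFock f) := rfl

theorem tensorFock_smul (a : ModeAlg) (t : ModeAlg ⊗[ℂ] Wave) :
    tensorFock (a • t) = fockRep smoothZeroModes a (tensorFock t) := by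
  induction t using TensorProduct.induction_on with
  | zero => simp
  | tmul b f =>
    rw [TensorProduct.smul_tmul', tensorFock_tmul, tensorFock_tmul, smul_eq_mul, map_mul]
    rfl
  | add s t hs ht => rw [smul_add, map_add, map_add, map_add, hs, ht]

theorem tensorFock_indRel {t : ModeAlg ⊗[ℂ] Wave} (ht : t ∈ indRel) : tensorFock t = 0 := by
  unfold indRel at ht
  induction ht using Submodule.span_induction with
  | mem t ht =>
    obtain ⟨g, f, hg, rfl⟩ := ht
    rw [map_sub, tensorFock_tmul, tensorFock_tmul, fockRep_waveFock g hg, map_one,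
      Module.End.one_apply, sub_self]
  | zero => simp
  | add s t _ _ hs ht => rw [map_add, hs, ht, add_zero]
  | smul a t _ ht => rw [tensorFock_smul, ht, map_zero]

/-- The map from the space of states to the Fock space. -/
def statesFock : States →ₗ[ℂ] Fock SmoothFun :=
  (Submodule.liftQ (indRel.restrictScalars ℂ) tensorFock
    (fun _ ht => tensorFock_indRel ht)).comp
    (Submodule.Quotient.restrictScalarsEquiv ℂ indRel).symm.toLinearMap

theorem statesFock_ket (f : Wave) : statesFock (ket f) = waveFock f := by
  change tensorFock (1 ⊗ₜ[ℂ] f) = _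
  rw [tensorFock_tmul, map_one, Module.End.one_apply]

theorem statesFock_smul (a : ModeAlg) (v : States) :
    statesFock (a • v) = fockRep smoothZeroModes a (statesFock v) := by
  obtain ⟨t, rfl⟩ := Submodule.Quotient.mk_surjective _ v
  exact tensorFock_smul a t

/-! ### Integrability of the pairing and existence of the bra -/

theorem measurableSet_fundDomain : MeasurableSet fundDomain := by
  simp only [fundDomain, Set.ofPred_and, Set.ofPred_forall]
  exact (MeasurableSet.iInter fun i => measurableSet_Ico.preimage
    (by fun_prop : Measurable fun p : Coord => p.1 i)).inter
    (MeasurableSet.iInter fun i => measurableSet_Ico.preimage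
    (by fun_prop : Measurable fun p : Coord => p.2 i))

theorem fundDomain_subset : fundDomain ⊆ Set.Icc (0 : Coord) 1 := fun _ hp =>
  ⟨⟨fun i => (hp.1 i).1, fun i => (hp.2 i).1⟩, ⟨fun i => (hp.1 i).2.le, fun i => (hp.2 i).2.le⟩⟩

/-- On the fundamental domain, which has finite measure, `ψ` is square integrable and hence
integrable, and `f` is bounded because the closed cube is compact. -/
theorem integrableOn_pairing (ψ : L2Y) (f : Wave) :
    IntegrableOn (fun p => conj (ψ (toY p)) * f.1 p) fundDomain := by
  have hfin : IsFiniteMeasure (volume.restrict fundDomain) := by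
    refine ⟨?_⟩
    rw [Measure.restrict_apply_univ]
    exact (measure_mono fundDomain_subset).trans_lt isCompact_Icc.measure_lt_top
  -- `Y` carries the quotient σ-algebra, so this holds by definition.
  have hY : Measurable toY := fun s hs => hs
  have hψ : MemLp (fun p => ψ (toY p)) 2 (volume.restrict fundDomain) :=
    (memLp_map_measure_iff (Lp.memLp ψ).1 hY.aemeasurable).1 (Lp.memLp ψ)
  have hi : Integrable (fun p => conj (ψ (toY p))) (volume.restrict fundDomain) :=
    Complex.conjLIE.toContinuousLinearEquiv.toContinuousLinearMap.integrable_comp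
      (hψ.integrable (by norm_num))
  have hc : Continuous f.1 := (Wave.contDiff f).continuous
  obtain ⟨M, hM⟩ := isCompact_Icc.exists_bound_of_continuousOn
    (hc.continuousOn (s := Set.Icc (0 : Coord) 1))
  exact hi.mul_bdd (c := M) hc.aestronglyMeasurable
    ((ae_restrict_iff' measurableSet_fundDomain).2 (.of_forall fun p hp =>
      hM p (fundDomain_subset hp)))

/-- The pairing with `ψ` as a linear map. -/
def pairingLin (ψ : L2Y) : Wave →ₗ[ℂ] ℂ where
  toFun := pairing ψ
  map_add' f g := by
    unfold pairing
    rw [← integral_add (integrableOn_pairing ψ f) (integrableOn_pairing ψ g)]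
    exact integral_congr_ae (.of_forall fun p => mul_add _ _ _)
  map_smul' c f := by
    unfold pairing
    rw [RingHom.id_apply, smul_eq_mul, ← integral_const_mul]
    exact integral_congr_ae (.of_forall fun p => mul_left_comm _ _ _)

/-- The functional maps a state to the Fock space, takes the constant term, a smooth function, and
pairs it with `ψ`. -/
theorem exists_isBra (ψ : L2Y) : ∃ Ψ : States →ₗ[ℂ] ℂ, IsBra ψ Ψ := by
  let T : Fock SmoothFun →ₗ[ℂ] SmoothFun :=
    { toFun := MvPolynomial.constantCoeff
      map_add' := map_add _
      map_smul' := fun c a => by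
        simp [Algebra.smul_def] }
  refine ⟨(pairingLin ψ).comp (waveEquiv.symm.toLinearMap.comp (T.comp statesFock)), ?_, ?_⟩
  · intro f
    change pairing ψ (waveEquiv.symm (MvPolynomial.constantCoeff (statesFock (ket f)))) = _
    rw [statesFock_ket, waveFock_apply, MvPolynomial.constantCoeff_C, LinearEquiv.symm_apply_apply]
  · intro g v hg
    change pairingLin ψ (waveEquiv.symm (MvPolynomial.constantCoeff (statesFock (op g • v)))) = _
    rw [statesFock_smul, constantCoeff_fockRep _ g hg, map_zero, map_zero]

/-! ### Homogeneous states and uniqueness of the bra -/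

/-- The states of degree `d` generated from the ground states by the modes of negative degree. -/
inductive CreatedState : ℤ → States → Prop
  | ket (f : Wave) : CreatedState 0 (ket f)
  | zero (d : ℤ) : CreatedState d 0
  | add {d : ℤ} {v w : States} : CreatedState d v → CreatedState d w → CreatedState d (v + w)
  | smul {d : ℤ} (c : ℂ) {v : States} : CreatedState d v → CreatedState d (c • v)
  | op {d : ℤ} (g : Mode) {v : States} : g.degree < 0 → CreatedState d v →
      CreatedState (d + g.degree) (op g • v)

theorem CreatedState.sum {ι : Type} {d : ℤ} (s : Finset ι) (v : ι → States)
    (h : ∀ i ∈ s, CreatedState d (v i)) : CreatedState d (∑ i ∈ s, v i) := by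
  classical
  induction s using Finset.induction_on with
  | empty => exact .zero d
  | insert a s ha ih =>
    rw [Finset.sum_insert ha]
    exact (h a (Finset.mem_insert_self a s)).add
      (ih fun i hi => h i (Finset.mem_insert_of_mem hi))

/-- Ground states have degree `0` and creation lowers the degree. This is what makes exponentials of
annihilation operators locally finite. -/
theorem CreatedState.eq_zero {d : ℤ} {v : States} (hv : CreatedState d v) (hd : 0 < d) : v = 0 := by
  induction hv with
  | ket f => exact absurd hd (lt_irrefl _)
  | zero d => rfl
  | add _ _ h₁ h₂ => rw [h₁ hd, h₂ hd, add_zero]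
  | smul c _ h => rw [h hd, smul_zero]
  | op g hg _ ih => rw [ih (by omega), smul_zero]

theorem CreatedState.epsSum_smul {d : ℤ} (i j : Fin 3) (g : Fin 3 → Mode) (v : States)
    (h : ∀ k, CreatedState d (HDFT.op (g k) • v)) :
    CreatedState d ((epsSum i j fun k => HDFT.op (g k)) • v) := by
  rw [epsSum, Finset.sum_smul]
  refine .sum _ _ fun k _ => ?_
  rw [smul_assoc, ← Int.cast_smul_eq_zsmul ℂ]
  exact (h k).smul _

theorem op_mul_op {g h : Mode} {c : FreeModes} (H : Rel (gen g * gen h) (gen h * gen g + c)) :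
    op g * op h = op h * op g + toModeAlg c := by
  have := op_rel H
  rwa [map_add, map_mul, map_mul] at this

/-- The mode is moved past one creation operator after another, each time at the cost of a
commutator, until it reaches a ground state; there it gives a ground state in degree `0` and zero in
positive degree. -/
theorem CreatedState.op_of_commutator (g : Mode) (hg : 0 ≤ g.degree)
    (H : ∀ h : Mode, h.degree < 0 → ∀ d v, CreatedState d v → CreatedState (d + h.degree + g.degree)
      ((HDFT.op g * HDFT.op h - HDFT.op h * HDFT.op g) • v))
    {d : ℤ} {v : States} (hv : CreatedState d v) :
    CreatedState (d + g.degree) (HDFT.op g • v) := by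
  induction hv with
  | ket f =>
    rw [← ketLin_apply, op_smul_ket g hg, ketLin_apply]
    rcases hg.eq_or_lt with h0 | h0
    · rw [← h0]; exact .ket _
    · have : zeroAct g f = 0 := by
        cases g with
        | W i => exact absurd h0 (lt_irrefl _)
        | P i => exact absurd h0 (lt_irrefl _)
        | x i n => exact if_neg (ne_of_gt h0)
        | xs i n => exact if_neg (ne_of_gt h0)
      rw [this, ← ketLin_apply, map_zero]
      exact .zero _
  | zero => rw [smul_zero]; exact .zero _
  | add _ _ h₁ h₂ => rw [smul_add]; exact h₁.add h₂
  | smul c _ h => rw [smul_comm]; exact h.smul c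
  | op h hh hv ih =>
    have h2 := ih.op h hh
    rw [add_right_comm] at h2
    have := (H h hh _ _ hv).add h2
    rwa [sub_smul, mul_smul, mul_smul, sub_add_cancel] at this

/-! ### Commutators in the algebra of modes -/

theorem W_mul_W (i j : Fin 3) : op (.W i) * op (.W j) = op (.W j) * op (.W i) := by
  have := op_rel (Rel.W_W i j)
  rwa [map_mul, map_mul] at this

theorem P_mul_W (i j : Fin 3) : op (.P i) * op (.W j) = op (.W j) * op (.P i) := by
  have := op_rel (Rel.P_W i j)
  rwa [map_mul, map_mul] at this

theorem x_mul_x (i j : Fin 3) (m n : ℤ) : op (.x i m) * op (.x j n) = op (.x j n) * op (.x i m) :=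
    by
  have := op_rel (Rel.x_x i j m n)
  rwa [map_mul, map_mul] at this

theorem W_mul_x (i j : Fin 3) (n : ℤ) : op (.W i) * op (.x j n) = op (.x j n) * op (.W i) := by
  have := op_rel (Rel.W_x i j n)
  rwa [map_mul, map_mul] at this

theorem W_mul_xs (i j : Fin 3) (n : ℤ) : op (.W i) * op (.xs j n) =
    op (.xs j n) * op (.W i) + if i = j ∧ n = 0 then 1 else 0 := by
  rw [op_mul_op (Rel.W_xs i j n), apply_ite toModeAlg, map_one, map_zero]

theorem P_mul_x (i j : Fin 3) (n : ℤ) : op (.P i) * op (.x j n) =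
    op (.x j n) * op (.P i) + if i = j ∧ n = 0 then 1 else 0 := by
  rw [op_mul_op (Rel.P_x i j n), apply_ite toModeAlg, map_one, map_zero]

theorem P_mul_xs (i j : Fin 3) (n : ℤ) : op (.P i) * op (.xs j n) =
    op (.xs j n) * op (.P i) - (1 / 2 : ℂ) • epsSum i j fun k => op (.x k n) := by
  have := op_rel (Rel.P_xs i j n)
  rwa [map_sub, map_mul, map_mul, map_smul, toModeAlg_epsSum] at this

theorem xs_mul_x (i j : Fin 3) (n m : ℤ) : op (.xs i n) * op (.x j m) = op (.x j m) * op (.xs i n) +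
    algebraMap ℂ ModeAlg (if i = j ∧ m = -n ∧ m ≠ 0 then 1 / (m : ℂ) else 0) := by
  rw [op_mul_op (Rel.xs_x i j n m)]
  split_ifs
  · rw [AlgHom.commutes]
  · simp

theorem xs_mul_xs (i j : Fin 3) (m n : ℤ) : op (.xs i m) * op (.xs j n) =
    op (.xs j n) * op (.xs i m) + (bracketCoeff m n • (epsSum i j fun k => op (.x k (m + n))) +
      (if m = -n ∧ m ≠ 0 then 1 / (m : ℂ) ^ 2 else 0) • epsSum i j fun k => op (.W k)) := by
  rw [op_mul_op (Rel.xs_xs i j m n), xsBracket_eq, map_add, map_smul, map_smul, toModeAlg_epsSum,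
    toModeAlg_epsSum]
  rfl

theorem toModeAlg_surjective : Function.Surjective toModeAlg :=
  RingQuot.mkAlgHom_surjective ℂ Rel

theorem createdState_x (i : Fin 3) (n : ℤ) {d : ℤ} {v : States} (hv : CreatedState d v) :
    CreatedState (d + n) (op (.x i n) • v) := by
  rcases lt_or_ge n 0 with hn | hn
  · exact hv.op (.x i n) hn
  refine CreatedState.op_of_commutator (.x i n) hn (fun h hh d v hv => ?_) hv
  cases h with
  | W j => exact absurd hh (lt_irrefl _)
  | P j => exact absurd hh (lt_irrefl _)
  | x j m => rw [x_mul_x, sub_self, zero_smul]; exact .zero _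
  | xs j m =>
    rw [xs_mul_x, sub_add_cancel_left, neg_smul, algebraMap_smul, ← neg_smul]
    split_ifs with h0
    · have : d + m + n = d := by omega
      exact (this.symm ▸ hv : CreatedState (d + m + n) v).smul _
    · rw [neg_zero, zero_smul]
      exact .zero _

theorem createdState_W (i : Fin 3) {d : ℤ} {v : States} (hv : CreatedState d v) :
    CreatedState d (op (.W i) • v) := by
  rw [← add_zero d]
  refine CreatedState.op_of_commutator (.W i) le_rfl (fun h hh d v hv => ?_) hv
  cases h with
  | W j => exact absurd hh (lt_irrefl _)
  | P j => exact absurd hh (lt_irrefl _)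
  | x j m => rw [W_mul_x, sub_self, zero_smul]; exact .zero _
  | xs j m =>
    change m < 0 at hh
    rw [W_mul_xs, if_neg (by omega), add_zero, sub_self, zero_smul]
    exact .zero _

/-- The modes have to be treated in order. Brackets of `x` with creation operators are scalars and
those of `W` vanish; those of `P` lead to `x`, and those of `x*` to scalars, `x` and `W`. -/
theorem createdState_op (g : Mode) {d : ℤ} {v : States} (hv : CreatedState d v) :
    CreatedState (d + g.degree) (op g • v) := by
  rcases lt_or_ge g.degree 0 with hg | hg
  · exact hv.op _ hg
  cases g with
  | W i => exact (add_zero d).symm ▸ createdState_W i hv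
  | x i n => exact createdState_x i n hv
  | P i =>
    refine CreatedState.op_of_commutator _ hg (fun h hh d v hv => ?_) hv
    cases h with
    | W j => exact absurd hh (lt_irrefl _)
    | P j => exact absurd hh (lt_irrefl _)
    | x j m =>
      change m < 0 at hh
      rw [P_mul_x, if_neg (by omega), add_zero, sub_self, zero_smul]
      exact .zero _
    | xs j m =>
      rw [P_mul_xs, sub_sub_cancel_left, neg_smul, smul_assoc, ← neg_smul]
      have : d + (Mode.xs j m).degree + (Mode.P i).degree = d + m := add_zero _
      rw [this]
      exact (CreatedState.epsSum_smul _ _ _ _ fun k => createdState_x k m hv).smul _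
  | xs i n =>
    refine CreatedState.op_of_commutator _ hg (fun h hh d v hv => ?_) hv
    cases h with
    | W j => exact absurd hh (lt_irrefl _)
    | P j => exact absurd hh (lt_irrefl _)
    | x j m =>
      rw [xs_mul_x, add_sub_cancel_left, algebraMap_smul]
      split_ifs with h0
      · have : d + m + n = d := by omega
        exact (this.symm ▸ hv : CreatedState (d + m + n) v).smul _
      · rw [zero_smul]
        exact .zero _
    | xs j m =>
      change CreatedState (d + m + n) _
      rw [xs_mul_xs, add_sub_cancel_left, add_smul, smul_assoc, smul_assoc]
      have h1 : d + m + n = d + (n + m) := by ring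
      refine .add (.smul _ (CreatedState.epsSum_smul _ _ _ _ fun k =>
        h1 ▸ createdState_x k (n + m) hv)) ?_
      split_ifs with h0
      · have : d + m + n = d := by omega
        rw [this]
        exact (CreatedState.epsSum_smul _ _ _ _ fun k => createdState_W k hv).smul _
      · rw [zero_smul]
        exact .zero _

theorem mem_span_createdState (v : States) :
    v ∈ Submodule.span ℂ {v : States | ∃ d, CreatedState d v} := by
  have key : ∀ (a : FreeModes), ∀ v ∈ Submodule.span ℂ {v : States | ∃ d, CreatedState d v},
      toModeAlg a • v ∈ Submodule.span ℂ {v : States | ∃ d, CreatedState d v} := by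
    intro a
    induction a using FreeAlgebra.induction with
    | grade0 c =>
      intro v hv
      rw [AlgHom.commutes, algebraMap_smul]
      exact Submodule.smul_mem _ c hv
    | grade1 g =>
      intro v hv
      induction hv using Submodule.span_induction with
      | mem v hv => exact Submodule.subset_span ⟨_, createdState_op g hv.choose_spec⟩
      | zero => rw [smul_zero]; exact Submodule.zero_mem _
      | add v w _ _ h₁ h₂ => rw [smul_add]; exact Submodule.add_mem _ h₁ h₂
      | smul c v _ h => rw [smul_comm]; exact Submodule.smul_mem _ c h
    | mul a b ha hb => intro v hv; rw [map_mul, mul_smul]; exact ha _ (hb _ hv)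
    | add a b ha hb =>
      intro v hv
      rw [map_add, add_smul]
      exact Submodule.add_mem _ (ha _ hv) (hb _ hv)
  obtain ⟨t, rfl⟩ := Submodule.mkQ_surjective _ v
  induction t using TensorProduct.induction_on with
  | zero => exact Submodule.zero_mem _
  | tmul a f =>
    obtain ⟨a, rfl⟩ := toModeAlg_surjective a
    exact (mkQ_tmul (toModeAlg a) f).symm ▸ key a _ (Submodule.subset_span ⟨0, .ket f⟩)
  | add s t hs ht => exact Submodule.add_mem _ hs ht

theorem IsBra.unique {ψ : L2Y} {Φ Ψ : States →ₗ[ℂ] ℂ} (hΦ : IsBra ψ Φ) (hΨ : IsBra ψ Ψ) :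
    Φ = Ψ := by
  refine LinearMap.ext fun v => ?_
  induction mem_span_createdState v using Submodule.span_induction with
  | mem v hv =>
    obtain ⟨d, hv⟩ := hv
    induction hv with
    | ket f => rw [hΦ.1, hΨ.1]
    | zero => simp
    | add _ _ h₁ h₂ => rw [map_add, map_add, h₁, h₂]
    | smul c _ h => rw [map_smul, map_smul, h]
    | op g hg _ _ => rw [hΦ.2 g _ hg, hΨ.2 g _ hg]
  | zero => simp
  | add v w _ _ h₁ h₂ => rw [map_add, map_add, h₁, h₂]
  | smul c v _ h => rw [map_smul, map_smul, h]

/-! ### Exponentials of formal power series -/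

section FormalExp

open PowerSeries

theorem formalExp_map {R S : Type} [Ring R] [Algebra ℂ R] [Ring S] [Algebra ℂ S] (T : R →ₐ[ℂ] S)
    (f : PowerSeries R) :
    PowerSeries.map (T : R →+* S) (formalExp f) = formalExp (PowerSeries.map (T : R →+* S) f) := by
  ext n
  simp only [formalExp, coeff_map, coeff_mk, RingHom.coe_coe, map_sum, map_smul, ← map_pow]

theorem coeff_formalExp_zero {R : Type} [Ring R] [Algebra ℂ R] (f : PowerSeries R) :
    coeff 0 (formalExp f) = 1 := by
  simp [formalExp]

theorem coeff_formalExp_mem {R : Type} [Ring R] [Algebra ℂ R] (S : Subalgebra ℂ R)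
    {f : PowerSeries R} (hf : ∀ n, coeff n f ∈ S) (n : ℕ) : coeff n (formalExp f) ∈ S := by
  have : f = PowerSeries.map (S.val : S →+* R) (PowerSeries.mk fun n => ⟨coeff n f, hf n⟩) := by
    ext n
    simp
  rw [this, ← formalExp_map, coeff_map]
  exact Subtype.prop _

theorem coeff_pow_eq_zero {R : Type} [CommRing R] {f : PowerSeries R} (hf : coeff 0 f = 0)
    {n k : ℕ} (h : n < k) : coeff n (f ^ k) = 0 := by
  have hX : (X : PowerSeries R) ∣ f := X_dvd_iff.2 (by simpa using hf)
  exact X_pow_dvd_iff.1 (pow_dvd_pow_of_dvd hX k) n h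

/-- Without constant term, `fᵏ` does not reach degrees below `k`. One truncation therefore serves
several coefficients at once, and it can be differentiated. -/
theorem coeff_formalExp_eq_sum {R : Type} [CommRing R] [Algebra ℂ R] {f : PowerSeries R}
    (hf : coeff 0 f = 0) {n N : ℕ} (h : n < N) :
    coeff n (formalExp f) = coeff n (∑ k ∈ Finset.range N, ((k ! : ℂ)⁻¹) • f ^ k) := by
  rw [formalExp, coeff_mk, map_sum]
  have hs : Finset.range (n + 1) ⊆ Finset.range N := Finset.range_mono h
  rw [← Finset.sum_subset hs]
  · rfl
  · intro k _ hk
    rw [Finset.mem_range, not_lt] at hk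
    change ((k ! : ℂ)⁻¹) • coeff n (f ^ k) = 0
    rw [coeff_pow_eq_zero hf hk, smul_zero]

theorem derivative_sum_pow {R : Type} [CommRing R] [Algebra ℂ R] (f : PowerSeries R) (N : ℕ) :
    derivative R (∑ k ∈ Finset.range (N + 1), ((k ! : ℂ)⁻¹) • f ^ k) =
      derivative R f * ∑ k ∈ Finset.range N, ((k ! : ℂ)⁻¹) • f ^ k := by
  rw [map_sum, Finset.sum_range_succ', Finset.mul_sum]
  simp only [pow_zero]
  have h1 : derivative R (((0 ! : ℂ)⁻¹) • (1 : PowerSeries R)) = 0 := by simp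
  rw [h1, add_zero]
  refine Finset.sum_congr rfl fun k _ => ?_
  have h2 : ∀ (c : ℂ) (g : PowerSeries R), derivative R (c • g) = c • derivative R g := by
    intro c g
    rw [← algebraMap_smul R c g, ← algebraMap_smul R c (derivative R g)]
    exact Derivation.map_smul _ _ _
  have h3 : ((k + 1)! : ℂ)⁻¹ * (k + 1) = (k ! : ℂ)⁻¹ := by
    rw [Nat.factorial_succ]
    have : ((k : ℂ) + 1) ≠ 0 := by exact_mod_cast k.succ_ne_zero
    have : (k ! : ℂ) ≠ 0 := by exact_mod_cast k.factorial_ne_zero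
    push_cast
    field_simp
  rw [h2, Derivation.leibniz_pow, Nat.add_sub_cancel, mul_smul_comm, ← h3, mul_smul, smul_eq_mul,
    mul_comm]
  congr 1
  rw [← Nat.cast_smul_eq_nsmul ℂ]
  push_cast
  rfl

/-- Comparison of coefficients in `E' = f' E` for `E = exp f`; truncation of `E` costs one term on
the right, which does not matter in degree `n`. -/
theorem coeff_formalExp_succ_of_comm {R : Type} [CommRing R] [Algebra ℂ R] {f : PowerSeries R}
    (hf : coeff 0 f = 0) (n : ℕ) : ((n : ℂ) + 1) • coeff (n + 1) (formalExp f) =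
      ∑ q ∈ Finset.HasAntidiagonal.antidiagonal n,
        ((q.1 : ℂ) + 1) • (coeff (q.1 + 1) f * coeff q.2 (formalExp f)) := by
  have h : ∀ (m : ℕ) (g : PowerSeries R), ((m : ℂ) + 1) • coeff (m + 1) g =
      coeff m (derivative R g) := by
    intro m g
    rw [coeff_derivative, Algebra.smul_def, mul_comm]
    simp
  rw [coeff_formalExp_eq_sum hf (Nat.lt_succ_self (n + 1)), h, derivative_sum_pow, coeff_mul]
  refine Finset.sum_congr rfl fun q hq => ?_
  rw [← smul_mul_assoc, h, coeff_formalExp_eq_sum hf (N := n + 1)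
    (by have := Finset.HasAntidiagonal.mem_antidiagonal.1 hq; omega)]

variable {R : Type} [Ring R] [Algebra ℂ R] {f : PowerSeries R}

/-- Commuting coefficients generate a commutative subalgebra. Identities that involve a single
exponential can be proved there and carried back by `formalExp_map`. -/
theorem exists_comm_lift (hc : ∀ m n, coeff m f * coeff n f = coeff n f * coeff m f) :
    ∃ (S : Type) (_ : CommRing S) (_ : Algebra ℂ S) (T : S →ₐ[ℂ] R) (g : PowerSeries S),
      Function.Injective T ∧ PowerSeries.map (T : S →+* R) g = f := by
  let s : Set R := Set.range fun n => coeff n f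
  have hs : ∀ a ∈ s, ∀ b ∈ s, a * b = b * a := by
    rintro _ ⟨m, rfl⟩ _ ⟨n, rfl⟩
    exact hc m n
  have hm := Algebra.isMulCommutative_adjoin ℂ hs
  let _ : CommRing (Algebra.adjoin ℂ s) :=
    { (inferInstance : Ring (Algebra.adjoin ℂ s)) with mul_comm := hm.is_comm.comm }
  refine ⟨Algebra.adjoin ℂ s, inferInstance, inferInstance, (Algebra.adjoin ℂ s).val,
    PowerSeries.mk fun n => ⟨coeff n f, Algebra.subset_adjoin ⟨n, rfl⟩⟩, Subtype.val_injective, ?_⟩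
  ext n
  simp

theorem coeff_formalExp_succ (hc : ∀ m n, coeff m f * coeff n f = coeff n f * coeff m f)
    (hf : coeff 0 f = 0) (n : ℕ) : ((n : ℂ) + 1) • coeff (n + 1) (formalExp f) =
      ∑ q ∈ Finset.HasAntidiagonal.antidiagonal n,
        ((q.1 : ℂ) + 1) • (coeff (q.1 + 1) f * coeff q.2 (formalExp f)) := by
  obtain ⟨S, _, _, T, g, hT, rfl⟩ := exists_comm_lift hc
  have hg : coeff 0 g = 0 := hT (by simpa using hf)
  have := congrArg T (coeff_formalExp_succ_of_comm hg n)
  rw [← formalExp_map]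
  simpa only [map_smul, map_sum, map_mul, coeff_map, RingHom.coe_coe] using this

theorem commute_coeff_formalExp (hc : ∀ m n, coeff m f * coeff n f = coeff n f * coeff m f)
    (m n : ℕ) : coeff m f * coeff n (formalExp f) = coeff n (formalExp f) * coeff m f := by
  obtain ⟨S, _, _, T, g, hT, rfl⟩ := exists_comm_lift hc
  rw [← formalExp_map]
  simp only [coeff_map, RingHom.coe_coe, ← map_mul, mul_comm]

end FormalExp

/-! ### Commuting exponentials of annihilation and creation operators -/

section Exchange

open PowerSeries

variable {U M : Type} [Ring U] [Algebra ℂ U] [AddCommGroup M] [Module U M]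

theorem scalar_smul_comm [Module ℂ M] [IsScalarTower ℂ U M] (c : ℂ) (a : U) (x : M) :
    c • a • x = a • c • x :=
  (smul_algebra_smul_comm c a x).symm

/-- The coefficients of `exp (B) v`, indexed by integers. -/
def expVec (B : PowerSeries U) (v : M) (b : ℤ) : M :=
  if 0 ≤ b then coeff b.toNat (formalExp B) • v else 0

theorem expVec_natCast (B : PowerSeries U) (v : M) (b : ℕ) :
    expVec B v b = coeff b (formalExp B) • v := by
  simp [expVec]

theorem expVec_zero (B : PowerSeries U) (v : M) : expVec B v 0 = v := by
  have := expVec_natCast B v 0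
  rwa [coeff_formalExp_zero, one_smul] at this

theorem expVec_of_neg (B : PowerSeries U) (v : M) {b : ℤ} (hb : b < 0) : expVec B v b = 0 :=
  if_neg hb.not_ge

variable [Module ℂ M] [IsScalarTower ℂ U M]

/-- The recursion from `E' = B' E`. As coefficients of negative index are zero, it holds for every
integer `b` and with any upper bound `K`, so that shifted indices need no case distinction. -/
theorem smul_expVec {B : PowerSeries U}
    (hc : ∀ m n, coeff m B * coeff n B = coeff n B * coeff m B) (h0 : coeff 0 B = 0) (v : M)
    (b : ℤ) (K : ℕ) (hK : b ≤ K) : (b : ℂ) • expVec B v b =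
      ∑ k ∈ Finset.range K, ((k : ℂ) + 1) • coeff (k + 1) B • expVec B v (b - (k + 1)) := by
  by_cases hb : 0 < b
  · obtain ⟨n, rfl⟩ : ∃ n : ℕ, b = n + 1 := ⟨(b - 1).toNat, by omega⟩
    have hs : Finset.range (n + 1) ⊆ Finset.range K := Finset.range_mono (by omega)
    have hcast : ((n : ℤ) + 1) = ((n + 1 : ℕ) : ℤ) := by push_cast; rfl
    rw [← Finset.sum_subset hs]
    · rw [hcast, expVec_natCast, ← smul_assoc]
      push_cast
      rw [coeff_formalExp_succ hc h0, Finset.Nat.sum_antidiagonal_eq_sum_range_succ_mk,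
        Finset.sum_smul]
      refine Finset.sum_congr rfl fun k hk => ?_
      have : ((n : ℤ) + 1 - (k + 1)) = ((n - k : ℕ) : ℤ) := by
        have := Finset.mem_range.1 hk
        omega
      rw [this, expVec_natCast, smul_assoc, mul_smul]
    · intro k _ hk
      rw [expVec_of_neg, smul_zero, smul_zero]
      have := mt Finset.mem_range.2 hk
      omega
  · rw [Finset.sum_eq_zero]
    · rcases (not_lt.1 hb).lt_or_eq with h | h
      · rw [expVec_of_neg _ _ h, smul_zero]
      · rw [h, Int.cast_zero, zero_smul]
    · intro k _
      rw [expVec_of_neg _ _ (by omega), smul_zero, smul_zero]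

variable (N : Submodule ℂ M) {A B : PowerSeries U} {γ : PowerSeries ℂ} {v : M}

/-- If `[Aₙ, Bₖ]` were the scalar `δₙₖ γₙ`, then `Aₙ` would act on `exp (B) v` as multiplication by
`γₙ` with a shift of degree by `n`. Here `N` absorbs the deviation, and the commutators are
controlled only on the vectors that occur. -/
theorem coeff_smul_expVec_sub_mem
    (hB : ∀ m n, coeff m B * coeff n B = coeff n B * coeff m B) (hB0 : coeff 0 B = 0)
    (hγ : coeff 0 γ = 0) (hv : ∀ n, coeff n A • v = 0)
    (hAB : ∀ n k b, (coeff n A * coeff k B - coeff k B * coeff n A) • expVec B v b -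
      (if n = k then coeff n γ • expVec B v b else 0) ∈ N)
    (hN : ∀ k, ∀ x ∈ N, coeff k B • x ∈ N) (n : ℕ) (b : ℤ) :
    coeff n A • expVec B v b - coeff n γ • expVec B v (b - n) ∈ N := by
  rcases lt_trichotomy b 0 with hb | rfl | hb
  · rw [expVec_of_neg _ _ hb, expVec_of_neg _ _ (by omega), smul_zero, smul_zero, sub_zero]
    exact N.zero_mem
  · rw [expVec_zero, hv]
    rcases Nat.eq_zero_or_pos n with rfl | hn
    · rw [hγ, zero_smul, sub_zero]; exact N.zero_mem
    · rw [expVec_of_neg _ _ (by omega), smul_zero, sub_zero]; exact N.zero_mem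
  induction h : b.toNat using Nat.strong_induction_on generalizing b with
  | _ m ih =>
  have ih' : ∀ k : ℕ, coeff n A • expVec B v (b - (k + 1)) -
      coeff n γ • expVec B v (b - (k + 1) - n) ∈ N := by
    intro k
    rcases lt_trichotomy (b - (k + 1)) 0 with hk | hk | hk
    · rw [expVec_of_neg _ _ hk, expVec_of_neg _ _ (by omega), smul_zero, smul_zero, sub_zero]
      exact N.zero_mem
    · rw [hk, expVec_zero, hv]
      rcases Nat.eq_zero_or_pos n with rfl | hn
      · rw [hγ, zero_smul, sub_zero]; exact N.zero_mem
      · rw [expVec_of_neg _ _ (by omega), smul_zero, sub_zero]; exact N.zero_mem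
    · exact ih (b - (k + 1)).toNat (by omega) _ hk rfl
  -- The recursion determines `b` times the coefficient of index `b`, whence the multiplication by
  -- `b ≠ 0`.
  rw [← N.smul_mem_iff (s := (b : ℂ)) (by exact_mod_cast hb.ne')]
  obtain ⟨K, hK1, hK2⟩ : ∃ K : ℕ, b ≤ K ∧ n ≤ K :=
    ⟨max b.toNat n, by have := le_max_left b.toNat n; omega, le_max_right _ _⟩
  have e1 : (b : ℂ) • coeff n A • expVec B v b = ∑ k ∈ Finset.range K, ((k : ℂ) + 1) •
      (coeff n A * coeff (k + 1) B) • expVec B v (b - (k + 1)) := by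
    rw [scalar_smul_comm, smul_expVec hB hB0 v b K hK1, Finset.smul_sum]
    refine Finset.sum_congr rfl fun k _ => ?_
    rw [← scalar_smul_comm, mul_smul]
  have e2 : (b : ℂ) • coeff n γ • expVec B v (b - n) = (∑ k ∈ Finset.range K, ((k : ℂ) + 1) •
      coeff (k + 1) B • coeff n γ • expVec B v (b - (k + 1) - n)) +
      ∑ k ∈ Finset.range K, ((k : ℂ) + 1) •
        (if n = k + 1 then coeff n γ • expVec B v (b - (k + 1)) else 0) := by
    have s1 := smul_expVec hB hB0 v (b - n) K (by omega)
    have s2 : ∑ k ∈ Finset.range K, ((k : ℂ) + 1) •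
        (if n = k + 1 then coeff n γ • expVec B v (b - (k + 1)) else 0) =
        (n : ℂ) • coeff n γ • expVec B v (b - n) := by
      rcases Nat.eq_zero_or_pos n with rfl | hn
      · simp
      · rw [Finset.sum_eq_single (n - 1)]
        · have hn1 : n = n - 1 + 1 := by omega
          rw [if_pos hn1]
          have hn2 : ((n - 1 : ℕ) : ℂ) + 1 = n := by exact_mod_cast hn1.symm
          have hn3 : ((n - 1 : ℕ) : ℤ) + 1 = n := by omega
          rw [hn2, hn3]
        · intro k _ hk
          rw [if_neg (by omega), smul_zero]
        · intro hk
          exact absurd (Finset.mem_range.2 (by omega)) hk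
    rw [s2]
    -- Here `b = (b - n) + n`: the first part is expanded by the recursion at `b - n`, the second
    -- matches the single commutator with `k + 1 = n`.
    have s3 : (b : ℂ) • coeff n γ • expVec B v (b - n) =
        coeff n γ • (((b - n : ℤ) : ℂ) • expVec B v (b - n)) +
          (n : ℂ) • coeff n γ • expVec B v (b - n) := by
      push_cast
      module
    rw [s3, s1, Finset.smul_sum]
    congr 1
    refine Finset.sum_congr rfl fun k _ => ?_
    rw [smul_comm, scalar_smul_comm (coeff n γ), show b - n - ((k : ℤ) + 1) =
      b - (k + 1) - n by ring]
  rw [smul_sub, e1, e2, ← Finset.sum_add_distrib, ← Finset.sum_sub_distrib]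
  refine N.sum_mem fun k _ => ?_
  have h1 := N.add_mem (hN (k + 1) _ (ih' k)) (hAB n (k + 1) (b - (k + 1)))
  have h2 := N.smul_mem ((k : ℂ) + 1) h1
  convert h2 using 1
  simp only [smul_add, smul_sub, sub_smul, mul_smul]
  abel

/-- The exponentials of `A` and of `γ` obey the same recursion, and by hypothesis `Aₙ` acts as `γₙ`
with a shift, modulo `N`. -/
theorem coeff_formalExp_smul_expVec_sub_mem
    (hA : ∀ m n, coeff m A * coeff n A = coeff n A * coeff m A) (hA0 : coeff 0 A = 0)
    (hγ : coeff 0 γ = 0)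
    (hN : ∀ k, ∀ x ∈ N, coeff k (formalExp A) • x ∈ N)
    (h : ∀ (n : ℕ) (b : ℤ), coeff n A • expVec B v b - coeff n γ • expVec B v (b - n) ∈ N)
    (c : ℕ) (b : ℤ) : coeff c (formalExp A) • expVec B v b -
      coeff c (formalExp γ) • expVec B v (b - c) ∈ N := by
  induction c using Nat.strong_induction_on generalizing b with
  | _ c ih =>
  rcases c with _ | c
  · rw [coeff_formalExp_zero, coeff_formalExp_zero, one_smul, one_smul, Nat.cast_zero, sub_zero,
      sub_self]
    exact N.zero_mem
  have hc : ((c : ℂ) + 1) ≠ 0 := by exact_mod_cast c.succ_ne_zero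
  rw [← N.smul_mem_iff hc, smul_sub, ← smul_assoc, ← smul_assoc, coeff_formalExp_succ hA hA0,
    coeff_formalExp_succ (fun _ _ => mul_comm _ _) hγ, Finset.sum_smul, Finset.sum_smul,
    ← Finset.sum_sub_distrib]
  refine N.sum_mem fun q hq => ?_
  have hq' : q.1 + q.2 = c := Finset.HasAntidiagonal.mem_antidiagonal.1 hq
  rw [smul_assoc, smul_assoc, ← smul_sub]
  refine N.smul_mem _ ?_
  have h1 := hN q.2 _ (h (q.1 + 1) b)
  have h2 := N.smul_mem (coeff (q.1 + 1) γ) (ih q.2 (by omega) (b - (q.1 + 1 : ℕ)))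
  convert N.add_mem h1 h2 using 1
  rw [commute_coeff_formalExp hA, mul_smul, smul_sub, smul_sub, scalar_smul_comm, mul_smul,
    show b - ((q.1 + 1 : ℕ) : ℤ) - (q.2 : ℤ) = b - ((c + 1 : ℕ) : ℤ) by omega]
  abel

end Exchange

/-! ### Linear combinations of modes -/

theorem lie_mul_left_eq {R : Type} [Ring R] (a b c : R) : ⁅a, b * c⁆ = ⁅a, b⁆ * c + b * ⁅a, c⁆ := by
  simp only [Ring.lie_def]
  noncomm_ring

section RingBracket

variable {R ι : Type} [Ring R]

theorem commutator_sum (s : Finset ι) (a : R) (f : ι → R) :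
    ⁅a, ∑ i ∈ s, f i⁆ = ∑ i ∈ s, ⁅a, f i⁆ := by
  simp only [Ring.lie_def, Finset.mul_sum, Finset.sum_mul, Finset.sum_sub_distrib]

theorem sum_commutator (s : Finset ι) (a : R) (f : ι → R) :
    ⁅∑ i ∈ s, f i, a⁆ = ∑ i ∈ s, ⁅f i, a⁆ := by
  simp only [Ring.lie_def, Finset.mul_sum, Finset.sum_mul, Finset.sum_sub_distrib]

theorem commutator_smul [Algebra ℂ R] (c : ℂ) (a b : R) : ⁅a, c • b⁆ = c • ⁅a, b⁆ := by
  simp only [Ring.lie_def, mul_smul_comm, smul_mul_assoc, smul_sub]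

theorem smul_commutator [Algebra ℂ R] (c : ℂ) (a b : R) : ⁅c • a, b⁆ = c • ⁅a, b⁆ := by
  simp only [Ring.lie_def, mul_smul_comm, smul_mul_assoc, smul_sub]

theorem commutator_sub (a b c : R) : ⁅a, b - c⁆ = ⁅a, b⁆ - ⁅a, c⁆ := by
  simp only [Ring.lie_def, mul_sub, sub_mul]
  abel

theorem commutator_add (a b c : R) : ⁅a, b + c⁆ = ⁅a, b⁆ + ⁅a, c⁆ := by
  simp only [Ring.lie_def, mul_add, add_mul]
  abel

theorem add_commutator (a b c : R) : ⁅a + b, c⁆ = ⁅a, c⁆ + ⁅b, c⁆ := by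
  simp only [Ring.lie_def, mul_add, add_mul]
  abel

theorem neg_commutator_swap (a b : R) : -⁅b, a⁆ = ⁅a, b⁆ := by
  simp only [Ring.lie_def, neg_sub]

end RingBracket

theorem lie_eq_zero_of_comm {R : Type} [Ring R] {a b : R} (h : a * b = b * a) : ⁅a, b⁆ = 0 := by
  rw [Ring.lie_def, h, sub_self]

theorem lie_epsSum (a : ModeAlg) (i j : Fin 3) (v : Fin 3 → ModeAlg) :
    ⁅a, epsSum i j v⁆ = epsSum i j fun k => ⁅a, v k⁆ := by
  simp only [epsSum, Ring.lie_def, Finset.mul_sum, Finset.sum_mul, Finset.sum_sub_distrib,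
    mul_smul_comm,
    smul_mul_assoc, smul_sub]

/-- `∑ uⁱ x*ᵢ,ₙ`. -/
def modeXs (u : Fin 3 → ℂ) (n : ℤ) : ModeAlg := ∑ i, u i • op (.xs i n)

/-- `∑ cₖ xᵏₙ`. -/
def modeX (c : Fin 3 → ℂ) (n : ℤ) : ModeAlg := ∑ k, c k • op (.x k n)

/-- `∑ cₖ Wᵏ`. -/
def modeW (c : Fin 3 → ℂ) : ModeAlg := ∑ k, c k • op (.W k)

/-- `∑ uⁱ εᵢⱼₖ Wʲ xᵏₙ`. -/
def modeWX (u : Fin 3 → ℂ) (n : ℤ) : ModeAlg :=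
  ∑ i, u i • ∑ j, epsSum i j fun k => op (.W j) * op (.x k n)

/-- `∑ uⁱ Qᵢ`. -/
def modeQ (u : Fin 3 → ℂ) : ModeAlg := ∑ i, u i • opQ i

/-- The cross product `εᵢⱼₖ uⁱ wʲ`. -/
def cross (u w : Fin 3 → ℂ) (k : Fin 3) : ℂ := ∑ i, ∑ j, (eps i j k : ℂ) * (u i * w j)

theorem cross_swap (u w : Fin 3 → ℂ) (k : Fin 3) : cross u w k = -cross w u k := by
  fin_cases k <;> simp [cross, Fin.sum_univ_three, eps] <;> ring

theorem cross_self (u : Fin 3 → ℂ) (k : Fin 3) : cross u u k = 0 := by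
  fin_cases k <;> simp [cross, Fin.sum_univ_three, eps] <;> ring

theorem modeX_eq_zero {c : Fin 3 → ℂ} (hc : ∀ k, c k = 0) (n : ℤ) : modeX c n = 0 := by
  simp [modeX, hc]

theorem sum_smul_epsSum {V : Type} [AddCommGroup V] [Module ℂ V] (u w : Fin 3 → ℂ)
    (v : Fin 3 → V) : ∑ i, u i • ∑ j, w j • epsSum i j v = ∑ k, cross u w k • v k := by
  simp only [epsSum, Fin.sum_univ_three, eps, cross]
  simp
  module

theorem sum_smul_epsSum_smul {V : Type} [AddCommGroup V] [Module ℂ V] (u w : Fin 3 → ℂ)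
    (v : Fin 3 → V) : ∑ i, u i • ∑ j, epsSum i j (fun k => w k • v j) =
      ∑ k, cross w u k • v k := by
  simp only [epsSum, Fin.sum_univ_three, eps, cross]
  simp
  module

theorem lie_W_W (i j : Fin 3) : ⁅op (.W i), op (.W j)⁆ = 0 := lie_eq_zero_of_comm (W_mul_W i j)

theorem lie_W_x (i j : Fin 3) (n : ℤ) : ⁅op (.W i), op (.x j n)⁆ = 0 :=
  lie_eq_zero_of_comm (W_mul_x i j n)

theorem lie_x_W (i j : Fin 3) (n : ℤ) : ⁅op (.x j n), op (.W i)⁆ = 0 :=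
  lie_eq_zero_of_comm (W_mul_x i j n).symm

theorem lie_P_W (i j : Fin 3) : ⁅op (.P i), op (.W j)⁆ = 0 := lie_eq_zero_of_comm (P_mul_W i j)

theorem lie_x_x (i j : Fin 3) (m n : ℤ) : ⁅op (.x i m), op (.x j n)⁆ = 0 :=
  lie_eq_zero_of_comm (x_mul_x i j m n)

theorem lie_P_x (i j : Fin 3) {n : ℤ} (hn : n ≠ 0) : ⁅op (.P i), op (.x j n)⁆ = 0 := by
  rw [Ring.lie_def, P_mul_x, if_neg (fun h => hn h.2), add_zero, sub_self]

theorem lie_W_xs (i j : Fin 3) {n : ℤ} (hn : n ≠ 0) : ⁅op (.W i), op (.xs j n)⁆ = 0 := by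
  rw [Ring.lie_def, W_mul_xs, if_neg (fun h => hn h.2), add_zero, sub_self]

theorem lie_P_xs (i j : Fin 3) (n : ℤ) : ⁅op (.P i), op (.xs j n)⁆ =
    -((1 / 2 : ℂ) • epsSum i j fun k => op (.x k n)) := by
  rw [Ring.lie_def, P_mul_xs, sub_sub_cancel_left]

theorem lie_xs_x (i j : Fin 3) (n m : ℤ) : ⁅op (.xs i n), op (.x j m)⁆ =
    (if i = j ∧ m = -n ∧ m ≠ 0 then 1 / (m : ℂ) else 0) • 1 := by
  rw [Ring.lie_def, xs_mul_x, add_sub_cancel_left, Algebra.algebraMap_eq_smul_one]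

theorem lie_xs_xs (i j : Fin 3) (m n : ℤ) : ⁅op (.xs i m), op (.xs j n)⁆ =
    bracketCoeff m n • (epsSum i j fun k => op (.x k (m + n))) +
      (if m = -n ∧ m ≠ 0 then 1 / (m : ℂ) ^ 2 else 0) • epsSum i j fun k => op (.W k) := by
  rw [Ring.lie_def, xs_mul_xs, add_sub_cancel_left]

theorem lie_modeXs_modeXs (u w : Fin 3 → ℂ) (m n : ℤ) : ⁅modeXs u m, modeXs w n⁆ =
    bracketCoeff m n • modeX (cross u w) (m + n) +
      (if m = -n ∧ m ≠ 0 then 1 / (m : ℂ) ^ 2 else 0) • modeW (cross u w) := by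
  simp only [modeXs, sum_commutator, smul_commutator, commutator_sum, commutator_smul, lie_xs_xs,
    modeX, modeW,
    ← sum_smul_epsSum, smul_add, Finset.sum_add_distrib, Finset.smul_sum]
  congr 1 <;>
  · refine Finset.sum_comm.trans (Finset.sum_congr rfl fun i _ => Finset.sum_congr rfl fun j _ => ?_)
    module

theorem lie_modeXs_x (u : Fin 3 → ℂ) (n : ℤ) (k : Fin 3) (m : ℤ) : ⁅modeXs u n, op (.x k m)⁆ =
    (if m = -n ∧ m ≠ 0 then 1 / (m : ℂ) else 0) • u k • 1 := by
  simp only [modeXs, sum_commutator, smul_commutator, lie_xs_x]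
  rw [Finset.sum_eq_single k]
  · simp only [true_and]
    rw [smul_comm]
  · intro i _ hi
    simp [hi]
  · simp

theorem lie_modeXs_W (u : Fin 3 → ℂ) {n : ℤ} (hn : n ≠ 0) (k : Fin 3) :
    ⁅modeXs u n, op (.W k)⁆ = 0 := by
  simp only [modeXs, sum_commutator, smul_commutator]
  exact Finset.sum_eq_zero fun i _ => by rw [← neg_commutator_swap, lie_W_xs _ _ hn, neg_zero,
    smul_zero]

theorem lie_modeXs_modeW (u c : Fin 3 → ℂ) {n : ℤ} (hn : n ≠ 0) : ⁅modeXs u n, modeW c⁆ = 0 := by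
  simp only [modeW, commutator_sum, commutator_smul, lie_modeXs_W u hn, smul_zero,
    Finset.sum_const_zero]

theorem lie_modeXs_modeX (u c : Fin 3 → ℂ) (n m : ℤ) : ⁅modeXs u n, modeX c m⁆ =
    ((if m = -n ∧ m ≠ 0 then 1 / (m : ℂ) else 0) * ∑ k, c k * u k) • 1 := by
  simp only [modeX, commutator_sum, commutator_smul, lie_modeXs_x, Finset.mul_sum, Finset.sum_smul]
  refine Finset.sum_congr rfl fun k _ => ?_
  module

theorem lie_modeXs_modeWX (u w : Fin 3 → ℂ) {n : ℤ} (hn : n ≠ 0) (m : ℤ) :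
    ⁅modeXs u n, modeWX w m⁆ =
      (if m = -n ∧ m ≠ 0 then 1 / (m : ℂ) else 0) • modeW (cross u w) := by
  simp only [modeWX, commutator_sum, commutator_smul, lie_epsSum, lie_mul_left_eq,
    lie_modeXs_W u hn, zero_mul,
    zero_add, lie_modeXs_x, modeW, ← sum_smul_epsSum_smul, Finset.smul_sum, mul_smul_comm, mul_one]
  refine Finset.sum_congr rfl fun i _ => ?_
  rw [Finset.sum_congr rfl]
  intro j _
  rw [epsSum_smul, smul_comm]

theorem lie_x_modeWX (w : Fin 3 → ℂ) (k : Fin 3) (m n : ℤ) : ⁅op (.x k n), modeWX w m⁆ = 0 := by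
  simp only [modeWX, commutator_sum, commutator_smul, lie_epsSum, lie_mul_left_eq, lie_x_W,
    lie_x_x, zero_mul,
    mul_zero, add_zero, epsSum_const_zero, smul_zero, Finset.sum_const_zero]

theorem lie_W_modeWX (w : Fin 3 → ℂ) (k : Fin 3) (m : ℤ) : ⁅op (.W k), modeWX w m⁆ = 0 := by
  simp only [modeWX, commutator_sum, commutator_smul, lie_epsSum, lie_mul_left_eq, lie_W_W,
    lie_W_x, zero_mul,
    mul_zero, add_zero, epsSum_const_zero, smul_zero, Finset.sum_const_zero]

theorem lie_modeX_modeWX (c w : Fin 3 → ℂ) (m n : ℤ) : ⁅modeX c n, modeWX w m⁆ = 0 := by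
  simp only [modeX, sum_commutator, smul_commutator, lie_x_modeWX, smul_zero, Finset.sum_const_zero]

theorem lie_modeW_modeWX (c w : Fin 3 → ℂ) (m : ℤ) : ⁅modeW c, modeWX w m⁆ = 0 := by
  simp only [modeW, sum_commutator, smul_commutator, lie_W_modeWX, smul_zero, Finset.sum_const_zero]

theorem lie_modeWX_modeWX (u w : Fin 3 → ℂ) (m n : ℤ) : ⁅modeWX u n, modeWX w m⁆ = 0 := by
  have h1 : ∀ j, ⁅modeWX u n, op (.W j)⁆ = 0 := fun j => by
    rw [← neg_commutator_swap, lie_W_modeWX, neg_zero]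
  have h2 : ∀ k, ⁅modeWX u n, op (.x k m)⁆ = 0 := fun k => by
    rw [← neg_commutator_swap, lie_x_modeWX, neg_zero]
  rw [modeWX.eq_1 w]
  simp only [commutator_sum, commutator_smul, lie_epsSum, lie_mul_left_eq, h1, h2, zero_mul,
    mul_zero, add_zero, epsSum_const_zero, smul_zero, Finset.sum_const_zero]

theorem lie_opQ (a : ModeAlg) (i : Fin 3) : ⁅a, opQ i⁆ = ⁅a, op (.P i)⁆ - (1 / 2 : ℂ) •
    ∑ j, epsSum i j fun k => ⁅a, op (.x j 0)⁆ * op (.W k) + op (.x j 0) * ⁅a, op (.W k)⁆ := by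
  simp only [opQ, commutator_sub, commutator_smul, commutator_sum, lie_epsSum, lie_mul_left_eq]

theorem lie_opQ_eq_lie_P {a : ModeAlg} (hx : ∀ j, ⁅a, op (.x j 0)⁆ = 0)
    (hW : ∀ k, ⁅a, op (.W k)⁆ = 0) (i : Fin 3) : ⁅a, opQ i⁆ = ⁅a, op (.P i)⁆ := by
  simp only [lie_opQ, hx, hW, zero_mul, mul_zero, add_zero, epsSum_const_zero, smul_zero,
    Finset.sum_const_zero, sub_zero]

theorem lie_W_modeQ (u : Fin 3 → ℂ) (k : Fin 3) : ⁅op (.W k), modeQ u⁆ = 0 := by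
  have h : ∀ i, ⁅op (.W k), op (.P i)⁆ = 0 := fun i => by rw [← neg_commutator_swap, lie_P_W,
    neg_zero]
  simp only [modeQ, commutator_sum, commutator_smul,
    lie_opQ_eq_lie_P (fun j => lie_W_x k j 0) (fun j => lie_W_W k j), h, smul_zero,
    Finset.sum_const_zero]

theorem lie_x_modeQ (u : Fin 3 → ℂ) (k : Fin 3) {n : ℤ} (hn : n ≠ 0) :
    ⁅op (.x k n), modeQ u⁆ = 0 := by
  have h : ∀ i, ⁅op (.x k n), op (.P i)⁆ = 0 := fun i => by
    rw [← neg_commutator_swap, lie_P_x _ _ hn, neg_zero]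
  simp only [modeQ, commutator_sum, commutator_smul,
    lie_opQ_eq_lie_P (fun j => lie_x_x k j n 0) (fun j => lie_x_W j k n), h, smul_zero,
    Finset.sum_const_zero]

theorem lie_modeX_modeQ (c u : Fin 3 → ℂ) {n : ℤ} (hn : n ≠ 0) : ⁅modeX c n, modeQ u⁆ = 0 := by
  simp only [modeX, sum_commutator, smul_commutator, lie_x_modeQ u _ hn, smul_zero,
    Finset.sum_const_zero]

theorem lie_modeQ_modeWX (u w : Fin 3 → ℂ) {n : ℤ} (hn : n ≠ 0) : ⁅modeQ u, modeWX w n⁆ = 0 := by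
  have h1 : ∀ j, ⁅modeQ u, op (.W j)⁆ = 0 := fun j => by
    rw [← neg_commutator_swap, lie_W_modeQ, neg_zero]
  have h2 : ∀ k, ⁅modeQ u, op (.x k n)⁆ = 0 := fun k => by
    rw [← neg_commutator_swap, lie_x_modeQ _ _ hn, neg_zero]
  simp only [modeWX, commutator_sum, commutator_smul, lie_epsSum, lie_mul_left_eq, h1, h2, zero_mul,
    mul_zero, add_zero, epsSum_const_zero, smul_zero, Finset.sum_const_zero]

/-- For `n ≠ 0` the modes `x*ₙ` commute with `x₀` and `W`, so the correction in `Q` does not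
contribute and the bracket is that of `P`. -/
theorem lie_modeQ_modeXs (u w : Fin 3 → ℂ) {n : ℤ} (hn : n ≠ 0) :
    ⁅modeQ u, modeXs w n⁆ = -((1 / 2 : ℂ) • modeX (cross u w) n) := by
  have h0 : ∀ i j, ⁅op (.xs j n), opQ i⁆ = ⁅op (.xs j n), op (.P i)⁆ := fun i j => by
    refine lie_opQ_eq_lie_P (fun k => ?_) (fun k => ?_) i
    · rw [lie_xs_x, if_neg (fun h => h.2.2 rfl), zero_smul]
    · rw [← neg_commutator_swap, lie_W_xs _ _ hn, neg_zero]
  have h : ∀ i j, ⁅opQ i, op (.xs j n)⁆ = -((1 / 2 : ℂ) • epsSum i j fun k => op (.x k n)) := by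
    intro i j
    rw [← neg_commutator_swap, h0, neg_commutator_swap, lie_P_xs]
  simp only [modeQ, modeXs, modeX, sum_commutator, smul_commutator, commutator_sum,
    commutator_smul, h, ← sum_smul_epsSum,
    Finset.smul_sum, smul_neg, Finset.sum_neg_distrib, neg_inj]
  refine Finset.sum_comm.trans (Finset.sum_congr rfl fun i _ => Finset.sum_congr rfl fun j _ => ?_)
  module

/-! ### The automorphism `exp (ad α₀)` on the modes of a vertex operator -/

theorem conjExp_op_eq (w : Fin 3 → ℂ) (g : Mode) :
    conjExp w (op g) = op g + ⁅alphaZero w, op g⁆ := conjExp_op w g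

theorem expZero_smul (w : Fin 3 → ℂ) (a : ModeAlg) (v : States) :
    expZero w (a • v) = conjExp w a • expZero w v := by
  obtain ⟨t, rfl⟩ := Submodule.Quotient.mk_surjective _ v
  change indRel.mkQ (preExp w (a • t)) = _ • indRel.mkQ (preExp w t)
  rw [preExp_smul, map_smul]

theorem conjExp_x (w : Fin 3 → ℂ) (k : Fin 3) (n : ℤ) : conjExp w (op (.x k n)) = op (.x k n) := by
  rw [conjExp_op, shift, adZero_x, add_zero]

theorem conjExp_W (w : Fin 3 → ℂ) (k : Fin 3) :
    conjExp w (op (.W k)) = op (.W k) - w k • 1 := by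
  rw [conjExp_op, shift, adZero_W, map_neg, Algebra.algebraMap_eq_smul_one, sub_eq_add_neg]

theorem conjExp_modeXs (u w : Fin 3 → ℂ) (n : ℤ) : conjExp w (modeXs u n) =
    modeXs u n + bracketCoeff 0 n • modeX (cross w u) n := by
  have : ⁅alphaZero w, modeXs u n⁆ = bracketCoeff 0 n • modeX (cross w u) n := by
    rw [show alphaZero w = modeXs w 0 from rfl, lie_modeXs_modeXs, zero_add,
      if_neg (fun h => h.2 rfl), zero_smul, add_zero]
  rw [← this]
  simp only [modeXs, map_sum, map_smul, conjExp_op_eq, smul_add, Finset.sum_add_distrib,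
    commutator_sum,
    commutator_smul]

theorem conjExp_modeXs_self (w : Fin 3 → ℂ) (n : ℤ) : conjExp w (modeXs w n) = modeXs w n := by
  rw [conjExp_modeXs, modeX_eq_zero (cross_self w), smul_zero, add_zero]

theorem conjExp_modeWX_self (w : Fin 3 → ℂ) (n : ℤ) : conjExp w (modeWX w n) = modeWX w n := by
  simp only [modeWX, map_sum, map_smul, map_epsSum (conjExp w), map_mul, conjExp_x, conjExp_W,
    sub_mul, smul_mul_assoc, one_mul]
  simp only [epsSum, Fin.sum_univ_three, eps]
  simp
  module

/-! ### Exponential ground states -/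

/-- The constant wave function `1`. -/
def oneWave : Wave := ⟨fun _ => 1, (contDiff_const : ContDiff ℝ ∞ fun _ : Coord => (1 : ℂ))⟩

theorem mul_expWave_expWave (u v : Fin 3 → ℂ) :
    Wave.mul (expWave u) (expWave v) = expWave (u + v) := by
  refine Subtype.ext (funext fun p => ?_)
  change Complex.exp _ * Complex.exp _ = Complex.exp _
  rw [← Complex.exp_add, ← Finset.sum_add_distrib]
  simp [add_mul]

theorem expZero_ket_oneWave (u : Fin 3 → ℂ) : expZero u (ket oneWave) = ket (expWave u) := by
  rw [expZero_ket]
  congr 1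
  exact Subtype.ext (funext fun p => mul_one _)

theorem op_W_smul_ket_oneWave (k : Fin 3) : op (.W k) • ket oneWave = 0 := by
  have : zeroAct (.W k) oneWave = 0 := by
    refine Subtype.ext (funext fun p => ?_)
    change fderiv ℝ (fun _ : Coord => (1 : ℂ)) p _ = 0
    simp
  rw [← ketLin_apply, op_smul_ket _ le_rfl, this, map_zero]

theorem op_P_smul_ket_oneWave (k : Fin 3) : op (.P k) • ket oneWave = 0 := by
  have : zeroAct (.P k) oneWave = 0 := by
    refine Subtype.ext (funext fun p => ?_)
    change fderiv ℝ (fun _ : Coord => (1 : ℂ)) p _ = 0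
    simp
  rw [← ketLin_apply, op_smul_ket _ le_rfl, this, map_zero]

theorem conjExp_P (w : Fin 3 → ℂ) (i : Fin 3) : conjExp w (op (.P i)) = op (.P i) +
    ∑ j, w j • (1 / 2 : ℂ) • epsSum i j fun k => op (.x k 0) := by
  rw [conjExp_op, shift, adZero_P]

/-- The shift of `Pᵢ` by modes `x₀` cancels against the shift of `Wᵏ` by scalars in the correction
`-½ εᵢⱼₖ xʲ₀ Wᵏ`. -/
theorem conjExp_opQ (w : Fin 3 → ℂ) (i : Fin 3) : conjExp w (opQ i) = opQ i := by
  simp only [opQ, map_sub, map_sum, map_smul, map_epsSum (conjExp w), map_mul, conjExp_x,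
    conjExp_W, conjExp_P, mul_sub, mul_smul_comm, mul_one]
  fin_cases i <;>
  · simp only [epsSum, Fin.sum_univ_three, eps]
    simp
    module

theorem conjExp_modeQ (u w : Fin 3 → ℂ) : conjExp w (modeQ u) = modeQ u := by
  simp only [modeQ, map_sum, map_smul, conjExp_opQ]

/-- `Q` annihilates the constant wave function, and `e^{α₀}`, which produces `|e^w⟩` from it,
commutes with `Q`. -/
theorem modeQ_smul_ket_expWave (u w : Fin 3 → ℂ) : modeQ u • ket (expWave w) = 0 := by
  have h : ∀ i, opQ i • ket oneWave = 0 := by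
    intro i
    simp only [opQ, epsSum, sub_smul, smul_assoc, Finset.sum_smul, mul_smul,
      op_P_smul_ket_oneWave, op_W_smul_ket_oneWave, smul_zero, Finset.sum_const_zero, sub_zero]
  rw [← expZero_ket_oneWave, ← conjExp_modeQ u w, ← expZero_smul]
  simp only [modeQ, Finset.sum_smul, smul_assoc, h, smul_zero, Finset.sum_const_zero, map_zero]

theorem op_W_smul_ket_expWave (k : Fin 3) (w : Fin 3 → ℂ) :
    op (.W k) • ket (expWave w) = w k • ket (expWave w) := by
  have h : conjExp w (op (.W k)) • ket (expWave w) = 0 := by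
    rw [← expZero_ket_oneWave, ← expZero_smul, op_W_smul_ket_oneWave, map_zero]
  rwa [conjExp_W, sub_smul, smul_assoc, one_smul, sub_eq_zero] at h

theorem modeW_smul_ket_expWave (c w : Fin 3 → ℂ) :
    modeW c • ket (expWave w) = (∑ k, c k * w k) • ket (expWave w) := by
  simp only [modeW, Finset.sum_smul, smul_assoc, op_W_smul_ket_expWave, mul_smul]

theorem op_smul_ket_of_pos (g : Mode) (hg : 0 < g.degree) (f : Wave) : op g • ket f = 0 := by
  rw [← ketLin_apply, op_smul_ket g hg.le]
  cases g with
  | W i => exact absurd hg (lt_irrefl _)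
  | P i => exact absurd hg (lt_irrefl _)
  | x i n => rw [zeroAct_x, if_neg (show n ≠ 0 from hg.ne'), map_zero]
  | xs i n => rw [zeroAct_xs, if_neg (show n ≠ 0 from hg.ne'), map_zero]

theorem modeXs_smul_ket (u : Fin 3 → ℂ) {n : ℤ} (hn : 0 < n) (f : Wave) :
    modeXs u n • ket f = 0 := by
  simp only [modeXs, Finset.sum_smul, smul_assoc, op_smul_ket_of_pos (.xs _ n) hn, smul_zero,
    Finset.sum_const_zero]

theorem modeX_smul_ket (u : Fin 3 → ℂ) {n : ℤ} (hn : 0 < n) (f : Wave) :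
    modeX u n • ket f = 0 := by
  simp only [modeX, Finset.sum_smul, smul_assoc, op_smul_ket_of_pos (.x _ n) hn, smul_zero,
    Finset.sum_const_zero]

theorem modeWX_smul_ket (u : Fin 3 → ℂ) {n : ℤ} (hn : 0 < n) (f : Wave) :
    modeWX u n • ket f = 0 := by
  simp only [modeWX, epsSum, Finset.sum_smul, smul_assoc, mul_smul,
    op_smul_ket_of_pos (.x _ n) hn, smul_zero, Finset.sum_const_zero]

theorem CreatedState.modeXs_smul (u : Fin 3 → ℂ) (n : ℤ) {d : ℤ} {v : States}
    (hv : CreatedState d v) : CreatedState (d + n) (modeXs u n • v) := by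
  simp only [modeXs, Finset.sum_smul, smul_assoc]
  exact CreatedState.sum _ _ fun i _ => (createdState_op (.xs i n) hv).smul _

theorem CreatedState.modeWX_smul (u : Fin 3 → ℂ) (n : ℤ) {d : ℤ} {v : States}
    (hv : CreatedState d v) : CreatedState (d + n) (modeWX u n • v) := by
  simp only [modeWX, epsSum, Finset.sum_smul, smul_assoc, mul_smul]
  refine CreatedState.sum _ _ fun i _ => .smul _ (CreatedState.sum _ _ fun j _ =>
    CreatedState.sum _ _ fun k _ => ?_)
  rw [← Int.cast_smul_eq_zsmul ℂ]
  exact (createdState_W j (createdState_x k n hv)).smul _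

/-! ### Exponentials of the half currents -/

open PowerSeries in
theorem coeff_coeff_formalExp_mem {R : Type} [Ring R] [Algebra ℂ R] (S : Subalgebra ℂ R)
    {f : PowerSeries (PowerSeries R)} (hf : ∀ n p, coeff p (coeff n f) ∈ S) (n p : ℕ) :
    coeff p (coeff n (formalExp f)) ∈ S := by
  let T : Subalgebra ℂ (PowerSeries R) :=
    { carrier := {g | ∀ p, coeff p g ∈ S}
      mul_mem' := fun {a b} ha hb p => by
        rw [coeff_mul]
        exact S.sum_mem fun q _ => S.mul_mem (ha _) (hb _)
      add_mem' := fun {a b} ha hb p => by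
        rw [map_add]
        exact S.add_mem (ha p) (hb p)
      algebraMap_mem' := fun c p => by
        rw [PowerSeries.algebraMap_apply, coeff_C]
        split_ifs
        · exact S.algebraMap_mem c
        · exact S.zero_mem }
  exact coeff_formalExp_mem T (fun n p => hf n p) n p

open PowerSeries in
/-- Coefficients of positive degree of an exponential lie in every right ideal that contains the
coefficients of the exponent. -/
theorem coeff_coeff_formalExp_mem_of_pos {R : Type} [Ring R] [Algebra ℂ R] (J : Submodule ℂ R)
    (hJ : ∀ a ∈ J, ∀ r, a * r ∈ J) {f : PowerSeries (PowerSeries R)}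
    (hf : ∀ n p, coeff p (coeff n f) ∈ J) {n : ℕ} (hn : 0 < n) (p : ℕ) :
    coeff p (coeff n (formalExp f)) ∈ J := by
  rw [formalExp, coeff_mk, map_sum]
  refine J.sum_mem fun k _ => ?_
  change (k ! : ℂ)⁻¹ • coeff p (coeff n (f ^ k)) ∈ J
  refine J.smul_mem _ ?_
  rcases k with _ | k
  · rw [pow_zero, coeff_one, if_neg hn.ne', map_zero]
    exact J.zero_mem
  · rw [pow_succ', coeff_mul, map_sum]
    refine J.sum_mem fun q _ => ?_
    rw [coeff_mul]
    exact J.sum_mem fun r _ => hJ _ (hf _ _) _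

/-- The coefficient at `uⁿ (log z)ᵖ` of the exponential of a half current. -/
def expHalf (s : ℤ) (w : Fin 3 → ℂ) (n p : ℕ) : ModeAlg :=
  PowerSeries.coeff p (PowerSeries.coeff n (formalExp (alphaHalf s w)))

theorem coeff_coeff_alphaHalf_mem {s : ℤ} {w : Fin 3 → ℂ} (S : Submodule ℂ ModeAlg)
    (h₁ : ∀ n : ℕ, 0 < n → modeXs w (s * n) ∈ S) (h₂ : ∀ n : ℕ, 0 < n → modeWX w (s * n) ∈ S)
    (n p : ℕ) : PowerSeries.coeff p (PowerSeries.coeff n (alphaHalf s w)) ∈ S := by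
  rw [alphaHalf, PowerSeries.coeff_mk]
  split_ifs with hn
  · rw [map_zero]
    exact S.zero_mem
  · rw [map_add, PowerSeries.coeff_C_mul, PowerSeries.coeff_C, PowerSeries.coeff_X]
    refine S.add_mem ?_ ?_
    · split_ifs
      · exact h₁ n (Nat.pos_of_ne_zero hn)
      · exact S.zero_mem
    · split_ifs
      · rw [mul_one]
        exact S.smul_mem _ (h₂ n (Nat.pos_of_ne_zero hn))
      · rw [mul_zero]
        exact S.zero_mem

theorem expHalf_mem {s : ℤ} {w : Fin 3 → ℂ} (S : Subalgebra ℂ ModeAlg)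
    (h₁ : ∀ n : ℕ, 0 < n → modeXs w (s * n) ∈ S) (h₂ : ∀ n : ℕ, 0 < n → modeWX w (s * n) ∈ S)
    (n p : ℕ) : expHalf s w n p ∈ S :=
  coeff_coeff_formalExp_mem S (coeff_coeff_alphaHalf_mem (Subalgebra.toSubmodule S) h₁ h₂) n p

open PowerSeries in
-- The half current is homogeneous: its coefficient of index `n` shifts degrees by `s n`, whatever
-- the power of the logarithm. Powers inherit this.
theorem CreatedState.expHalf_smul (s : ℤ) (w : Fin 3 → ℂ) (n p : ℕ) {d : ℤ} {v : States}
    (hv : CreatedState d v) : CreatedState (d + s * n) (expHalf s w n p • v) := by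
  have h1 : ∀ (n p : ℕ) (d : ℤ) (v : States), CreatedState d v →
      CreatedState (d + s * n) (coeff p (coeff n (alphaHalf s w)) • v) := by
    intro n p d v hv
    let S : Submodule ℂ ModeAlg :=
      { carrier := {a | CreatedState (d + s * n) (a • v)}
        add_mem' := fun {a b} ha hb => by
          change CreatedState _ _
          rw [add_smul]
          exact .add ha hb
        zero_mem' := by
          change CreatedState _ _
          rw [zero_smul]
          exact .zero _
        smul_mem' := fun c a ha => by
          change CreatedState _ _
          rw [smul_assoc]
          exact .smul c ha }
    change _ ∈ S
    rw [alphaHalf, coeff_mk]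
    split_ifs with hn
    · rw [map_zero]
      exact S.zero_mem
    · rw [map_add, coeff_C_mul, coeff_C, coeff_X]
      refine S.add_mem ?_ ?_
      · split_ifs
        · exact CreatedState.modeXs_smul w (s * n) hv
        · exact S.zero_mem
      · split_ifs
        · rw [mul_one]
          exact S.smul_mem _ (CreatedState.modeWX_smul w (s * n) hv)
        · rw [mul_zero]
          exact S.zero_mem
  have h2 : ∀ (k n p : ℕ) (d : ℤ) (v : States), CreatedState d v →
      CreatedState (d + s * n) (coeff p (coeff n (alphaHalf s w ^ k)) • v) := by
    intro k
    induction k with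
    | zero =>
      intro n p d v hv
      rw [pow_zero, coeff_one]
      split_ifs with hn
      · rw [hn, coeff_one, Nat.cast_zero, mul_zero, add_zero]
        split_ifs
        · rwa [one_smul]
        · rw [zero_smul]; exact .zero _
      · rw [map_zero, zero_smul]; exact .zero _
    | succ k ih =>
      intro n p d v hv
      rw [pow_succ', coeff_mul, map_sum, Finset.sum_smul]
      refine CreatedState.sum _ _ fun q hq => ?_
      rw [coeff_mul, Finset.sum_smul]
      refine CreatedState.sum _ _ fun r _ => ?_
      rw [mul_smul]
      have := h1 q.1 r.1 _ _ (ih q.2 r.2 d v hv)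
      have hn : d + s * n = d + s * q.2 + s * q.1 := by
        rw [← Finset.HasAntidiagonal.mem_antidiagonal.1 hq]
        push_cast
        ring
      rwa [hn]
  rw [expHalf, formalExp, coeff_mk, map_sum, Finset.sum_smul]
  refine CreatedState.sum _ _ fun k _ => ?_
  change CreatedState _ (((k ! : ℂ)⁻¹ • coeff p (coeff n (alphaHalf s w ^ k))) • v)
  rw [smul_assoc]
  exact (h2 k n p d v hv).smul _

theorem expHalf_smul_eq_zero (w : Fin 3 → ℂ) {n : ℕ} (p : ℕ) {d : ℤ} {v : States}
    (hv : CreatedState d v) (hd : 0 < d + n) : expHalf 1 w n p • v = 0 :=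
  (hv.expHalf_smul 1 w n p).eq_zero (by simpa using hd)

theorem mem_centralizer_of_lie {R : Type} [Ring R] [Algebra ℂ R] {a b : R} (h : ⁅a, b⁆ = 0) :
    b ∈ Subalgebra.centralizer ℂ {a} := by
  rw [Subalgebra.mem_centralizer_iff]
  rintro _ rfl
  rwa [Ring.lie_def, sub_eq_zero] at h

/-- With the same vector `w` in both operators, the bracket is proportional to `w × w = 0`. -/
theorem modeQ_mul_expHalf (w : Fin 3 → ℂ) {s : ℤ} (hs : s ≠ 0) (n p : ℕ) :
    modeQ w * expHalf s w n p = expHalf s w n p * modeQ w := by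
  have := expHalf_mem (s := s) (w := w) (Subalgebra.centralizer ℂ {modeQ w})
    (fun n hn => mem_centralizer_of_lie ?_) (fun n hn => mem_centralizer_of_lie ?_) n p
  · exact Subalgebra.mem_centralizer_iff _ |>.1 this _ rfl
  · rw [lie_modeQ_modeXs _ _ (mul_ne_zero hs (by exact_mod_cast hn.ne')),
      modeX_eq_zero (cross_self w), smul_zero, neg_zero]
  · exact lie_modeQ_modeWX _ _ (mul_ne_zero hs (by exact_mod_cast hn.ne'))

theorem conjExp_expHalf (w : Fin 3 → ℂ) (s : ℤ) (n p : ℕ) :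
    conjExp w (expHalf s w n p) = expHalf s w n p :=
  expHalf_mem (AlgHom.equalizer (conjExp w) (AlgHom.id ℂ ModeAlg))
    (fun _ _ => conjExp_modeXs_self w _) (fun _ _ => conjExp_modeWX_self w _) n p

/-! ### Matrix elements of vertex operators -/

theorem cross_dot_left (u w : Fin 3 → ℂ) : ∑ k, cross u w k * u k = 0 := by
  simp [cross, Fin.sum_univ_three, eps]
  ring

theorem cross_dot_right (u w : Fin 3 → ℂ) : ∑ k, cross u w k * w k = 0 := by
  simp [cross, Fin.sum_univ_three, eps]
  ring

theorem lie_modeX_cross_left (u w : Fin 3 → ℂ) (m n : ℤ) :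
    ⁅modeX (cross u w) m, modeXs u n⁆ = 0 := by
  rw [← neg_commutator_swap, lie_modeXs_modeX, cross_dot_left, mul_zero, zero_smul, neg_zero]

theorem lie_modeX_cross_right (u w : Fin 3 → ℂ) (m n : ℤ) :
    ⁅modeX (cross u w) m, modeXs w n⁆ = 0 := by
  rw [← neg_commutator_swap, lie_modeXs_modeX, cross_dot_right, mul_zero, zero_smul, neg_zero]

open PowerSeries in
theorem mul_comm_of_coeff {R : Type} [Ring R] {F G : PowerSeries R}
    (h : ∀ m n, coeff m F * coeff n G = coeff n G * coeff m F) : F * G = G * F := by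
  ext n
  rw [coeff_mul, coeff_mul, ← Finset.Nat.sum_antidiagonal_swap]
  exact Finset.sum_congr rfl fun q _ => h _ _

theorem coeff_zPow (w : Fin 3 → ℂ) (p : ℕ) :
    PowerSeries.coeff p (zPow w) = ((p ! : ℂ)⁻¹) • modeQ w ^ p := by
  rw [zPow, PowerSeries.coeff_mk]
  rfl

theorem zPow_mul_coeff_formalExp (w : Fin 3 → ℂ) {s : ℤ} (hs : s ≠ 0) (n : ℕ) :
    zPow w * PowerSeries.coeff n (formalExp (alphaHalf s w)) =
      PowerSeries.coeff n (formalExp (alphaHalf s w)) * zPow w := by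
  refine mul_comm_of_coeff fun p q => ?_
  have h : Commute (modeQ w) (expHalf s w n q) := modeQ_mul_expHalf w hs n q
  rw [coeff_zPow, smul_mul_assoc, mul_smul_comm]
  exact congrArg _ (h.pow_left p)

theorem coeff_mul_smul_eq (F G : PowerSeries ModeAlg) (p : ℕ) (v : States) :
    PowerSeries.coeff p (F * G) • v = ∑ q ∈ Finset.HasAntidiagonal.antidiagonal p,
      PowerSeries.coeff q.1 F • PowerSeries.coeff q.2 G • v := by
  rw [PowerSeries.coeff_mul, Finset.sum_smul]
  exact Finset.sum_congr rfl fun q _ => mul_smul _ _ _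

/-- The contribution of `z^c` in `exp (α(z)₋)` and `z^(-b)` in `exp (α(z)₊)` to a vertex
operator. -/
def vertexTerm (w : Fin 3 → ℂ) (p c b : ℕ) : ModeAlg :=
  PowerSeries.coeff p (zPow w * PowerSeries.coeff c (formalExp (alphaHalf (-1) w)) *
    PowerSeries.coeff b (formalExp (alphaHalf 1 w)))

theorem vertexTerm_smul_eq_zero (w : Fin 3 → ℂ) (p c : ℕ) {b : ℕ} {d : ℤ} {v : States}
    (hv : CreatedState d v) (hd : 0 < d + b) : vertexTerm w p c b • v = 0 := by
  rw [vertexTerm, coeff_mul_smul_eq]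
  refine Finset.sum_eq_zero fun q _ => ?_
  have := expHalf_smul_eq_zero w q.2 hv hd
  rw [expHalf] at this
  rw [this, smul_zero]

/-- On an exponential ground state the annihilation half current and `Q` act by zero, so only the
constant terms of `exp (α₊)` and `z^{u·Q}` survive; `e^{α₀}` then commutes with the half current of
the same vector. -/
theorem vertex_ket (u v : Fin 3 → ℂ) (b : ℤ) (q : ℕ) : vertex u b q (ket (expWave v)) =
    if 0 ≤ b then expHalf (-1) u b.toNat q • ket (Wave.mul (expWave u) (expWave v)) else 0 := by
  have h0 : ∀ c b : ℕ, b ≠ 0 → vertexTerm u q c b • ket (expWave v) = 0 := fun c b hb =>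
    vertexTerm_smul_eq_zero u q c (.ket _) (by omega)
  have h1 : ∀ c : ℕ, vertexTerm u q c 0 • ket (expWave v) =
      expHalf (-1) u c q • ket (expWave v) := by
    intro c
    rw [vertexTerm, coeff_formalExp_zero, mul_one, zPow_mul_coeff_formalExp u (by norm_num),
      coeff_mul_smul_eq, Finset.sum_eq_single (q, 0)]
    · rw [coeff_zPow, pow_zero, Nat.factorial_zero, Nat.cast_one, inv_one, one_smul, one_smul]
      rfl
    · rintro ⟨q1, q2⟩ hq hne
      have hq2 : q2 ≠ 0 := by
        rintro rfl
        exact hne (by simpa using Finset.HasAntidiagonal.mem_antidiagonal.1 hq)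
      obtain ⟨k, rfl⟩ := Nat.exists_eq_succ_of_ne_zero hq2
      rw [coeff_zPow, Nat.succ_eq_add_one, pow_succ, smul_assoc, mul_smul, modeQ_smul_ket_expWave,
        smul_zero, smul_zero, smul_zero]
    · intro h
      exact absurd (Finset.HasAntidiagonal.mem_antidiagonal.2 (by simp)) h
  change expZero u (∑ᶠ cb ∈ {cb : ℕ × ℕ | (cb.1 : ℤ) - cb.2 = b},
    vertexTerm u q cb.1 cb.2 • ket (expWave v)) = _
  rw [finsum_mem_def]
  split_ifs with hb
  · rw [finsum_eq_single _ (b.toNat, 0), Set.indicator_of_mem, h1, expZero_smul, conjExp_expHalf,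
      expZero_ket]
    · change ((b.toNat : ℕ) : ℤ) - ((0 : ℕ) : ℤ) = b
      omega
    · rintro ⟨c, b'⟩ hne
      rw [Set.indicator_apply_eq_zero]
      intro hm
      change (c : ℤ) - (b' : ℤ) = b at hm
      refine h0 _ _ ?_
      rintro rfl
      exact hne (Prod.ext (by simp at hm ⊢; omega) rfl)
  · rw [finsum_eq_zero_of_forall_eq_zero, map_zero]
    rintro ⟨c, b'⟩
    rw [Set.indicator_apply_eq_zero]
    intro hm
    change (c : ℤ) - (b' : ℤ) = b at hm
    exact h0 _ _ (by omega)

/-! ### Functionals that vanish on images of creation operators -/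

section Bra

variable {Φ : States →ₗ[ℂ] ℂ}

theorem apply_expHalf_neg_smul (hΦ : ∀ (g : Mode) (v : States), g.degree < 0 → Φ (op g • v) = 0)
    (u : Fin 3 → ℂ) {n : ℕ} (hn : 0 < n) (p : ℕ) (v : States) :
    Φ (expHalf (-1) u n p • v) = 0 := by
  let J : Submodule ℂ ModeAlg :=
    { carrier := {a | ∀ v : States, Φ (a • v) = 0}
      add_mem' := fun {a b} ha hb v => by rw [add_smul, map_add, ha, hb, add_zero]
      zero_mem' := fun v => by rw [zero_smul, map_zero]
      smul_mem' := fun c a ha v => by rw [smul_assoc, map_smul, ha, smul_zero] }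
  have hJ : ∀ a ∈ J, ∀ r, a * r ∈ J := fun a ha r v => by rw [mul_smul]; exact ha _
  have hop : ∀ g : Mode, g.degree < 0 → op g ∈ J := fun g hg v => hΦ g v hg
  refine coeff_coeff_formalExp_mem_of_pos J hJ (coeff_coeff_alphaHalf_mem J ?_ ?_) hn p v
  · exact fun m hm => J.sum_mem fun i _ => J.smul_mem _ (hop (.xs i _) (by
      change -1 * (m : ℤ) < 0
      omega))
  · refine fun m hm => J.sum_mem fun i _ => J.smul_mem _ (J.sum_mem fun j _ =>
      J.sum_mem fun k _ => zsmul_mem ?_ _)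
    beta_reduce
    -- The creation operator has to stand on the left for `Φ` to annihilate the product.
    rw [W_mul_x]
    exact hJ _ (hop (.x k _) (by change -1 * (m : ℤ) < 0; omega)) _

theorem apply_vertexTerm_smul (hΦ : ∀ (g : Mode) (v : States), g.degree < 0 → Φ (op g • v) = 0)
    (u : Fin 3 → ℂ) (p : ℕ) {c : ℕ} (hc : 0 < c) (b : ℕ) (v : States) :
    Φ (vertexTerm u p c b • v) = 0 := by
  rw [vertexTerm, zPow_mul_coeff_formalExp u (by norm_num), mul_assoc, coeff_mul_smul_eq, map_sum]
  exact Finset.sum_eq_zero fun q _ => apply_expHalf_neg_smul hΦ u hc _ _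

/-- The creation exponential commutes with `z^{u·Q}`, so it can be moved to the far left, where `Φ`
kills its terms of positive degree. Only `c = 0`, `b = -a` is left. -/
theorem apply_finsum_vertexTerm
    (hΦ : ∀ (g : Mode) (v : States), g.degree < 0 → Φ (op g • v) = 0)
    (u : Fin 3 → ℂ) (a : ℤ) (p : ℕ) {d : ℤ} {v : States} (hv : CreatedState d v) :
    Φ (∑ᶠ cb ∈ {cb : ℕ × ℕ | (cb.1 : ℤ) - cb.2 = a}, vertexTerm u p cb.1 cb.2 • v) =
      if a ≤ 0 then ∑ q ∈ Finset.HasAntidiagonal.antidiagonal p,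
        Φ (expHalf 1 u (-a).toNat q.1 • ((q.2 ! : ℂ)⁻¹) • modeQ u ^ q.2 • v) else 0 := by
  -- A linear map passes through `finsum` when the support is finite: a nonzero term has `b ≤ -d`,
  -- and `c = a + b`.
  have hfin : ({cb : ℕ × ℕ | (cb.1 : ℤ) - cb.2 = a} ∩
      Function.support fun cb : ℕ × ℕ => vertexTerm u p cb.1 cb.2 • v).Finite := by
    refine ((Set.finite_Iic (d.natAbs + a.natAbs)).prod
      (Set.finite_Iic (d.natAbs))).subset ?_
    rintro ⟨c, b⟩ ⟨h1, h2⟩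
    change (c : ℤ) - (b : ℤ) = a at h1
    have : ¬ 0 < d + b := fun h => h2 (vertexTerm_smul_eq_zero u p c hv h)
    exact ⟨Set.mem_Iic.2 (by dsimp only; omega), Set.mem_Iic.2 (by dsimp only; omega)⟩
  have hmap := AddMonoidHom.map_finsum_mem' Φ.toAddMonoidHom hfin
  change Φ _ = ∑ᶠ cb ∈ {cb : ℕ × ℕ | (cb.1 : ℤ) - cb.2 = a},
    Φ (vertexTerm u p cb.1 cb.2 • v) at hmap
  rw [hmap, finsum_mem_def]
  split_ifs with ha
  · rw [finsum_eq_single _ (0, (-a).toNat), Set.indicator_of_mem]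
    · rw [vertexTerm, coeff_formalExp_zero, mul_one, zPow_mul_coeff_formalExp u (by norm_num),
        coeff_mul_smul_eq, map_sum]
      refine Finset.sum_congr rfl fun q _ => ?_
      rw [coeff_zPow, smul_assoc]
      rfl
    · change ((0 : ℕ) : ℤ) - (((-a).toNat : ℕ) : ℤ) = a
      omega
    · rintro ⟨c, b⟩ hne
      rw [Set.indicator_apply_eq_zero]
      intro hm
      change (c : ℤ) - (b : ℤ) = a at hm
      refine apply_vertexTerm_smul hΦ u p (Nat.pos_of_ne_zero ?_) _ _
      rintro rfl
      exact hne (Prod.ext rfl (by simp at hm ⊢; omega))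
  · rw [finsum_eq_zero_of_forall_eq_zero]
    rintro ⟨c, b⟩
    rw [Set.indicator_apply_eq_zero]
    intro hm
    change (c : ℤ) - (b : ℤ) = a at hm
    exact apply_vertexTerm_smul hΦ u p (by omega) _ _

end Bra

/-- The span of the images of the creation operators `∑ cₖ xᵏ₋ₘ`, `m > 0`. -/
def createdSpan (c : Fin 3 → ℂ) : Submodule ℂ States :=
  Submodule.span ℂ {y | ∃ m : ℕ, 0 < m ∧ ∃ v : States, y = modeX c (-m) • v}

theorem modeX_smul_mem_createdSpan (c : Fin 3 → ℂ) {m : ℕ} (hm : 0 < m) (v : States) :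
    modeX c (-m) • v ∈ createdSpan c :=
  Submodule.subset_span ⟨m, hm, v, rfl⟩

theorem smul_mem_createdSpan {c : Fin 3 → ℂ} {a : ModeAlg}
    (ha : ∀ m : ℕ, 0 < m → ⁅modeX c (-m), a⁆ = 0) {y : States} (hy : y ∈ createdSpan c) :
    a • y ∈ createdSpan c := by
  unfold createdSpan at hy
  induction hy using Submodule.span_induction with
  | mem y hy =>
    obtain ⟨m, hm, v, rfl⟩ := hy
    have h := ha m hm
    rw [Ring.lie_def, sub_eq_zero] at h
    rw [← mul_smul, ← h, mul_smul]
    exact modeX_smul_mem_createdSpan c hm _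
  | zero => rw [smul_zero]; exact Submodule.zero_mem _
  | add v w _ _ h₁ h₂ => rw [smul_add]; exact Submodule.add_mem _ h₁ h₂
  | smul r v _ h => rw [← scalar_smul_comm]; exact Submodule.smul_mem _ r h

theorem apply_createdSpan {Φ : States →ₗ[ℂ] ℂ}
    (hΦ : ∀ (g : Mode) (v : States), g.degree < 0 → Φ (op g • v) = 0) {c : Fin 3 → ℂ}
    {y : States} (hy : y ∈ createdSpan c) : Φ y = 0 := by
  unfold createdSpan at hy
  induction hy using Submodule.span_induction with
  | mem y hy =>
    obtain ⟨m, hm, v, rfl⟩ := hy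
    simp only [modeX, Finset.sum_smul, smul_assoc, map_sum, map_smul]
    refine Finset.sum_eq_zero fun k _ => ?_
    rw [hΦ (.x k _) v (show -(m : ℤ) < 0 by omega), smul_zero]
  | zero => rw [map_zero]
  | add v w _ _ h₁ h₂ => rw [map_add, h₁, h₂, add_zero]
  | smul r v _ h => rw [map_smul, h, smul_zero]

theorem lie_modeX_expHalf {c u : Fin 3 → ℂ} {m : ℤ} (h : ∀ n, ⁅modeX c m, modeXs u n⁆ = 0)
    (s : ℤ) (n p : ℕ) : ⁅modeX c m, expHalf s u n p⁆ = 0 := by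
  have := expHalf_mem (s := s) (w := u) (Subalgebra.centralizer ℂ {modeX c m})
    (fun n _ => mem_centralizer_of_lie (h _))
    (fun n _ => mem_centralizer_of_lie (lie_modeX_modeWX _ _ _ _)) n p
  exact lie_eq_zero_of_comm (Subalgebra.mem_centralizer_iff _ |>.1 this _ rfl)

/-- Since `Q` kills the ket, only its bracket with the exponential matters. By the Leibniz rule this
contains a factor `c·x₋ₙ`, which commutes with everything to its left. -/
theorem modeQ_smul_expHalf_mem (u w v : Fin 3 → ℂ) (b q : ℕ) :
    modeQ u • expHalf (-1) w b q • ket (expWave v) ∈ createdSpan (cross u w) := by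
  -- The first condition makes multiplication by `a` preserve `createdSpan`; with it the second
  -- condition is stable under products.
  let S : Subalgebra ℂ ModeAlg :=
    { carrier := {a | (∀ m : ℕ, 0 < m → ⁅modeX (cross u w) (-m), a⁆ = 0) ∧
        ∀ y : States, ⁅modeQ u, a⁆ • y ∈ createdSpan (cross u w)}
      mul_mem' := fun {a b} ha hb => ⟨fun m hm => by
          rw [lie_mul_left_eq, ha.1 m hm, hb.1 m hm, zero_mul, mul_zero, add_zero],
        fun y => by
          rw [lie_mul_left_eq, add_smul, mul_smul, mul_smul]
          exact Submodule.add_mem _ (ha.2 _) (smul_mem_createdSpan ha.1 (hb.2 _))⟩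
      add_mem' := fun {a b} ha hb => ⟨fun m hm => by
          rw [commutator_add, ha.1 m hm, hb.1 m hm, add_zero],
        fun y => by
          rw [commutator_add, add_smul]
          exact Submodule.add_mem _ (ha.2 _) (hb.2 _)⟩
      algebraMap_mem' := fun r => ⟨fun m _ => lie_eq_zero_of_comm (Algebra.commutes r _).symm,
        fun y => by
          rw [lie_eq_zero_of_comm (Algebra.commutes r _).symm, zero_smul]
          exact Submodule.zero_mem _⟩ }
  have hS : expHalf (-1) w b q ∈ S := by
    refine expHalf_mem S (fun n hn => ⟨fun m _ => lie_modeX_cross_right _ _ _ _, fun y => ?_⟩)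
      (fun n hn => ⟨fun m _ => lie_modeX_modeWX _ _ _ _, fun y => ?_⟩) b q
    · rw [lie_modeQ_modeXs _ _ (by omega), neg_smul, smul_assoc, neg_one_mul]
      exact Submodule.neg_mem _ (Submodule.smul_mem _ _ (modeX_smul_mem_createdSpan _ hn y))
    · rw [lie_modeQ_modeWX _ _ (by omega), zero_smul]
      exact Submodule.zero_mem _
  have h := hS.2 (ket (expWave v))
  rwa [Ring.lie_def, sub_smul, mul_smul, mul_smul, modeQ_smul_ket_expWave, smul_zero,
    sub_zero] at h

/-- Conjugation by `e^{α₀}` fixes `xₙ` and changes `x*ₙ` only by modes `xₙ` of the same negative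
degree. -/
theorem comp_expZero_op_smul {Ψ : States →ₗ[ℂ] ℂ}
    (hΨ : ∀ (g : Mode) (v : States), g.degree < 0 → Ψ (op g • v) = 0) (u : Fin 3 → ℂ)
    (g : Mode) (v : States) (hg : g.degree < 0) : (Ψ.comp (expZero u)) (op g • v) = 0 := by
  rw [LinearMap.comp_apply, expZero_smul, conjExp_op, shift, add_smul, map_add, hΨ g _ hg, zero_add]
  cases g with
  | W i => exact absurd hg (lt_irrefl _)
  | P i => exact absurd hg (lt_irrefl _)
  | x i n => rw [adZero_x, zero_smul, map_zero]
  | xs i n =>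
    have hn : n < 0 := hg
    rw [adZero_xs, if_neg hn.ne]
    simp only [epsSum, Finset.sum_smul, smul_assoc, map_sum, map_smul]
    refine Finset.sum_eq_zero fun j _ => ?_
    rw [Finset.sum_eq_zero, smul_zero, smul_zero]
    intro k _
    rw [← Int.cast_smul_eq_zsmul ℂ, map_smul, hΨ (.x k n) _ hn, smul_zero]

/-- The inner vertex operator is known from `vertex_ket`. In the outer one, a positive power of `Q`
sends the state into `createdSpan`, which `Q` and the annihilation half current preserve and on
which the functional vanishes. -/
theorem correlator_eq {ψ : L2Y} {Ψ : States →ₗ[ℂ] ℂ} (hΨ : IsBra ψ Ψ) (u₁ u₂ u₃ : Fin 3 → ℂ)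
    (a : ℤ) (p : ℕ) (b : ℤ) (q : ℕ) : correlator Ψ u₁ u₂ u₃ a p b q =
      if a ≤ 0 ∧ 0 ≤ b then (Ψ.comp (expZero u₁)) (expHalf 1 u₁ (-a).toNat p •
        expHalf (-1) u₂ b.toNat q • ket (expWave (u₂ + u₃))) else 0 := by
  have hΦ := comp_expZero_op_smul hΨ.2 u₁
  rw [correlator, vertex_ket, mul_expWave_expWave]
  by_cases hb : 0 ≤ b
  · rw [if_pos hb]
    have h := apply_finsum_vertexTerm hΦ u₁ a p
      ((CreatedState.ket (expWave (u₂ + u₃))).expHalf_smul (-1) u₂ b.toNat q)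
    refine Eq.trans h ?_
    by_cases ha : a ≤ 0
    · rw [if_pos ha, if_pos ⟨ha, hb⟩, Finset.sum_eq_single (p, 0)]
      · rw [pow_zero, Nat.factorial_zero, Nat.cast_one, inv_one, one_smul, one_smul]
      · rintro ⟨p1, p2⟩ hp hne
        have hp2 : p2 ≠ 0 := by
          rintro rfl
          exact hne (by simpa using Finset.HasAntidiagonal.mem_antidiagonal.1 hp)
        obtain ⟨k, rfl⟩ := Nat.exists_eq_succ_of_ne_zero hp2
        refine apply_createdSpan hΦ (c := cross u₁ u₂) ?_
        refine smul_mem_createdSpan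
          (fun m _ => lie_modeX_expHalf (lie_modeX_cross_left _ _ _) _ _ _) ?_
        refine Submodule.smul_mem _ _ ?_
        rw [Nat.succ_eq_add_one, pow_succ, mul_smul]
        refine smul_mem_createdSpan (fun m hm => ?_) (modeQ_smul_expHalf_mem _ _ _ _ _)
        have hc := lie_modeX_modeQ (cross u₁ u₂) u₁ (n := -m) (by omega)
        rw [Ring.lie_def, sub_eq_zero] at hc
        exact lie_eq_zero_of_comm (Commute.pow_right hc k)
      · intro h
        exact absurd (Finset.HasAntidiagonal.mem_antidiagonal.2 (by simp)) h
    · rw [if_neg ha, if_neg fun h => ha h.1]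
  · rw [if_neg hb, if_neg fun h => hb h.2]
    have h := apply_finsum_vertexTerm hΦ u₁ a p (CreatedState.zero 0)
    refine Eq.trans h ?_
    simp

/-! ### Specialization of the logarithms -/

section Specialize

open Polynomial

variable {R : Type} [Ring R] [Algebra ℂ R]

/-- A polynomial as a power series. -/
def polyToSeries : R[X] →ₐ[ℂ] PowerSeries R :=
  { eval₂RingHom' (PowerSeries.C : R →+* PowerSeries R) PowerSeries.X
      (fun _ => PowerSeries.commute_X _) with
    commutes' := fun c => by
      change eval₂ _ _ (algebraMap ℂ R[X] c) = _
      rw [Polynomial.algebraMap_apply, eval₂_C, PowerSeries.algebraMap_apply] }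

theorem polyToSeries_C (a : R) : polyToSeries (C a) = PowerSeries.C a := eval₂_C _ _

theorem polyToSeries_X : polyToSeries (X : R[X]) = PowerSeries.X := eval₂_X _ _

theorem coeff_polyToSeries (f : R[X]) (p : ℕ) :
    PowerSeries.coeff p (polyToSeries f) = f.coeff p := by
  induction f using Polynomial.induction_on' with
  | add f g hf hg => rw [map_add, map_add, hf, hg, coeff_add]
  | monomial n a =>
    rw [← C_mul_X_pow_eq_monomial, map_mul, map_pow, polyToSeries_C, polyToSeries_X,
      PowerSeries.coeff_C_mul, PowerSeries.coeff_X_pow, coeff_C_mul, coeff_X_pow]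

/-- Evaluation of a polynomial at a scalar. -/
def scalarEval (r : ℂ) : R[X] →ₐ[ℂ] R :=
  { eval₂RingHom' (RingHom.id R) (algebraMap ℂ R r)
      (fun a => (Algebra.commutes r a).symm) with
    commutes' := fun c => by
      change eval₂ _ _ (algebraMap ℂ R[X] c) = _
      rw [Polynomial.algebraMap_apply, eval₂_C]
      rfl }

theorem scalarEval_C (r : ℂ) (a : R) : scalarEval r (C a) = a := eval₂_C _ _

theorem scalarEval_X (r : ℂ) : scalarEval r (X : R[X]) = algebraMap ℂ R r := eval₂_X _ _

theorem scalarEval_eq_sum (r : ℂ) (f : R[X]) {P : ℕ} (hP : f.natDegree < P) :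
    scalarEval r f = ∑ p ∈ Finset.range P, r ^ p • f.coeff p := by
  refine (eval₂_eq_sum_range' _ hP _).trans (Finset.sum_congr rfl fun p _ => ?_)
  rw [RingHom.id_apply, ← map_pow, ← Algebra.commutes, Algebra.smul_def]

/-- The half current, with coefficients polynomial in `log z`. -/
def alphaPoly (s : ℤ) (w : Fin 3 → ℂ) : PowerSeries ModeAlg[X] :=
  PowerSeries.mk fun n => if n = 0 then 0 else
    C (modeXs w (s * n)) + C ((1 / 2 : ℂ) • modeWX w (s * n)) * X

theorem map_polyToSeries_alphaPoly (s : ℤ) (w : Fin 3 → ℂ) :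
    PowerSeries.map (polyToSeries : ModeAlg[X] →ₐ[ℂ] PowerSeries ModeAlg) (alphaPoly s w) =
      alphaHalf s w := by
  ext1 n
  rw [PowerSeries.coeff_map, alphaPoly, alphaHalf, PowerSeries.coeff_mk, PowerSeries.coeff_mk]
  change polyToSeries _ = _
  split_ifs
  · rw [map_zero]
  · rw [map_add, map_mul, polyToSeries_C, polyToSeries_C, polyToSeries_X]
    rfl

theorem expHalf_eq_coeff (s : ℤ) (w : Fin 3 → ℂ) (n p : ℕ) :
    expHalf s w n p = (PowerSeries.coeff n (formalExp (alphaPoly s w))).coeff p := by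
  rw [expHalf, ← map_polyToSeries_alphaPoly, ← formalExp_map, PowerSeries.coeff_map]
  exact coeff_polyToSeries _ _

/-- The half current at a value of `log z`. -/
def alphaAt (s : ℤ) (w : Fin 3 → ℂ) (r : ℂ) : PowerSeries ModeAlg :=
  PowerSeries.mk fun n => if n = 0 then 0 else
    modeXs w (s * n) + (r * (1 / 2)) • modeWX w (s * n)

theorem map_scalarEval_alphaPoly (s : ℤ) (w : Fin 3 → ℂ) (r : ℂ) :
    PowerSeries.map (scalarEval r : ModeAlg[X] →ₐ[ℂ] ModeAlg) (alphaPoly s w) =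
      alphaAt s w r := by
  ext1 n
  rw [PowerSeries.coeff_map, alphaPoly, alphaAt, PowerSeries.coeff_mk, PowerSeries.coeff_mk]
  change scalarEval r _ = _
  split_ifs
  · rw [map_zero]
  · rw [map_add, map_mul, scalarEval_C, scalarEval_C, scalarEval_X, ← Algebra.commutes,
      ← Algebra.smul_def, smul_smul]

/-- At a fixed power of `z` the exponential is polynomial in `log z`. The bound `P` does not depend
on the value `r`, so the coefficients can be recovered from the values. -/
theorem exists_coeff_formalExp_alphaAt_eq_sum (s : ℤ) (w : Fin 3 → ℂ) (n : ℕ) :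
    ∃ P : ℕ, (∀ r, PowerSeries.coeff n (formalExp (alphaAt s w r)) =
      ∑ p ∈ Finset.range P, r ^ p • expHalf s w n p) ∧ ∀ p, P ≤ p → expHalf s w n p = 0 := by
  refine ⟨(PowerSeries.coeff n (formalExp (alphaPoly s w))).natDegree + 1, fun r => ?_,
    fun p hp => ?_⟩
  · rw [← map_scalarEval_alphaPoly, ← formalExp_map, PowerSeries.coeff_map]
    refine (scalarEval_eq_sum r _ (Nat.lt_succ_self _)).trans ?_
    exact Finset.sum_congr rfl fun p _ => by rw [expHalf_eq_coeff]
  · rw [expHalf_eq_coeff]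
    exact coeff_eq_zero_of_natDegree_lt hp

end Specialize

/-! ### The exchange relation at given values of the logarithms -/

open PowerSeries in
theorem smul_expVec_of_comm {B : PowerSeries ModeAlg} {a : ModeAlg}
    (h : ∀ n, ⁅a, coeff n B⁆ = 0) (v : States) (b : ℤ) :
    a • expVec B v b = expVec B (a • v) b := by
  unfold expVec
  split_ifs
  · have := coeff_formalExp_mem (Subalgebra.centralizer ℂ {a})
      (fun n => mem_centralizer_of_lie (h n)) b.toNat
    rw [← mul_smul, ← mul_smul, Subalgebra.mem_centralizer_iff _ |>.1 this _ rfl]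
  · rw [smul_zero]

theorem expVec_smul (B : PowerSeries ModeAlg) (c : ℂ) (v : States) (b : ℤ) :
    expVec B (c • v) b = c • expVec B v b := by
  unfold expVec
  split_ifs
  · rw [scalar_smul_comm]
  · rw [smul_zero]

theorem expVec_zero_right (B : PowerSeries ModeAlg) (b : ℤ) : expVec B (0 : States) b = 0 := by
  unfold expVec
  rw [smul_zero, ite_self]

theorem coeff_alphaAt (s : ℤ) (w : Fin 3 → ℂ) (r : ℂ) (n : ℕ) :
    PowerSeries.coeff n (alphaAt s w r) = if n = 0 then 0 else
      modeXs w (s * n) + (r * (1 / 2)) • modeWX w (s * n) := PowerSeries.coeff_mk _ _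

theorem coeff_alphaAt_zero (s : ℤ) (w : Fin 3 → ℂ) (r : ℂ) :
    PowerSeries.coeff 0 (alphaAt s w r) = 0 := by
  rw [coeff_alphaAt, if_pos rfl]

theorem lie_coeff_alphaAt {a : ModeAlg} {s : ℤ} {w : Fin 3 → ℂ} (r : ℂ)
    (h₁ : ∀ n : ℕ, 0 < n → ⁅a, modeXs w (s * n)⁆ = 0)
    (h₂ : ∀ n : ℕ, 0 < n → ⁅a, modeWX w (s * n)⁆ = 0) (n : ℕ) :
    ⁅a, PowerSeries.coeff n (alphaAt s w r)⁆ = 0 := by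
  rw [coeff_alphaAt]
  split_ifs with hn
  · exact lie_eq_zero_of_comm (by rw [zero_mul, mul_zero])
  · rw [commutator_add, commutator_smul, h₁ n (Nat.pos_of_ne_zero hn),
      h₂ n (Nat.pos_of_ne_zero hn), smul_zero, add_zero]

theorem modeW_eq_zero {c : Fin 3 → ℂ} (hc : ∀ k, c k = 0) : modeW c = 0 := by
  simp [modeW, hc]

theorem lie_coeff_alphaAt_self {s : ℤ} (hs : s ≠ 0) (w : Fin 3 → ℂ) (r : ℂ) (m n : ℕ) :
    ⁅PowerSeries.coeff m (alphaAt s w r), PowerSeries.coeff n (alphaAt s w r)⁆ = 0 := by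
  have hXX : ∀ m n, ⁅modeXs w m, modeXs w n⁆ = 0 := fun m n => by
    rw [lie_modeXs_modeXs, modeX_eq_zero (cross_self w), modeW_eq_zero (cross_self w), smul_zero,
      smul_zero, add_zero]
  have hXW : ∀ m n, m ≠ 0 → ⁅modeXs w m, modeWX w n⁆ = 0 := fun m n hm => by
    rw [lie_modeXs_modeWX _ _ hm, modeW_eq_zero (cross_self w), smul_zero]
  have hs' : ∀ n : ℕ, 0 < n → s * n ≠ 0 := fun n hn => mul_ne_zero hs (by exact_mod_cast hn.ne')
  refine lie_coeff_alphaAt r (fun n hn => ?_) (fun n hn => ?_) n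
  · rw [← neg_commutator_swap, lie_coeff_alphaAt r (fun m _ => hXX _ _)
      (fun m _ => hXW _ _ (hs' n hn)), neg_zero]
  · rw [← neg_commutator_swap, lie_coeff_alphaAt r (fun m hm => ?_)
      (fun m _ => lie_modeWX_modeWX _ _ _ _), neg_zero]
    rw [← neg_commutator_swap, hXW _ _ (hs' m hm), neg_zero]

theorem coeff_alphaAt_comm {s : ℤ} (hs : s ≠ 0) (w : Fin 3 → ℂ) (r : ℂ) (m n : ℕ) :
    PowerSeries.coeff m (alphaAt s w r) * PowerSeries.coeff n (alphaAt s w r) =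
      PowerSeries.coeff n (alphaAt s w r) * PowerSeries.coeff m (alphaAt s w r) :=
  sub_eq_zero.1 (lie_coeff_alphaAt_self hs w r m n)

/-- The coefficient of the central commutator of two half currents. -/
def exchangeCoeff (r t : ℂ) (n : ℕ) : ℂ := 1 / (n : ℂ) ^ 2 - 1 / (2 * (n : ℂ)) * (t - r)

/-- The bracket of two modes `x*` gives the `x` term and `1/n²`; the two mixed brackets of `x*` with
`W x` give `-t/(2n)` and `r/(2n)`, and two terms `W x` commute. -/
theorem lie_alphaAt_alphaAt (u w : Fin 3 → ℂ) (r t : ℂ) {m n : ℕ} (hm : m ≠ 0) (hn : n ≠ 0) :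
    ⁅PowerSeries.coeff m (alphaAt 1 u r), PowerSeries.coeff n (alphaAt (-1) w t)⁆ =
      bracketCoeff m (-n) • modeX (cross u w) ((m : ℤ) - n) +
        (if m = n then exchangeCoeff r t m else 0) • modeW (cross u w) := by
  have hm' : (m : ℤ) ≠ 0 := by exact_mod_cast hm
  have hn' : -(n : ℤ) ≠ 0 := by simpa using hn
  have hc : ((m : ℤ) = - -(n : ℤ) ∧ (m : ℤ) ≠ 0) ↔ m = n := by simp [hm]
  have hc' : (-(n : ℤ) = -(m : ℤ) ∧ -(n : ℤ) ≠ 0) ↔ m = n := by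
    simp [hn, eq_comm]
  have hWX : ⁅modeWX u m, modeXs w (-n)⁆ =
      (if m = n then 1 / (m : ℂ) else 0) • modeW (cross u w) := by
    have hsw : modeW (cross u w) = - modeW (cross w u) := by
      simp only [modeW, ← Finset.sum_neg_distrib]
      exact Finset.sum_congr rfl fun k _ => by rw [cross_swap, neg_smul]
    rw [← neg_commutator_swap, lie_modeXs_modeWX _ _ hn', hsw, smul_neg]
    simp only [hc, Int.cast_natCast]
  rw [coeff_alphaAt, coeff_alphaAt, if_neg hm, if_neg hn, one_mul, neg_one_mul]
  simp only [add_commutator, commutator_add, smul_commutator, commutator_smul, hWX,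
    lie_modeXs_modeXs, lie_modeXs_modeWX _ _ hm', lie_modeWX_modeWX, smul_zero, add_zero, hc, hc',
    ← sub_eq_add_neg, add_assoc]
  congr 1
  split_ifs with h
  · subst h
    simp only [exchangeCoeff, Int.cast_natCast, Int.cast_neg, smul_smul, ← add_smul]
    congr 1
    field_simp
    ring
  · simp

section Matrix

variable (u₁ u₂ u₃ : Fin 3 → ℂ) (r t : ℂ)

/-- The triple product of three vectors. -/
def tripleProduct (u₁ u₂ u₃ : Fin 3 → ℂ) : ℂ := ∑ k, cross u₁ u₂ k * u₃ k

/-- The power series `D i_{z,w} L(w/z)` at given values of the logarithms. -/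
def exchangeSeries (D r t : ℂ) : PowerSeries ℂ :=
  PowerSeries.mk fun n => if n = 0 then 0 else D * exchangeCoeff r t n

/-- `c·W` commutes with the creation half current and has the eigenvalue `c·(u₂ + u₃)` on the ket,
where `c·u₂ = 0`. -/
theorem modeW_cross_smul_expVec (b : ℤ) :
    modeW (cross u₁ u₂) • expVec (alphaAt (-1) u₂ t) (ket (expWave (u₂ + u₃))) b =
      tripleProduct u₁ u₂ u₃ • expVec (alphaAt (-1) u₂ t) (ket (expWave (u₂ + u₃))) b := by
  rw [smul_expVec_of_comm (lie_coeff_alphaAt t (fun n hn => ?_)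
    (fun n _ => lie_modeW_modeWX _ _ _)), modeW_smul_ket_expWave, expVec_smul]
  · simp only [Pi.add_apply, mul_add, Finset.sum_add_distrib, cross_dot_right, zero_add]
    rfl
  · rw [← neg_commutator_swap, lie_modeXs_modeW _ _ (by omega), neg_zero]

theorem modeX_cross_smul_expVec {m : ℤ} (hm : 0 < m) (f : Wave) (b : ℤ) :
    modeX (cross u₁ u₂) m • expVec (alphaAt (-1) u₂ t) (ket f) b = 0 := by
  rw [smul_expVec_of_comm (lie_coeff_alphaAt t (fun n _ => lie_modeX_cross_right _ _ _ _)
    (fun n _ => lie_modeX_modeWX _ _ _ _)), modeX_smul_ket _ hm, expVec_zero_right]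

/-- The mode `c·xₙ₋ₖ` in the commutator is a creation operator for `n < k`, hence has image in
`createdSpan`, and annihilates the vector for `n > k`. On the diagonal only `c·W` is left. -/
theorem alphaAt_exchange_mem (n k : ℕ) (b : ℤ) :
    (PowerSeries.coeff n (alphaAt 1 u₁ r) * PowerSeries.coeff k (alphaAt (-1) u₂ t) -
      PowerSeries.coeff k (alphaAt (-1) u₂ t) * PowerSeries.coeff n (alphaAt 1 u₁ r)) •
        expVec (alphaAt (-1) u₂ t) (ket (expWave (u₂ + u₃))) b -
      (if n = k then PowerSeries.coeff n (exchangeSeries (tripleProduct u₁ u₂ u₃) r t) •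
        expVec (alphaAt (-1) u₂ t) (ket (expWave (u₂ + u₃))) b else 0) ∈
      createdSpan (cross u₁ u₂) := by
  rw [exchangeSeries, PowerSeries.coeff_mk]
  rcases eq_or_ne n 0 with rfl | hn
  · rw [coeff_alphaAt_zero, zero_mul, mul_zero, sub_self, zero_smul, if_pos rfl, zero_smul,
      ite_self, sub_zero]
    exact Submodule.zero_mem _
  rcases eq_or_ne k 0 with rfl | hk
  · rw [coeff_alphaAt_zero, zero_mul, mul_zero, sub_self, zero_smul, if_neg hn, sub_zero]
    exact Submodule.zero_mem _
  rw [← Ring.lie_def, lie_alphaAt_alphaAt _ _ _ _ hn hk, if_neg hn, add_smul, smul_assoc,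
    smul_assoc,
    modeW_cross_smul_expVec]
  rcases lt_trichotomy n k with h | rfl | h
  · rw [if_neg h.ne, if_neg h.ne, zero_smul, add_zero, sub_zero]
    refine Submodule.smul_mem _ _ ?_
    obtain ⟨m, rfl⟩ := Nat.exists_eq_add_of_lt h
    have : (n : ℤ) - ((n + m + 1 : ℕ) : ℤ) = -((m + 1 : ℕ) : ℤ) := by push_cast; ring
    rw [this]
    exact modeX_smul_mem_createdSpan _ m.succ_pos _
  -- The numerator `m + n` of the structure constant vanishes for opposite modes, so `c·x₀` does not
  -- occur.
  · have h0 : bracketCoeff (n : ℤ) (-n) = 0 := by simp [bracketCoeff, hn]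
    rw [if_pos rfl, if_pos rfl, h0, zero_smul, zero_add, smul_smul, mul_comm, sub_self]
    exact Submodule.zero_mem _
  · rw [if_neg h.ne', if_neg h.ne', zero_smul, add_zero, sub_zero,
      modeX_cross_smul_expVec _ _ _ (by omega), smul_zero]
    exact Submodule.zero_mem _

/-- After the exchange, what remains of the creation exponential is its coefficient of index `b -
c`, and `Φ` sees it only for `b = c`. -/
theorem apply_formalExp_alphaAt {Φ : States →ₗ[ℂ] ℂ}
    (hΦ : ∀ (g : Mode) (v : States), g.degree < 0 → Φ (op g • v) = 0) (c b : ℕ) :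
    Φ (PowerSeries.coeff c (formalExp (alphaAt 1 u₁ r)) •
      PowerSeries.coeff b (formalExp (alphaAt (-1) u₂ t)) • ket (expWave (u₂ + u₃))) =
      if b = c then
        PowerSeries.coeff c (formalExp (exchangeSeries (tripleProduct u₁ u₂ u₃) r t)) *
          Φ (ket (expWave (u₂ + u₃))) else 0 := by
  have hγ : PowerSeries.coeff 0 (exchangeSeries (tripleProduct u₁ u₂ u₃) r t) = 0 := by
    rw [exchangeSeries, PowerSeries.coeff_mk, if_pos rfl]
  have hv : ∀ n, PowerSeries.coeff n (alphaAt 1 u₁ r) • ket (expWave (u₂ + u₃)) = 0 := by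
    intro n
    rw [coeff_alphaAt]
    split_ifs with hn
    · rw [zero_smul]
    · rw [add_smul, smul_assoc, modeXs_smul_ket _ (by omega), modeWX_smul_ket _ (by omega),
        smul_zero, add_zero]
  have key := coeff_formalExp_smul_expVec_sub_mem (createdSpan (cross u₁ u₂))
    (coeff_alphaAt_comm one_ne_zero u₁ r) (coeff_alphaAt_zero 1 u₁ r) hγ
    (fun k x hx => smul_mem_createdSpan (fun m _ => ?_) hx)
    (coeff_smul_expVec_sub_mem (createdSpan (cross u₁ u₂))
      (coeff_alphaAt_comm (s := -1) (by norm_num) u₂ t) (coeff_alphaAt_zero (-1) u₂ t) hγ hv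
      (alphaAt_exchange_mem u₁ u₂ u₃ r t)
      (fun k x hx => smul_mem_createdSpan (fun m _ => lie_coeff_alphaAt t
        (fun n _ => lie_modeX_cross_right _ _ _ _) (fun n _ => lie_modeX_modeWX _ _ _ _) k) hx))
    c b
  · have h := apply_createdSpan hΦ key
    rw [map_sub, sub_eq_zero, expVec_natCast] at h
    rw [h, Φ.map_smul]
    rcases lt_trichotomy b c with hbc | rfl | hbc
    · rw [if_neg hbc.ne, expVec_of_neg _ _ (by omega), map_zero, smul_zero]
    · rw [if_pos rfl, sub_self, expVec_zero, smul_eq_mul]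
    · rw [if_neg hbc.ne', ← Nat.cast_sub hbc.le, expVec_natCast]
      obtain ⟨P, hP, -⟩ := exists_coeff_formalExp_alphaAt_eq_sum (-1) u₂ (b - c)
      rw [hP, Finset.sum_smul, map_sum, Finset.sum_eq_zero, smul_zero]
      intro p _
      rw [smul_assoc, map_smul, apply_expHalf_neg_smul hΦ u₂ (by omega), smul_zero]
  · have hm := coeff_formalExp_mem (Subalgebra.centralizer ℂ {modeX (cross u₁ u₂) (-m)})
      (fun n => mem_centralizer_of_lie (lie_coeff_alphaAt (s := 1) (w := u₁) r
        (fun n _ => lie_modeX_cross_left _ _ _ _) (fun n _ => lie_modeX_modeWX _ _ _ _) n)) k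
    exact lie_eq_zero_of_comm (Subalgebra.mem_centralizer_iff _ |>.1 hm _ rfl)

end Matrix

/-! ### The correlator -/

theorem eval_coeff_formalExp_rogersSeries (D : ℂ) (x : Fin 2 → ℂ) (n : ℕ) :
    MvPolynomial.eval x (PowerSeries.coeff n (formalExp (D • rogersSeries))) =
      PowerSeries.coeff n (formalExp (exchangeSeries D (x 0) (x 1))) := by
  have h : PowerSeries.map ((MvPolynomial.aeval x : MvPolynomial (Fin 2) ℂ →ₐ[ℂ] ℂ) :
      MvPolynomial (Fin 2) ℂ →+* ℂ) (D • rogersSeries) = exchangeSeries D (x 0) (x 1) := by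
    ext n
    rw [PowerSeries.coeff_map, rogersSeries, exchangeSeries, PowerSeries.coeff_mk,
      PowerSeries.coeff_smul,
      PowerSeries.coeff_mk]
    split_ifs with hn
    · simp
    · simp [exchangeCoeff, MvPolynomial.smul_eq_C_mul]
  rw [← h, ← formalExp_map, PowerSeries.coeff_map]
  exact (MvPolynomial.coe_aeval_eq_eval x).symm ▸ rfl

theorem single_add_single_injective {p q p' q' : ℕ}
    (h : (Finsupp.single 0 p + Finsupp.single 1 q : Fin 2 →₀ ℕ) =
      Finsupp.single 0 p' + Finsupp.single 1 q') : p = p' ∧ q = q' := by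
  constructor
  · simpa using DFunLike.congr_fun h 0
  · simpa using DFunLike.congr_fun h 1

theorem apply_expHalf_expHalf {Φ : States →ₗ[ℂ] ℂ}
    (hΦ : ∀ (g : Mode) (v : States), g.degree < 0 → Φ (op g • v) = 0)
    (u₁ u₂ u₃ : Fin 3 → ℂ) (c b p q : ℕ) :
    Φ (expHalf 1 u₁ c p • expHalf (-1) u₂ b q • ket (expWave (u₂ + u₃))) =
      if b = c then MvPolynomial.coeff (Finsupp.single 0 p + Finsupp.single 1 q)
        (PowerSeries.coeff c (formalExp (tripleProduct u₁ u₂ u₃ • rogersSeries))) *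
          Φ (ket (expWave (u₂ + u₃))) else 0 := by
  obtain ⟨P, hP, hP'⟩ := exists_coeff_formalExp_alphaAt_eq_sum 1 u₁ c
  obtain ⟨Q, hQ, hQ'⟩ := exists_coeff_formalExp_alphaAt_eq_sum (-1) u₂ b
  set v := ket (expWave (u₂ + u₃)) with hv
  set g : ℕ → ℕ → ℂ := fun p q => Φ (expHalf 1 u₁ c p • expHalf (-1) u₂ b q • v) with hg
  set F : MvPolynomial (Fin 2) ℂ := ∑ p ∈ Finset.range P, ∑ q ∈ Finset.range Q,
    MvPolynomial.monomial (Finsupp.single 0 p + Finsupp.single 1 q) (g p q) with hF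
  have h1 : F = if b = c then MvPolynomial.C (Φ v) *
      PowerSeries.coeff c (formalExp (tripleProduct u₁ u₂ u₃ • rogersSeries)) else 0 := by
    -- Polynomials over the infinite field `ℂ` are determined by their values, here at `x = (log z,
    -- log w)`.
    refine MvPolynomial.funext fun x => ?_
    have e1 := apply_formalExp_alphaAt u₁ u₂ u₃ (x 0) (x 1) hΦ c b
    rw [← eval_coeff_formalExp_rogersSeries, ← hv] at e1
    have e2 : MvPolynomial.eval x F = Φ (PowerSeries.coeff c (formalExp (alphaAt 1 u₁ (x 0))) •
        PowerSeries.coeff b (formalExp (alphaAt (-1) u₂ (x 1))) • v) := by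
      rw [hP, hQ, hF]
      simp only [map_sum, Finset.sum_smul, smul_assoc, Finset.smul_sum, map_smul]
      refine Finset.sum_comm.trans
        (Finset.sum_congr rfl fun q _ => Finset.sum_congr rfl fun p _ => ?_)
      rw [← scalar_smul_comm, map_smul, MvPolynomial.eval_monomial,
        Finsupp.prod_fintype _ _ (fun i => pow_zero _), Fin.prod_univ_two]
      simp [hg]
      ring
    rw [e2, e1]
    split_ifs
    · rw [map_mul, MvPolynomial.eval_C, mul_comm]
    · rw [map_zero]
  have h2 : MvPolynomial.coeff (Finsupp.single 0 p + Finsupp.single 1 q) F = g p q := by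
    rw [hF]
    simp only [MvPolynomial.coeff_sum, MvPolynomial.coeff_monomial]
    by_cases hp : p < P
    · by_cases hq : q < Q
      · rw [Finset.sum_eq_single p, Finset.sum_eq_single q, if_pos rfl]
        · intro q' _ hne
          exact if_neg fun h => hne (single_add_single_injective h).2
        · exact fun h => absurd (Finset.mem_range.2 hq) h
        · intro p' _ hne
          exact Finset.sum_eq_zero fun q' _ =>
            if_neg fun h => hne (single_add_single_injective h).1
        · exact fun h => absurd (Finset.mem_range.2 hp) h
      · rw [show g p q = 0 by rw [hg]; simp only [hQ' q (not_lt.1 hq), zero_smul, smul_zero,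
          map_zero]]
        refine Finset.sum_eq_zero fun p' _ => Finset.sum_eq_zero fun q' hq' => if_neg fun h => ?_
        exact hq ((single_add_single_injective h).2 ▸ Finset.mem_range.1 hq')
    · rw [show g p q = 0 by rw [hg]; simp only [hP' p (not_lt.1 hp), zero_smul, map_zero]]
      refine Finset.sum_eq_zero fun p' hp' => Finset.sum_eq_zero fun q' _ => if_neg fun h => ?_
      exact hp ((single_add_single_injective h).1 ▸ Finset.mem_range.1 hp')
  rw [show Φ _ = g p q from rfl, ← h2, h1]
  split_ifs
  · rw [MvPolynomial.coeff_C_mul, mul_comm]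
  · rw [MvPolynomial.coeff_zero]

theorem correlator_eq_coeffZW {ψ : L2Y} {Ψ : States →ₗ[ℂ] ℂ} (hΨ : IsBra ψ Ψ)
    (u₁ u₂ u₃ : Fin 3 → ℂ) (a : ℤ) (p : ℕ) (b : ℤ) (q : ℕ) :
    correlator Ψ u₁ u₂ u₃ a p b q =
      coeffZW (formalExp (tripleProduct u₁ u₂ u₃ • rogersSeries)) a p b q *
        pairing ψ (Wave.mul (expWave u₁) (Wave.mul (expWave u₂) (expWave u₃))) := by
  have h0 : (Ψ.comp (expZero u₁)) (ket (expWave (u₂ + u₃))) =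
      pairing ψ (Wave.mul (expWave u₁) (Wave.mul (expWave u₂) (expWave u₃))) := by
    rw [LinearMap.comp_apply, expZero_ket, hΨ.1, mul_expWave_expWave u₂ u₃]
  rw [correlator_eq hΨ, apply_expHalf_expHalf (comp_expZero_op_smul hΨ.2 u₁), h0, coeffZW]
  by_cases hab : 0 ≤ b ∧ a = -b
  · have h1 : b.toNat = (-a).toNat := by omega
    rw [if_pos hab, if_pos (by omega), if_pos h1, h1]
  · rw [if_neg hab, zero_mul]
    split_ifs
    · omega
    · rfl
    · rfl

/-! ### Convergence of exponentials of power series -/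

section Convergence

open PowerSeries

variable {f : PowerSeries ℂ} {x : ℂ}

theorem summable_cauchyProduct {u v c : ℕ → ℂ} (hu : Summable fun n => ‖u n‖)
    (hv : Summable fun n => ‖v n‖)
    (hc : ∀ n, c n = ∑ q ∈ Finset.HasAntidiagonal.antidiagonal n, u q.1 * v q.2) :
    Summable (fun n => ‖c n‖) ∧ ∑' n, c n = (∑' n, u n) * ∑' n, v n ∧
      ∑' n, ‖c n‖ ≤ (∑' n, ‖u n‖) * ∑' n, ‖v n‖ := by
  obtain rfl : c = fun n => ∑ q ∈ Finset.HasAntidiagonal.antidiagonal n, u q.1 * v q.2 := funext hc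
  have hu' : Summable fun n => ‖‖u n‖‖ := by simpa using hu
  have hv' : Summable fun n => ‖‖v n‖‖ := by simpa using hv
  have h := tsum_mul_tsum_eq_tsum_sum_antidiagonal_of_summable_norm hu' hv'
  have hs := (summable_norm_sum_mul_antidiagonal_of_summable_norm hu' hv').of_norm
  refine ⟨summable_norm_sum_mul_antidiagonal_of_summable_norm hu hv,
    (tsum_mul_tsum_eq_tsum_sum_antidiagonal_of_summable_norm hu hv).symm, ?_⟩
  rw [h]
  refine (summable_norm_sum_mul_antidiagonal_of_summable_norm hu hv).tsum_le_tsum (fun n => ?_) hs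
  refine (norm_sum_le _ _).trans (le_of_eq ?_)
  exact Finset.sum_congr rfl fun q _ => norm_mul _ _

/-- Row `k` sums to `Sᵏ`, so summing along rows gives the exponential series. Summing along columns
gives finite sums, by triangularity. The bound `sᵏ / k!` on the rows permits the exchange. -/
theorem hasSum_exp_of_triangular {c : ℕ → ℕ → ℂ} {S : ℂ} {s : ℝ}
    (h₁ : ∀ k, Summable fun n => ‖c k n‖) (h₂ : ∀ k, ∑' n, c k n = S ^ k)
    (h₃ : ∀ k, ∑' n, ‖c k n‖ ≤ s ^ k) (h₄ : ∀ n k, n < k → c k n = 0) :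
    HasSum (fun n => ∑ k ∈ Finset.range (n + 1), (k ! : ℂ)⁻¹ * c k n) (Complex.exp S) := by
  have hF : Summable fun p : ℕ × ℕ => (p.1 ! : ℂ)⁻¹ * c p.1 p.2 := by
    refine Summable.of_norm ((summable_prod_of_nonneg fun _ => norm_nonneg _).2 ⟨fun k => ?_, ?_⟩)
    · simp only [norm_mul]
      exact (h₁ k).mul_left _
    · refine Summable.of_nonneg_of_le (fun k => tsum_nonneg fun _ => norm_nonneg _) (fun k => ?_)
        (Real.summable_pow_div_factorial s)
      simp only [norm_mul, tsum_mul_left]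
      rw [norm_inv, Complex.norm_natCast, div_eq_inv_mul]
      exact mul_le_mul_of_nonneg_left (h₃ k) (by positivity)
  have e1 : HasSum (fun k : ℕ => (k ! : ℂ)⁻¹ * S ^ k)
      (∑' p : ℕ × ℕ, (p.1 ! : ℂ)⁻¹ * c p.1 p.2) := by
    refine hF.hasSum.prod_fiberwise fun k => ?_
    have h : HasSum (c k) (S ^ k) := h₂ k ▸ (Summable.of_norm (h₁ k)).hasSum
    exact h.mul_left ((k ! : ℂ)⁻¹)
  have e2 : HasSum (fun k : ℕ => (k ! : ℂ)⁻¹ * S ^ k) (Complex.exp S) := by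
    have := NormedSpace.expSeries_div_hasSum_exp S
    rw [← Complex.exp_eq_exp_ℂ] at this
    simpa only [div_eq_inv_mul] using this
  rw [e2.unique e1]
  have e3 : HasSum (fun p : ℕ × ℕ => (p.2 ! : ℂ)⁻¹ * c p.2 p.1)
      (∑' p : ℕ × ℕ, (p.1 ! : ℂ)⁻¹ * c p.1 p.2) :=
    (Equiv.prodComm ℕ ℕ).hasSum_iff.2 hF.hasSum
  refine e3.prod_fiberwise fun n => hasSum_sum_of_ne_finset_zero fun k hk => ?_
  have := mt Finset.mem_range.2 hk
  rw [h₄ n k (by omega), mul_zero]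

theorem coeff_pow_succ_mul_pow (f : PowerSeries ℂ) (x : ℂ) (k n : ℕ) :
    coeff n (f ^ (k + 1)) * x ^ n = ∑ q ∈ Finset.HasAntidiagonal.antidiagonal n,
      (coeff q.1 (f ^ k) * x ^ q.1) * (coeff q.2 f * x ^ q.2) := by
  rw [pow_succ, coeff_mul, Finset.sum_mul]
  refine Finset.sum_congr rfl fun q hq => ?_
  rw [← Finset.HasAntidiagonal.mem_antidiagonal.1 hq, pow_add]
  ring

theorem summable_coeff_pow (hf : Summable fun n => ‖coeff n f * x ^ n‖) (k : ℕ) :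
    Summable (fun n => ‖coeff n (f ^ k) * x ^ n‖) ∧
      ∑' n, coeff n (f ^ k) * x ^ n = (∑' n, coeff n f * x ^ n) ^ k ∧
      ∑' n, ‖coeff n (f ^ k) * x ^ n‖ ≤ (∑' n, ‖coeff n f * x ^ n‖) ^ k := by
  induction k with
  | zero =>
    have h : ∀ n, coeff n (f ^ 0) * x ^ n = if n = 0 then 1 else 0 := by
      intro n
      rw [pow_zero, coeff_one]
      split_ifs with hn
      · simp [hn]
      · simp
    simp only [h]
    refine ⟨?_, ?_, ?_⟩
    · refine summable_of_ne_finset_zero (s := {0}) fun n hn => ?_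
      rw [if_neg (by simpa using hn), norm_zero]
    · rw [tsum_ite_eq, pow_zero]
    · rw [tsum_eq_single 0 fun n hn => by rw [if_neg hn, norm_zero]]
      simp
  | succ k ih =>
    obtain ⟨h1, h2, h3⟩ := ih
    obtain ⟨e1, e2, e3⟩ := summable_cauchyProduct h1 hf
      (c := fun n => coeff n (f ^ (k + 1)) * x ^ n) (coeff_pow_succ_mul_pow f x k)
    refine ⟨e1, ?_, ?_⟩
    · rw [e2, h2, pow_succ]
    · rw [pow_succ]
      exact e3.trans (mul_le_mul_of_nonneg_right h3 (tsum_nonneg fun _ => norm_nonneg _))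

theorem hasSum_coeff_formalExp (hf0 : coeff 0 f = 0)
    (hf : Summable fun n => ‖coeff n f * x ^ n‖) :
    HasSum (fun n => coeff n (formalExp f) * x ^ n) (Complex.exp (∑' n, coeff n f * x ^ n)) := by
  have h := hasSum_exp_of_triangular (fun k => (summable_coeff_pow hf k).1)
    (fun k => (summable_coeff_pow hf k).2.1) (fun k => (summable_coeff_pow hf k).2.2)
    (fun n k hk => by
      rw [coeff_of_lt_order, zero_mul]
      refine lt_of_lt_of_le ?_ (le_order_pow_of_constantCoeff_eq_zero k (by simpa using hf0))
      exact_mod_cast hk)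
  refine (congrArg (fun g => HasSum g _) (funext fun n => ?_)).mpr h
  rw [formalExp, coeff_mk, Finset.sum_mul]
  refine Finset.sum_congr rfl fun k _ => ?_
  rw [smul_eq_mul, mul_assoc]

end Convergence

theorem hasSum_exchangeSeries (D r t : ℂ) {x : ℂ} (hx : ‖x‖ < 1) :
    HasSum (fun n => PowerSeries.coeff n (exchangeSeries D r t) * x ^ n)
      (D * rogersL x (t - r)) := by
  have h1 : HasSum (fun n : ℕ => x ^ (n + 1) / ((n : ℂ) + 1) ^ 2)
      (∑' n : ℕ, x ^ (n + 1) / ((n : ℂ) + 1) ^ 2) := by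
    refine (Summable.of_norm_bounded (g := fun n : ℕ => ‖x‖ ^ (n + 1))
      ((summable_nat_add_iff 1).2 (summable_geometric_of_lt_one (norm_nonneg x) hx))
      fun n => ?_).hasSum
    rw [norm_div, norm_pow, norm_pow]
    refine div_le_self (by positivity) (one_le_pow₀ ?_)
    have : ‖((n : ℂ) + 1)‖ = (n : ℝ) + 1 := by
      rw [← Nat.cast_succ, Complex.norm_natCast, Nat.cast_succ]
    rw [this]
    linarith [n.cast_nonneg (α := ℝ)]
  -- The extra term at `n = 0` is `1 / 0 = 0`; this aligns the index with that of the logarithm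
  -- series.
  have h2 : HasSum (fun n : ℕ => x ^ n / (n : ℂ) ^ 2)
      (∑' n : ℕ, x ^ (n + 1) / ((n : ℂ) + 1) ^ 2) := by
    rw [← hasSum_nat_add_iff' 1]
    simpa using h1
  have h3 := (h2.sub ((Complex.hasSum_taylorSeries_neg_log hx).mul_left
    ((t - r) / 2))).mul_left D
  have e : D * rogersL x (t - r) = D * ((∑' n : ℕ, x ^ (n + 1) / ((n : ℂ) + 1) ^ 2) -
      (t - r) / 2 * -Complex.log (1 - x)) := by
    unfold rogersL
    ring
  rw [e]
  refine (congrArg (fun g => HasSum g _) (funext fun n => ?_)).mpr h3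
  rw [exchangeSeries, PowerSeries.coeff_mk]
  split_ifs with hn
  · simp [hn]
  · unfold exchangeCoeff
    ring

theorem hasSum_formalExp_rogersSeries (D : ℂ) {z w lz lw : ℂ} (hzw : ‖w‖ < ‖z‖) :
    HasSum (fun n : ℕ => MvPolynomial.eval ![lz, lw]
      (PowerSeries.coeff n (formalExp (D • rogersSeries))) * (w / z) ^ n)
      (Complex.exp (D * rogersL (w / z) (lw - lz))) := by
  have hx : ‖w / z‖ < 1 := by
    rw [norm_div]
    exact (div_lt_one ((norm_nonneg w).trans_lt hzw)).2 hzw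
  have h := hasSum_exchangeSeries D lz lw hx
  rw [← h.tsum_eq]
  simp only [eval_coeff_formalExp_rogersSeries]
  refine hasSum_coeff_formalExp ?_ h.summable.norm
  simp [exchangeSeries]

/-! ### The volume of a tetrahedron -/

/-- The corner simplex `{x ≥ 0, ∑ xᵢ ≤ r}`. -/
def cornerSimplex (n : ℕ) (r : ℝ) : Set (Fin n → ℝ) := {x | (∀ i, 0 ≤ x i) ∧ ∑ i, x i ≤ r}

theorem isClosed_cornerSimplex (n : ℕ) (r : ℝ) : IsClosed (cornerSimplex n r) := by
  have h : cornerSimplex n r = (⋂ i, {x | 0 ≤ x i}) ∩ {x | ∑ i, x i ≤ r} := by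
    ext x
    simp [cornerSimplex]
  rw [h]
  exact (isClosed_iInter fun i => isClosed_le continuous_const (continuous_apply i)).inter
    (isClosed_le (continuous_finsetSum _ fun i _ => continuous_apply i) continuous_const)

theorem cornerSimplex_of_neg (n : ℕ) {r : ℝ} (hr : r < 0) : cornerSimplex n r = ∅ := by
  refine Set.eq_empty_of_forall_notMem fun x hx => ?_
  exact absurd (hx.2.trans_lt hr) (Finset.sum_nonneg fun i _ => hx.1 i).not_gt

/-- Slicing by the first coordinate: the slice at `t` is a corner simplex of size `r - t`, and `(r -
t)ⁿ / n!` integrates to `rⁿ⁺¹ / (n + 1)!` over `[0, r]`. -/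
theorem volume_cornerSimplex (n : ℕ) {r : ℝ} (hr : 0 ≤ r) :
    volume (cornerSimplex n r) = ENNReal.ofReal (r ^ n / n !) := by
  induction n generalizing r with
  | zero =>
    have : cornerSimplex 0 r = Set.univ := Set.eq_univ_of_forall fun x => by
      simp [cornerSimplex, hr]
    rw [this, volume_pi, Measure.pi_of_empty]
    simp
  | succ n ih =>
    let e := MeasurableEquiv.piFinSuccAbove (fun _ : Fin (n + 1) => ℝ) 0
    let s : Set (ℝ × (Fin n → ℝ)) := {p | 0 ≤ p.1 ∧ p.2 ∈ cornerSimplex n (r - p.1)}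
    have hs : cornerSimplex (n + 1) r = e ⁻¹' s := by
      ext x
      simp only [cornerSimplex, s, e, Set.mem_preimage, Set.mem_ofPred_eq, Fin.forall_fin_succ,
        Fin.sum_univ_succ, MeasurableEquiv.piFinSuccAbove_apply, Fin.insertNthEquiv_symm_apply,
        Fin.removeNth_apply, Fin.zero_succAbove, and_assoc, le_sub_iff_add_le']
    have hm : MeasurableSet s := by
      have : s = e.symm ⁻¹' cornerSimplex (n + 1) r := by
        rw [hs, ← Set.preimage_comp]
        simp
      rw [this]
      exact e.symm.measurable (isClosed_cornerSimplex _ _).measurableSet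
    have h1 : volume (cornerSimplex (n + 1) r) = volume s := by
      rw [hs]
      exact (volume_preserving_piFinSuccAbove (fun _ : Fin (n + 1) => ℝ) 0).measure_preimage_equiv s
    have h2 : ∀ t : ℝ, volume (Prod.mk t ⁻¹' s) =
        (Set.Icc 0 r).indicator (fun t => ENNReal.ofReal ((r - t) ^ n / n !)) t := by
      intro t
      by_cases ht : t ∈ Set.Icc 0 r
      · rw [Set.indicator_of_mem ht, ← ih (sub_nonneg.2 ht.2)]
        congr 1
        ext x
        exact ⟨fun h => h.2, fun h => ⟨ht.1, h⟩⟩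
      · rw [Set.indicator_of_notMem ht]
        have : Prod.mk t ⁻¹' s = ∅ := by
          refine Set.eq_empty_of_forall_notMem fun x hx => ht ⟨hx.1, ?_⟩
          by_contra h
          have hx2 : x ∈ cornerSimplex n (r - t) := hx.2
          rw [cornerSimplex_of_neg n (by linarith)] at hx2
          exact hx2
        rw [this, measure_empty]
    rw [h1, Measure.volume_eq_prod, Measure.prod_apply hm]
    simp only [h2]
    rw [lintegral_indicator measurableSet_Icc, ← ofReal_integral_eq_lintegral_ofReal,
      integral_Icc_eq_integral_Ioc, ← intervalIntegral.integral_of_le hr,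
      intervalIntegral.integral_div, intervalIntegral.integral_comp_sub_left (fun x => x ^ n)]
    · congr 1
      rw [sub_self, sub_zero, integral_pow, Nat.factorial_succ]
      push_cast
      have : ((n : ℝ) + 1) ≠ 0 := by positivity
      have : (n ! : ℝ) ≠ 0 := by positivity
      field_simp
      simp
    · exact (Continuous.integrableOn_Icc (by fun_prop))
    · refine (ae_restrict_iff' measurableSet_Icc).2 (ae_of_all _ fun t ht => ?_)
      exact div_nonneg (pow_nonneg (sub_nonneg.2 ht.2) _) (Nat.cast_nonneg _)

theorem image_cornerSimplex {E : Type} [AddCommGroup E] [Module ℝ E] (T : (Fin 3 → ℝ) →ₗ[ℝ] E) :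
    T '' cornerSimplex 3 1 =
      convexHull ℝ {0, T (Pi.single 0 1), T (Pi.single 1 1), T (Pi.single 2 1)} := by
  have hT : ∀ x, T x = ∑ i, x i • T (Pi.single i 1) := fun x => by
    conv_lhs => rw [pi_eq_sum_univ' x]
    simp [map_sum]
  refine Set.Subset.antisymm ?_ (convexHull_min ?_ ?_)
  · rintro _ ⟨x, hx, rfl⟩
    -- The image of `x` is a convex combination of the vertices, with the missing weight `1 - ∑ xᵢ`
    -- placed at the vertex `0`.
    have h := (convex_convexHull ℝ ({0, T (Pi.single 0 1), T (Pi.single 1 1),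
      T (Pi.single 2 1)} : Set E)).sum_mem (t := Finset.univ)
      (w := (Fin.cons (1 - ∑ i, x i) x : Fin 4 → ℝ))
      (z := (Fin.cons 0 fun i => T (Pi.single i 1) : Fin 4 → E)) ?_ ?_ ?_
    · rw [Fin.sum_univ_succ] at h
      simp only [Fin.cons_zero, Fin.cons_succ, smul_zero, zero_add] at h
      rwa [← hT x] at h
    · intro i _
      refine Fin.cases ?_ (fun i => ?_) i
      · simpa using hx.2
      · simpa using hx.1 i
    · rw [Fin.sum_univ_succ]
      simp
    · intro i _
      apply subset_convexHull
      refine Fin.cases (Or.inl rfl) (fun i => ?_) i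
      rw [Fin.cons_succ]
      fin_cases i <;> simp
  · have h0 : ∀ i : Fin 3, T (Pi.single i 1) ∈ T '' cornerSimplex 3 1 := fun i =>
      ⟨_, ⟨fun j => by by_cases h : j = i <;> simp [h], by simp⟩, rfl⟩
    rintro y (rfl | rfl | rfl | rfl)
    · exact ⟨0, ⟨fun _ => le_rfl, by simp⟩, map_zero T⟩
    · exact h0 0
    · exact h0 1
    · exact h0 2
  · have hconv : Convex ℝ (cornerSimplex 3 1) := by
      intro x hx y hy a b ha hb hab
      refine ⟨fun i => add_nonneg (mul_nonneg ha (hx.1 i)) (mul_nonneg hb (hy.1 i)), ?_⟩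
      have : ∑ i, (a • x + b • y) i = a * ∑ i, x i + b * ∑ i, y i := by
        simp [Finset.sum_add_distrib, Finset.mul_sum]
      rw [this]
      nlinarith [mul_le_mul_of_nonneg_left hx.2 ha, mul_le_mul_of_nonneg_left hy.2 hb]
    exact hconv.linear_image T

/-- The linear map with `eᵢ ↦ nᵢ` carries the corner simplex of volume `1/6` to the tetrahedron and
scales volume by `|det|`; Euclidean space has the same volume as the product `ℝ³`. -/
theorem volume_tetrahedron (n₁ n₂ n₃ : Fin 3 → ℤ) :
    volume (convexHull ℝ {0, toPoint n₁, toPoint n₂, toPoint n₃}) =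
      ENNReal.ofReal (|((Matrix.of ![n₁, n₂, n₃]).det : ℝ)| / 6) := by
  let A : Matrix (Fin 3) (Fin 3) ℝ := (Matrix.of ![n₁, n₂, n₃]).map (Int.cast : ℤ → ℝ)
  let L : (Fin 3 → ℝ) →ₗ[ℝ] (Fin 3 → ℝ) := Matrix.toLin' A.transpose
  have hA : A.det = ((Matrix.of ![n₁, n₂, n₃]).det : ℝ) :=
    (RingHom.map_det (Int.castRingHom ℝ) (Matrix.of ![n₁, n₂, n₃])).symm
  let T : (Fin 3 → ℝ) →ₗ[ℝ] EuclideanSpace ℝ (Fin 3) :=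
    (WithLp.linearEquiv 2 ℝ (Fin 3 → ℝ)).symm.toLinearMap.comp L
  have hL : ∀ i, L (Pi.single i 1) = fun j => ((![n₁, n₂, n₃] i j : ℤ) : ℝ) := by
    intro i
    ext j
    simp [L, A]
  have hT : ∀ i, T (Pi.single i 1) = toPoint (![n₁, n₂, n₃] i) := fun i => by
    change WithLp.toLp 2 (L (Pi.single i 1)) = _
    rw [hL]
    rfl
  have h := image_cornerSimplex T
  rw [hT, hT, hT] at h
  change _ = convexHull ℝ {0, toPoint n₁, toPoint n₂, toPoint n₃} at h
  rw [← h, ← (PiLp.volume_preserving_toLp (Fin 3)).measure_preimage_equiv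
    (f := MeasurableEquiv.toLp 2 (Fin 3 → ℝ))]
  have hpre : (MeasurableEquiv.toLp 2 (Fin 3 → ℝ)) ⁻¹' (T '' cornerSimplex 3 1) =
      L '' cornerSimplex 3 1 := by
    ext x
    constructor
    · rintro ⟨y, hy, hyx⟩
      exact ⟨y, hy, congrArg WithLp.ofLp hyx⟩
    · rintro ⟨y, hy, rfl⟩
      exact ⟨y, hy, rfl⟩
  rw [hpre, Measure.addHaar_image_linearMap, volume_cornerSimplex 3 zero_le_one,
    LinearMap.det_toLin', Matrix.det_transpose, hA, ← ENNReal.ofReal_mul (abs_nonneg _)]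
  norm_num [Nat.factorial, div_eq_mul_inv]

theorem six_mul_orientedVol (n₁ n₂ n₃ : Fin 3 → ℤ) :
    6 * orientedVol n₁ n₂ n₃ = ((Matrix.of ![n₁, n₂, n₃]).det : ℝ) := by
  rw [orientedVol, volume_tetrahedron, ENNReal.toReal_ofReal (by positivity)]
  generalize (Matrix.of ![n₁, n₂, n₃]).det = d
  have h : ((SignType.sign d : ℤ) : ℝ) * |(d : ℝ)| = d := by
    exact_mod_cast sign_mul_abs d
  linarith

theorem tripleProduct_winding (κ : ℂ) (n₁ n₂ n₃ : Fin 3 → ℤ) :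
    tripleProduct (winding κ n₁) (winding κ n₂) (winding κ n₃) =
      κ ^ 3 * (6 * orientedVol n₁ n₂ n₃ : ℝ) := by
  rw [six_mul_orientedVol, Matrix.det_fin_three]
  simp [tripleProduct, cross, Fin.sum_univ_three, eps, winding]
  ring

end HDFT

end

/-! ### The proposition -/

theorem proposition1 (κ : ℂ) (n₁ n₂ n₃ : Fin 3 → ℤ) (ψ : HDFT.L2Y) :
    (∃! Ψ : HDFT.States →ₗ[ℂ] ℂ, HDFT.IsBra ψ Ψ) ∧
    (∀ Ψ : HDFT.States →ₗ[ℂ] ℂ, HDFT.IsBra ψ Ψ →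
      ∀ (a : ℤ) (p : ℕ) (b : ℤ) (q : ℕ),
        HDFT.correlator Ψ (HDFT.winding κ n₁) (HDFT.winding κ n₂) (HDFT.winding κ n₃) a p b q =
          HDFT.coeffZW (HDFT.formalExp
            ((κ ^ 3 * (6 * HDFT.orientedVol n₁ n₂ n₃ : ℝ)) • HDFT.rogersSeries)) a p b q *
          HDFT.pairing ψ (HDFT.Wave.mul (HDFT.expWave (HDFT.winding κ n₁))
            (HDFT.Wave.mul (HDFT.expWave (HDFT.winding κ n₂))
              (HDFT.expWave (HDFT.winding κ n₃))))) ∧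
    (∀ z w lz lw : ℂ, Complex.exp lz = z → Complex.exp lw = w → ‖w‖ < ‖z‖ →
      HasSum (fun n : ℕ => MvPolynomial.eval ![lz, lw] (PowerSeries.coeff n (HDFT.formalExp
          ((κ ^ 3 * (6 * HDFT.orientedVol n₁ n₂ n₃ : ℝ)) • HDFT.rogersSeries))) * (w / z) ^ n)
        (Complex.exp (κ ^ 3 * (6 * HDFT.orientedVol n₁ n₂ n₃ : ℝ) *
          HDFT.rogersL (w / z) (lw - lz)))) := by
  refine ⟨?_, fun Ψ hΨ a p b q => ?_, fun z w lz lw _ _ hzw =>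
    HDFT.hasSum_formalExp_rogersSeries _ hzw⟩
  · obtain ⟨Ψ, hΨ⟩ := HDFT.exists_isBra ψ
    exact ⟨Ψ, hΨ, fun Φ hΦ => hΦ.unique hΨ⟩
  · rw [← HDFT.tripleProduct_winding]
    exact HDFT.correlator_eq_coeffZW hΨ _ _ _ a p b q
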